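/- **Proposition 2.2.** Let $k$ be an algebraically closed field of characteristic different from $2,3,5$. By (the complete local ring of) a curve singularity we mean a complete Noetherian reduced local $k$-algebra $R$ of Krull dimension one with residue field $k$. Its branches are the irreducible components of $\operatorname{Spec} R$; if there are $m$ of them and $\widetilde R$ is the normalisation of $R$ (its integral closure in its total ring of fractions), the genus of $R$ is $g=\delta-m+1$ with $\delta=\dim_k\widetilde R/R$. The ring $R$ is Gorenstein if $R/xR$ has simple socle for some nonzerodivisor $x$ in the maximal ideal. Write $\widetilde{\mathfrak m}=(t_1,\dots,t_m)\subset k[[t_1]]\oplus\dots\oplus k[[t_m]]$. For every $m\ge 2$ there are, up to isomorphism of $k$-algebras, exactly two Gorenstein curve singularities of genus two with $m$ branches, the following two, which are not isomorphic to each other. * *Type I*: the $k$-subalgebra of $k[[t_1]]\oplus\dots\oplus k[[t_m]]$ generated by $\widetilde{\mathfrak m}^4$ and $$x_i=t_i\oplus t_m^3\quad(1\le i\le m-1),\qquad x_m=t_m^2 .$$ * *Type II*: the $k$-subalgebra of $k[[t_1]]\oplus\dots\oplus k[[t_m]]$ generated by $\widetilde{\mathfrak m}^3$ and $$x_1=t_1\oplus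 t_m,\qquad x_i=t_i\oplus t_m^2\quad(2\le i\le m-1).$$ (Here $t_i\oplus t_m^3$ has entry $t_i$ in the $i$-th factor, $t_m^3$ in the $m$-th factor, and $0$ elsewhere; similarly for the others.) In terms of these coordinates the two rings are given by equations as follows: the $k$-algebra homomorphism from the power series ring in the listed variables to $k[[t_1]]\oplus\dots\oplus k[[t_m]]$ that sends each variable to the element of the same name has image the ring in question, and kernel the listed ideal. * Type I, variables $x_1,\dots,x_m$: the ideal is $\langle x_2(x_2^3-x_1^2)\rangle$ if $m=2$ ($D_5$); $\langle x_3(x_1-x_2),\,x_3^3-x_1x_2\rangle$ if $m=3$; and, if $m\ge4$, it is generated by $x_i(x_j-x_l)$ and $x_m(x_i-x_j)$ for pairwise different $i,j,l\in\{1,\dots,m-1\}$, together with $x_m^3-x_1x_2$. * Type II, variables $x_1$ and $y=0\oplus t_2^3$ if $m=2$, and $x_1,\dots,x_{m-1}$ if $m\ge3$: the ideal is $\langle y(y-x_1^3)\rangle$ if $m=2$ ($A_5$); $\langle x_1x_2(x_2-x_1^2)\rangle$ if $m=3$ ($D_6$); and, if $m\ge4$, it is generated by $x_3(x_1^2-x_2)$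 and by $x_i(x_j-x_l)$ for $1\le i<j<l\le m-1$ or $1<j<l<i\le m-1$. -/

import Mathlib

open scoped PowerSeries

/-- The complete local ring of a germ of reduced curve at a point with residue field `k`:
a complete Noetherian reduced local `k`-algebra of Krull dimension one whose residue field is `k`.
(A local ring of dimension one is automatically equidimensional.) -/
structure IsCompleteCurveGerm (k R : Type*) [Field k] [CommRing R] [Algebra k R] : Prop where
  [isLocalRing : IsLocalRing R]
  isNoetherianRing : IsNoetherianRing R
  isReduced : IsReduced R
  isAdicComplete : IsAdicComplete (IsLocalRing.maximalIdeal R) R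
  ringKrullDim_eq_one : ringKrullDim R = 1
  residue_bijective : Function.Bijective (algebraMap k (IsLocalRing.ResidueField R))

/-- The number of branches of a curve germ with complete local ring `R`: the number of irreducible
components of `Spec R`. -/
noncomputable def numBranches (R : Type*) [CommRing R] : ℕ :=
  (minimalPrimes R).ncard

/-- The normalisation of a reduced ring `R`: its integral closure in the total ring of fractions
(the localisation of `R` at all its nonzerodivisors). -/
noncomputable abbrev Normalisation (R : Type*) [CommRing R] : Subalgebra R (FractionRing R) :=
  integralClosure R (FractionRing R)

/-- The delta invariant: the `k`-dimension of `R̃ / R`, with `R̃` the normalisation of `R`. -/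
noncomputable def deltaInvariant (k R : Type*) [Field k] [CommRing R] [Algebra k R] : ℕ :=
  Module.finrank k
    (Normalisation R ⧸ LinearMap.range (Algebra.linearMap R (Normalisation R)))

/-- The genus `δ - m + 1` of a curve germ with `m` branches. -/
noncomputable def singularityGenus (k R : Type*) [Field k] [CommRing R] [Algebra k R] : ℤ :=
  (deltaInvariant k R : ℤ) - (numBranches R : ℤ) + 1

/-- A Noetherian local ring `R` of dimension one is Gorenstein if, for some nonzerodivisor `x` in
the maximal ideal, the zero-dimensional local ring `R / xR` is Gorenstein, that is, its socle
(the elements killed by the maximal ideal) is a simple module. -/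
def IsGorensteinDimOne (R : Type*) [CommRing R] [IsLocalRing R] : Prop :=
  ∃ x ∈ IsLocalRing.maximalIdeal R, x ∈ nonZeroDivisors R ∧
    IsSimpleModule R (Submodule.torsionBySet R (R ⧸ Ideal.span {x})
      (IsLocalRing.maximalIdeal R : Set R))

/-- `R` is the complete local ring of a Gorenstein curve singularity of genus two with
`m` branches. -/
structure IsGorensteinGenusTwo (k R : Type*) [Field k] [CommRing R] [Algebra k R]
    (m : ℕ) : Prop extends IsCompleteCurveGerm k R where
  numBranches_eq : numBranches R = m
  genus_eq_two : singularityGenus k R = 2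
  gorenstein : IsGorensteinDimOne R

section Models

variable (k : Type*) [Field k]

/-- The ideal `m̃ ^ N` of `k⟦t_1⟧ × ⋯ × k⟦t_m⟧`, where `m̃ = (t_1, …, t_m)`, as a set. -/
def radicalPow (m N : ℕ) : Set (Fin m → k⟦X⟧) :=
  {f | ∀ j, (PowerSeries.X : k⟦X⟧) ^ N ∣ f j}

/-- Coordinates on the type I singularity (indices start at `0`):
`x_i = t_i ⊕ t_m ^ 3` for `1 ≤ i ≤ m - 1`, and `x_m = t_m ^ 2`.
`paramI k m i j` is the component of `x_i` on the branch with parameter `t_j`. -/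
noncomputable def paramI (m : ℕ) (i : Fin m) : Fin m → k⟦X⟧ := fun j =>
  if i.val + 1 = m then
    if j = i then PowerSeries.X ^ 2 else 0
  else if j = i then PowerSeries.X
  else if j.val + 1 = m then PowerSeries.X ^ 3
  else 0

/-- Coordinates on the type II singularity (indices start at `0`):
`x_1 = t_1 ⊕ t_m`, and `x_i = t_i ⊕ t_m ^ 2` for `2 ≤ i ≤ m - 1`. -/
noncomputable def paramII (m : ℕ) (i : Fin (m - 1)) : Fin m → k⟦X⟧ := fun j =>
  if j.val = i.val then PowerSeries.X
  else if j.val + 1 = m then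
    if i.val = 0 then PowerSeries.X else PowerSeries.X ^ 2
  else 0

/-- The type I singularity with `m` branches: the subalgebra of `k⟦t_1⟧ × ⋯ × k⟦t_m⟧` containing
`m̃ ^ 4` and generated modulo `m̃ ^ 4` by the coordinates `paramI`. -/
noncomputable def typeI (m : ℕ) : Subalgebra k (Fin m → k⟦X⟧) :=
  Algebra.adjoin k (Set.range (paramI k m) ∪ radicalPow k m 4)

/-- The type II singularity with `m` branches: the subalgebra of `k⟦t_1⟧ × ⋯ × k⟦t_m⟧` containing
`m̃ ^ 3` and generated modulo `m̃ ^ 3` by the coordinates `paramII`. -/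
noncomputable def typeII (m : ℕ) : Subalgebra k (Fin m → k⟦X⟧) :=
  Algebra.adjoin k (Set.range (paramII k m) ∪ radicalPow k m 3)

/-- The subalgebra `S` of `k⟦t_1⟧ × ⋯ × k⟦t_m⟧` is the complete local ring at the origin of the
subscheme of affine `n`-space with ideal `J`, and `x` are the coordinates: the homomorphism
`k⟦X_1, …, X_n⟧ → k⟦t_1⟧ × ⋯ × k⟦t_m⟧` with `X_i ↦ x_i` has image `S` and kernel `J`. -/
def HasEquations {k : Type*} [Field k] {m n : ℕ} (S : Subalgebra k (Fin m → k⟦X⟧))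
    (x : Fin n → Fin m → k⟦X⟧) (J : Ideal (MvPowerSeries (Fin n) k)) : Prop :=
  ∃ φ : MvPowerSeries (Fin n) k →ₐ[k] (Fin m → k⟦X⟧),
    (∀ i, φ (MvPowerSeries.X i) = x i) ∧ φ.range = S ∧ RingHom.ker φ = J

/-- Equations of the type I singularity with `m ≥ 4` branches: `x_i (x_j - x_l)`,
`x_m (x_i - x_j)` for distinct `i, j, l ∈ {1, …, m - 1}`, and `x_m ^ 3 - x_1 x_2`. -/
noncomputable def equationsI (m : ℕ) (hm : 4 ≤ m) : Ideal (MvPowerSeries (Fin m) k) :=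
  let x : Fin m → MvPowerSeries (Fin m) k := MvPowerSeries.X
  let last : Fin m := ⟨m - 1, by omega⟩
  Ideal.span
    ({f | ∃ i j l : Fin m, i ≠ last ∧ j ≠ last ∧ l ≠ last ∧ i ≠ j ∧ i ≠ l ∧ j ≠ l ∧
        f = x i * (x j - x l)} ∪
      {f | ∃ i j : Fin m, i ≠ last ∧ j ≠ last ∧ i ≠ j ∧ f = x last * (x i - x j)} ∪
      {x last ^ 3 - x ⟨0, by omega⟩ * x ⟨1, by omega⟩})

/-- Equations of the type II singularity with `m ≥ 4` branches: `x_3 (x_1 ^ 2 - x_2)`, and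
`x_i (x_j - x_l)` for `1 ≤ i < j < l ≤ m - 1` or `1 < j < l < i ≤ m - 1`. -/
noncomputable def equationsII (m : ℕ) (hm : 4 ≤ m) : Ideal (MvPowerSeries (Fin (m - 1)) k) :=
  let x : Fin (m - 1) → MvPowerSeries (Fin (m - 1)) k := MvPowerSeries.X
  Ideal.span
    ({x ⟨2, by omega⟩ * (x ⟨0, by omega⟩ ^ 2 - x ⟨1, by omega⟩)} ∪
      {f | ∃ i j l : Fin (m - 1), ((i < j ∧ j < l) ∨ (0 < j.val ∧ j < l ∧ l < i)) ∧
        f = x i * (x j - x l)})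

end Models

/-! Write `T` for the product of the `m` rings `k⟦t_i⟧` and `r` for its ideal `(t_1, …, t_m)`. The
total fraction ring of a germ `R` as in the theorem is a finite product of fields, one per branch.
If the normalisation is finite, each of its factors is a complete discrete valuation ring with
coefficient field `k`, so `R` embeds in `T` with codimension `δ`
(`IsCompleteCurveGerm.exists_algHom_pi`). Genus two means codimension `m + 1`. Since `R` is local,
`m - 1` of these conditions say that the values at the origin agree, and two linear conditions are
left.

The Gorenstein property enters as follows: modulo `S`, the elements of `T` multiplying the maximal
ideal of `S` into `S` form a space of dimension at most one (`HasSimpleSocle`). This forbids `r ^ 2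
⊆ S` and confines the two conditions to orders at most three (`IsBranchGlueing.exists_functionals`):
with `f_n` the vector of `n`-th coefficients, they are `a ⬝ᵥ f_1 = 0` and `b ⬝ᵥ f_3 + c ⬝ᵥ f_2 + e
⬝ᵥ f_1 = 0`. Closure under multiplication then restricts the supports. If `b ≠ 0`, then `a`, `b`,
`c` live on one branch, which is cuspidal. If `b = 0`, then `a` and `c` live on one or two branches,
and the simple socle excludes one. The simple socle also makes the entries of `e` on all other
branches nonzero, so that a change of parameter `t ↦ u t + γ t ^ 2` on each branch brings `S` to
`glueI` or `glueII`. These are types I and II written as linear conditions (`typeI_eq_glueI`,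
`typeII_eq_glueII`), and in this form the converse is a computation with coefficients. The types
differ because every branch of type II is smooth.

For the equations, let `J` be the listed ideal and `φ` the parametrisation. Choose `z` whose image
lives on the last branch only and such that modulo `J + (z)` the ring is a union of coordinate axes:
`z = x_m` in type I, `z = x_1 x_2` in type II with `m ≥ 3`. An element of the kernel is then `u + w
z` with `u ∈ J` and `w` vanishing on the last branch, and Nakayama's lemma shows that the kernel of
the last branch is contained in `(J : z)`. -/

/-! ### Power series rings: recognition by a uniformiser, changes of parameter. -/

namespace PowerSeries

/-- Each member of such a family is divisible by every power of `X`. This is the coinduction by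
which identities between maps defined digit by digit are verified. -/
lemma eq_zero_of_forall_exists_eq_X_mul {R α : Type*} [CommRing R] (D : α → R⟦X⟧)
    (h : ∀ x, ∃ y, D x = X * D y) (x : α) : D x = 0 := by
  ext n
  induction n generalizing x with
  | zero => obtain ⟨y, hy⟩ := h x; simp [hy]
  | succ n ih => obtain ⟨y, hy⟩ := h x; simpa [hy, coeff_succ_X_mul] using ih y

lemma exists_eq_C_add_X_mul {R : Type*} [CommRing R] (f : R⟦X⟧) :
    ∃ g : R⟦X⟧, f = C (coeff 0 f) + X * g := by
  refine ⟨mk fun n => coeff (n + 1) f, ?_⟩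
  ext n
  cases n <;> simp [coeff_succ_X_mul]

lemma exists_eq_add_X_pow_four_mul {R : Type*} [CommRing R] (f : R⟦X⟧) :
    ∃ g : R⟦X⟧, f = C (coeff 0 f) + C (coeff 1 f) * X + C (coeff 2 f) * X ^ 2
      + C (coeff 3 f) * X ^ 3 + X ^ 4 * g := by
  refine ⟨mk fun n => coeff (n + 4) f, ?_⟩
  ext n
  rcases n with _ | _ | _ | _ | n <;>
    simp [coeff_C, coeff_X_pow, coeff_X_pow_mul']

/-- A ring which is complete and separated for the topology of a nonzerodivisor `π`, with
coefficient field `k` modulo `π`, is the ring of power series in `π`. -/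
theorem exists_algEquiv_apply_eq_X {k A : Type*} [Field k] [CommRing A] [Algebra k A] (π : A)
    (hπ : π ∈ nonZeroDivisors A) (hunit : ¬ IsUnit π)
    (hdec : ∀ a : A, ∃ c : k, ∃ b : A, a = algebraMap k A c + π * b)
    (hsep : ∀ a : A, (∀ n, π ^ n ∣ a) → a = 0)
    (hprec : ∀ c : ℕ → k, ∃ a : A, ∀ n,
      π ^ n ∣ a - ∑ i ∈ Finset.range n, algebraMap k A (c i) * π ^ i) :
    ∃ e : A ≃ₐ[k] k⟦X⟧, e π = X := by
  have hc : ∀ c : k, π ∣ algebraMap k A c → c = 0 := by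
    intro c hc
    by_contra h
    exact hunit (isUnit_of_dvd_unit hc ((IsUnit.mk0 c h).map (algebraMap k A)))
  choose r s hrs using hdec
  have huniq : ∀ a c b, a = algebraMap k A c + π * b → r a = c ∧ s a = b := by
    intro a c b h
    have h1 := hrs a
    have hr : r a = c := by
      have : r a - c = 0 := hc _ ⟨b - s a, by rw [map_sub]; linear_combination h - h1⟩
      exact sub_eq_zero.mp this
    refine ⟨hr, ?_⟩
    rw [hr] at h1
    have : π * (s a - b) = 0 := by linear_combination h - h1
    have := (mul_left_mem_nonZeroDivisors_eq_zero_iff hπ).mp this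
    exact sub_eq_zero.mp this
  -- The digits of `a` in base `π`: `r` gives the digit, `s` the remaining quotient. By uniqueness
  -- of the decomposition, identities for `ψ` reduce to comparing one digit and recursing.
  let ψ : A → k⟦X⟧ := fun a => mk fun n => r (s^[n] a)
  have hψ : ∀ a, ψ a = C (r a) + X * ψ (s a) := by
    intro a
    ext n
    cases n <;> simp [ψ, coeff_succ_X_mul]
  have hψ' : ∀ c b, ψ (algebraMap k A c + π * b) = C c + X * ψ b := by
    intro c b
    obtain ⟨h1, h2⟩ := huniq _ c b rfl
    rw [hψ, h1, h2]
  have h0 : ψ 0 = 0 := by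
    refine eq_zero_of_forall_exists_eq_X_mul (fun _ : Unit => ψ 0) (fun _ => ⟨(), ?_⟩) ()
    have := hψ' 0 0
    simpa using this
  have halg : ∀ c, ψ (algebraMap k A c) = C c := by
    intro c
    have := hψ' c 0
    simpa [h0] using this
  have hadd : ∀ a b, ψ (a + b) = ψ a + ψ b := by
    intro a b
    refine sub_eq_zero.mp (eq_zero_of_forall_exists_eq_X_mul
      (fun p : A × A => ψ (p.1 + p.2) - (ψ p.1 + ψ p.2)) (fun p => ⟨(s p.1, s p.2), ?_⟩) (a, b))
    have : p.1 + p.2 = algebraMap k A (r p.1 + r p.2) + π * (s p.1 + s p.2) := by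
      rw [map_add]; linear_combination hrs p.1 + hrs p.2
    simp only
    rw [this, hψ', hψ p.1, hψ p.2, map_add]
    ring
  have hmul : ∀ a b, ψ (a * b) = ψ a * ψ b := by
    intro a b
    have hsmul : ∀ (c : k) b, ψ (algebraMap k A c * b) = C c * ψ b := by
      intro c b
      refine sub_eq_zero.mp (eq_zero_of_forall_exists_eq_X_mul
        (fun p : A => ψ (algebraMap k A c * p) - C c * ψ p) (fun p => ⟨s p, ?_⟩) b)
      have : algebraMap k A c * p = algebraMap k A (c * r p) + π * (algebraMap k A c * s p) := by
        rw [map_mul]; linear_combination algebraMap k A c * hrs p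
      rw [this, hψ', hψ p, map_mul]
      ring
    -- Only the first factor is expanded; the second stays fixed along the recursion.
    refine sub_eq_zero.mp (eq_zero_of_forall_exists_eq_X_mul
      (fun p : A × A => ψ (p.1 * p.2) - ψ p.1 * ψ p.2) (fun p => ⟨(s p.1, p.2), ?_⟩) (a, b))
    have : p.1 * p.2 = algebraMap k A (r p.1 * r p.2)
        + π * (algebraMap k A (r p.1) * s p.2 + s p.1 * p.2) := by
      rw [map_mul]; linear_combination p.2 * hrs p.1 + algebraMap k A (r p.1) * hrs p.2
    simp only
    rw [this, hψ', hψ p.1, hadd, hsmul]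
    have h2 := hψ p.2
    rw [map_mul]
    linear_combination - C (r p.1) * h2
  let Ψ : A →ₐ[k] k⟦X⟧ :=
    { toFun := ψ
      map_one' := by simpa using halg 1
      map_mul' := hmul
      map_zero' := h0
      map_add' := hadd
      commutes' := halg }
  have hX : Ψ π = X := by
    have h1 : ψ 1 = 1 := by simpa using halg 1
    have h2 := hψ' 0 1
    rw [map_zero, zero_add, mul_one, h1, map_zero, zero_add, mul_one] at h2
    exact h2
  have hinj : Function.Injective Ψ := by
    refine (injective_iff_map_eq_zero Ψ).mpr fun a ha => hsep a fun n => ?_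
    have key : ∀ n a, ψ a = 0 → π ^ n ∣ a := by
      intro n
      induction n with
      | zero => intro a _; simp
      | succ n ih =>
        intro a ha
        have h1 := hψ a
        rw [ha] at h1
        have hr : r a = 0 := by simpa using (congrArg (coeff 0) h1).symm
        have hs : ψ (s a) = 0 := by
          rw [hr] at h1
          simpa using h1.symm
        rw [hrs a, hr, map_zero, zero_add, pow_succ']
        exact mul_dvd_mul_left _ (ih _ hs)
    exact key n a ha
  have hsurj : Function.Surjective Ψ := by
    intro f
    obtain ⟨a, ha⟩ := hprec fun n => coeff n f
    refine ⟨a, ?_⟩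
    ext n
    obtain ⟨b, hb⟩ := ha (n + 1)
    have h1 : Ψ a = X ^ (n + 1) * Ψ b
        + ∑ i ∈ Finset.range (n + 1), C (coeff i f) * X ^ i := by
      have : a = π ^ (n + 1) * b
          + ∑ i ∈ Finset.range (n + 1), algebraMap k A (coeff i f) * π ^ i := by
        rw [← hb]; ring
      rw [this]
      simp only [map_add, map_mul, map_pow, map_sum, hX, AlgHom.commutes]
      rfl
    rw [h1]
    simp [coeff_X_pow_mul', coeff_X_pow]
  exact ⟨AlgEquiv.ofBijective Ψ ⟨hinj, hsurj⟩, hX⟩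

/-- A change of parameter `t ↦ u t + γ t ^ 2`. -/
theorem exists_algEquiv_coeff {k : Type*} [Field k] (u γ : k) (hu : u ≠ 0) :
    ∃ e : k⟦X⟧ ≃ₐ[k] k⟦X⟧, ∀ f, coeff 0 (e f) = coeff 0 f ∧ coeff 1 (e f) = u * coeff 1 f ∧
      coeff 2 (e f) = u ^ 2 * coeff 2 f + γ * coeff 1 f ∧
      coeff 3 (e f) = u ^ 3 * coeff 3 f + 2 * u * γ * coeff 2 f := by
  set v : k⟦X⟧ := C u + C γ * X with hv
  have hvu : IsUnit v := by
    rw [isUnit_iff_constantCoeff]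
    simpa [hv] using hu
  have hdvd : ∀ n f, (X * v) ^ n ∣ f ↔ X ^ n ∣ f := by
    intro n f
    rw [mul_pow]
    exact (hvu.pow n).mul_right_dvd
  obtain ⟨e, he⟩ := exists_algEquiv_apply_eq_X (k := k) (X * v)
    (mem_nonZeroDivisors_of_ne_zero (mul_ne_zero X_ne_zero hvu.ne_zero))
    (by simp [isUnit_iff_constantCoeff])
    (by
      intro a
      obtain ⟨g, hg⟩ := exists_eq_C_add_X_mul a
      obtain ⟨w, hw⟩ := hvu.exists_right_inv
      refine ⟨coeff 0 a, w * g, ?_⟩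
      rw [show algebraMap k k⟦X⟧ (coeff 0 a) = C (coeff 0 a) from rfl]
      linear_combination hg - X * g * hw)
    (by
      intro a ha
      ext n
      have := ha (n + 1)
      rw [hdvd, X_pow_dvd_iff] at this
      simpa using this n (Nat.lt_succ_self n))
    (by
      intro c
      -- Terms of index above `n` do not affect coefficient `n`, so it can be read off the partial
      -- sum with `n + 1` terms.
      refine ⟨mk fun n => coeff n
        (∑ i ∈ Finset.range (n + 1), algebraMap k k⟦X⟧ (c i) * (X * v) ^ i), fun n => ?_⟩
      rw [hdvd, X_pow_dvd_iff]
      intro l hl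
      rw [map_sub, coeff_mk, sub_eq_zero, map_sum, map_sum]
      refine Finset.sum_subset (by intro x; simp; omega) ?_
      intro i _ hi
      have : X ^ i ∣ algebraMap k k⟦X⟧ (c i) * (X * v) ^ i :=
        Dvd.dvd.mul_left (by rw [mul_pow]; exact dvd_mul_right _ _) _
      rw [X_pow_dvd_iff] at this
      exact this l (by simpa [Nat.lt_succ_iff] using hi))
  -- `e` takes the new parameter `X * v` to `X`, so the substitution `X ↦ u X + γ X ^ 2` is its
  -- inverse.
  refine ⟨e.symm, fun f => ?_⟩
  have hX : e.symm X = X * v := e.symm_apply_eq.mpr he.symm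
  obtain ⟨g, hg⟩ := exists_eq_add_X_pow_four_mul f
  have hC : ∀ c : k, e.symm (C c) = C c := fun c => e.symm.commutes c
  have h : e.symm f = C (coeff 0 f) + C (u * coeff 1 f) * X
      + C (u ^ 2 * coeff 2 f + γ * coeff 1 f) * X ^ 2
      + C (u ^ 3 * coeff 3 f + 2 * u * γ * coeff 2 f) * X ^ 3
      + X ^ 4 * (C (γ ^ 2 * coeff 2 f)
        + C (coeff 3 f) * (3 * C u ^ 2 * C γ + 3 * C u * C γ ^ 2 * X + C γ ^ 3 * X ^ 2)
        + v ^ 4 * e.symm g) := by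
    conv_lhs => rw [hg]
    simp only [map_add, map_mul, map_pow, hX, hC]
    rw [map_ofNat C 2, hv]
    ring
  rw [h]
  have hCX : ∀ (c : k) n l, coeff l (C c * X ^ n : k⟦X⟧) = if l = n then c else 0 := by
    intro c n l
    rw [coeff_C_mul, coeff_X_pow, mul_ite, mul_one, mul_zero]
  refine ⟨?_, ?_, ?_, ?_⟩ <;>
  · simp only [map_add (coeff _), hCX, coeff_X_pow_mul', coeff_C, coeff_C_mul, coeff_X]
    simp

end PowerSeries

/-! ### Glueings of branches are complete curve germs. -/

/-- A subalgebra of `k⟦t_1⟧ × ⋯ × k⟦t_m⟧` is a glueing of the `m` branches at the origin if it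
contains a power of the ideal `(t_1, …, t_m)` and its elements have a well defined value at the
origin. -/
structure IsBranchGlueing {k : Type*} [Field k] {m : ℕ} (S : Subalgebra k (Fin m → k⟦X⟧))
    (N : ℕ) : Prop where
  pos : 0 < m
  exponent_pos : 0 < N
  coeff_zero_eq : ∀ f ∈ S, ∀ i j, PowerSeries.coeff 0 (f i) = PowerSeries.coeff 0 (f j)
  radicalPow_subset : radicalPow k m N ⊆ S

lemma radicalPow_mono {k : Type*} [Field k] {m a b : ℕ} (h : a ≤ b) :
    radicalPow k m b ⊆ radicalPow k m a :=
  fun _ hf j => (pow_dvd_pow _ h).trans (hf j)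

lemma exists_eq_X_pow_mul_of_mem_radicalPow {k : Type*} [Field k] {m N : ℕ} {f : Fin m → k⟦X⟧}
    (hf : f ∈ radicalPow k m N) : ∃ g : Fin m → k⟦X⟧, f = (fun _ => PowerSeries.X ^ N) * g := by
  choose g hg using hf
  exact ⟨g, funext hg⟩

namespace IsBranchGlueing

open PowerSeries

variable {k : Type*} [Field k] {m : ℕ} {S : Subalgebra k (Fin m → k⟦X⟧)} {N : ℕ}

lemma X_pow_mem (h : IsBranchGlueing S N) : (fun _ => X ^ N) ∈ S :=
  h.radicalPow_subset fun _ => dvd_rfl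

/-- After scaling, `f = 1 - g` with `g` of positive order. The geometric series for the inverse may
be cut at `N`, because its remainder is a multiple of `g ^ N` and so lies in `radicalPow k m N`. -/
lemma inv_mem (h : IsBranchGlueing S N) {f : Fin m → k⟦X⟧} (hf : f ∈ S)
    (hf0 : ∀ i, coeff 0 (f i) ≠ 0) : (fun i => (f i)⁻¹) ∈ S := by
  set i₀ : Fin m := ⟨0, h.pos⟩
  set c := coeff 0 (f i₀) with hc
  have hcf : ∀ i, coeff 0 (f i) = c := fun i => h.coeff_zero_eq f hf i i₀
  set g : Fin m → k⟦X⟧ := 1 - c⁻¹ • f with hg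
  have hgS : g ∈ S := sub_mem (one_mem S) (S.smul_mem hf _)
  have hgX : ∀ i, X ∣ g i := by
    intro i
    rw [X_dvd_iff]
    have h1 := hcf i
    rw [coeff_zero_eq_constantCoeff_apply] at h1
    simp [hg, h1, inv_mul_cancel₀ (show c ≠ 0 from hf0 i₀)]
  have hpow : ∀ p : Fin m → k⟦X⟧, g ^ N * p ∈ S := by
    intro p
    refine h.radicalPow_subset fun i => ?_
    exact Dvd.dvd.mul_right (pow_dvd_pow_of_dvd (hgX i) N) _
  have hS : c⁻¹ • ((∑ n ∈ Finset.range N, g ^ n) + g ^ N * (c • fun i => (f i)⁻¹)) ∈ S :=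
    S.smul_mem (add_mem (sum_mem fun n _ => pow_mem hgS n) (hpow _)) _
  convert hS using 1
  have hfinv : f * (fun i => (f i)⁻¹) = 1 := by
    funext i
    exact PowerSeries.mul_inv_cancel _ (by simpa using hf0 i)
  have hgf : f = c • (1 - g) := by
    rw [hg, sub_sub_cancel, smul_smul, mul_inv_cancel₀ (hf0 i₀), one_smul]
  have hgeom := mul_neg_geom_sum g N
  set q : Fin m → k⟦X⟧ := fun i => (f i)⁻¹ with hq
  set p := ∑ n ∈ Finset.range N, g ^ n
  have h1 : (1 - g) * (c • q) = 1 := by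
    rw [mul_smul_comm, ← smul_mul_assoc, ← hgf, hfinv]
  have h2 : p + g ^ N * (c • q) = c • q := by
    linear_combination (c • q) * hgeom - (p) * h1
  rw [h2, smul_smul, inv_mul_cancel₀ (hf0 i₀), one_smul]

lemma isUnit_iff (h : IsBranchGlueing S N) (f : S) (i : Fin m) :
    IsUnit f ↔ coeff 0 (f.1 i) ≠ 0 := by
  constructor
  · rintro hu
    have : IsUnit (f.1 i) := hu.map ((Pi.evalRingHom (fun _ => k⟦X⟧) i).comp S.val.toRingHom)
    rw [isUnit_iff_constantCoeff] at this
    simpa using this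
  · intro hf
    have hf0 : ∀ j, coeff 0 (f.1 j) ≠ 0 := fun j => by rwa [h.coeff_zero_eq f.1 f.2 j i]
    refine IsUnit.of_mul_eq_one ⟨_, h.inv_mem f.2 hf0⟩ (Subtype.ext ?_)
    funext j
    exact PowerSeries.mul_inv_cancel _ (by simpa using hf0 j)

lemma isLocalRing (h : IsBranchGlueing S N) : IsLocalRing S := by
  have i₀ : Fin m := ⟨0, h.pos⟩
  have : Nonempty (Fin m) := ⟨i₀⟩
  have : Nontrivial S := inferInstance
  refine IsLocalRing.of_isUnit_or_isUnit_one_sub_self fun f => ?_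
  rw [h.isUnit_iff f i₀, h.isUnit_iff _ i₀]
  by_contra! hc
  obtain ⟨h1, h2⟩ := hc
  simp at h1 h2
  simp [h1] at h2

lemma mem_maximalIdeal_iff (h : IsBranchGlueing S N) [IsLocalRing S] (f : S) (i : Fin m) :
    f ∈ IsLocalRing.maximalIdeal S ↔ coeff 0 (f.1 i) = 0 := by
  rw [IsLocalRing.mem_maximalIdeal, mem_nonunits_iff, h.isUnit_iff f i, not_not]

lemma residue_bijective (h : IsBranchGlueing S N) [IsLocalRing S] :
    Function.Bijective (algebraMap k (IsLocalRing.ResidueField S)) := by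
  have i₀ : Fin m := ⟨0, h.pos⟩
  refine ⟨(algebraMap k _).injective, fun y => ?_⟩
  obtain ⟨f, rfl⟩ := IsLocalRing.residue_surjective y
  refine ⟨coeff 0 (f.1 i₀), ?_⟩
  rw [IsScalarTower.algebraMap_apply k S (IsLocalRing.ResidueField S), eq_comm, ← sub_eq_zero]
  change IsLocalRing.residue S _ - IsLocalRing.residue S _ = 0
  rw [← map_sub, IsLocalRing.residue_eq_zero_iff, h.mem_maximalIdeal_iff _ i₀]
  simp

lemma isReduced : IsReduced S :=
  isReduced_of_injective S.val.toRingHom Subtype.val_injective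

/-- The prime ideal of the `i`-th branch. -/
noncomputable def branchPrime (S : Subalgebra k (Fin m → k⟦X⟧)) (i : Fin m) : Ideal S :=
  RingHom.ker ((Pi.evalRingHom (fun _ => k⟦X⟧) i).comp S.val.toRingHom)

lemma mem_branchPrime {i : Fin m} {f : S} : f ∈ branchPrime S i ↔ f.1 i = 0 := Iff.rfl

instance (i : Fin m) : (branchPrime S i).IsPrime := RingHom.ker_isPrime _

lemma single_mem (h : IsBranchGlueing S N) (i : Fin m) {g : k⟦X⟧} (hg : X ^ N ∣ g) :
    Pi.single i g ∈ S := by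
  refine h.radicalPow_subset fun j => ?_
  by_cases hj : j = i
  · subst hj; simpa using hg
  · simp [Pi.single_eq_of_ne hj]

lemma branchPrime_injective (h : IsBranchGlueing S N) {i j : Fin m}
    (hij : branchPrime S i ≤ branchPrime S j) : i = j := by
  by_contra hne
  have h1 : (⟨Pi.single j (X ^ N), h.single_mem j dvd_rfl⟩ : S) ∈ branchPrime S i := by
    rw [mem_branchPrime]; exact Pi.single_eq_of_ne hne _
  have h2 := hij h1
  rw [mem_branchPrime] at h2
  simp at h2

/-- The branch primes meet in zero, so `Q` contains one of them, say the `i`-th. If `Q` is larger,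
it has an element whose `i`-th component is `X ^ a` times a unit. A high power of any `p` in the
maximal ideal then agrees on branch `i` with a multiple of that element, the cofactor being
supported on branch `i` and of order at least `N`. -/
lemma eq_branchPrime_or (h : IsBranchGlueing S N) [IsLocalRing S] (Q : Ideal S) [hQ : Q.IsPrime] :
    (∃ i, Q = branchPrime S i) ∨ Q = IsLocalRing.maximalIdeal S := by
  by_cases hne : ∃ i, Q = branchPrime S i
  · exact Or.inl hne
  right
  push Not at hne
  obtain ⟨i, hi⟩ : ∃ i, branchPrime S i ≤ Q := by
    have : (Finset.univ : Finset (Fin m)).inf (branchPrime S) ≤ Q := by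
      intro f hf
      have : f = 0 := by
        refine Subtype.ext (funext fun i => ?_)
        have := (Finset.inf_le (f := branchPrime S) (Finset.mem_univ i)) hf
        exact this
      rw [this]; exact Q.zero_mem
    obtain ⟨i, -, hi⟩ := (Ideal.IsPrime.inf_le' hQ).mp this
    exact ⟨i, hi⟩
  obtain ⟨f, hfQ, hfi⟩ : ∃ f ∈ Q, f ∉ branchPrime S i := by
    by_contra! hc
    exact hne i (le_antisymm hc hi)
  rw [mem_branchPrime] at hfi
  refine le_antisymm (IsLocalRing.le_maximalIdeal hQ.ne_top) fun p hp => ?_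
  obtain ⟨v, hv, hfv⟩ : ∃ v : k⟦X⟧, IsUnit v ∧ f.1 i = X ^ (f.1 i).order.toNat * v := by
    obtain ⟨v, hv⟩ := exists_eq_mul_right_of_dvd (X_pow_order_dvd (φ := f.1 i))
    refine ⟨v, ?_, hv⟩
    rw [isUnit_iff_constantCoeff]
    have h1 : coeff (f.1 i).order.toNat (f.1 i) = coeff 0 v := by
      have key : ∀ n, f.1 i = X ^ n * v → coeff n (f.1 i) = coeff 0 v := by
        intro n hn
        simp [hn, coeff_X_pow_mul']
      exact key _ hv
    rw [← coeff_zero_eq_constantCoeff_apply, ← h1]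
    exact isUnit_iff_ne_zero.mpr (coeff_order hfi)
  set a := (f.1 i).order.toNat
  obtain ⟨w, hw⟩ := hv.exists_right_inv
  obtain ⟨q, hq⟩ : X ∣ p.1 i := by
    rw [X_dvd_iff]
    have := (h.mem_maximalIdeal_iff p i).mp hp
    simpa using this
  set g : S := ⟨Pi.single i (X ^ N * (w * q ^ (a + N))), h.single_mem i (dvd_mul_right _ _)⟩
  have h1 : p ^ (a + N) - f * g ∈ Q := by
    apply hi
    rw [mem_branchPrime]
    change p.1 i ^ (a + N) - f.1 i * (Pi.single i (X ^ N * (w * q ^ (a + N))) : Fin m → k⟦X⟧) i = 0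
    rw [Pi.single_eq_same, hq, hfv, mul_pow, pow_add]
    linear_combination (- X ^ a * X ^ N * q ^ (a + N)) * hw
  have h2 : p ^ (a + N) ∈ Q := by
    have := Q.add_mem h1 (Q.mul_mem_right g hfQ)
    simpa using this
  exact hQ.mem_of_pow_mem _ h2

lemma minimalPrimes_eq (h : IsBranchGlueing S N) [IsLocalRing S] :
    minimalPrimes S = Set.range (branchPrime S) := by
  have i₀ : Fin m := ⟨0, h.pos⟩
  have hmax : ∀ i, ¬ IsLocalRing.maximalIdeal S ≤ branchPrime S i := by
    intro i hle
    have h1 : (⟨_, h.X_pow_mem⟩ : S) ∈ IsLocalRing.maximalIdeal S := by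
      rw [h.mem_maximalIdeal_iff _ i]
      simp [coeff_X_pow, h.exponent_pos.ne]
    have := hle h1
    rw [mem_branchPrime] at this
    simp at this
  ext Q
  rw [minimalPrimes_eq_minimals]
  constructor
  · rintro ⟨hQ, hmin⟩
    have : Q.IsPrime := hQ
    rcases h.eq_branchPrime_or Q with ⟨i, rfl⟩ | rfl
    · exact ⟨i, rfl⟩
    · exact (hmax i₀ (hmin (inferInstanceAs (branchPrime S i₀).IsPrime)
        (IsLocalRing.le_maximalIdeal (Ideal.IsPrime.ne_top inferInstance)))).elim
  · rintro ⟨i, rfl⟩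
    refine ⟨(inferInstance : (branchPrime S i).IsPrime), fun P hP hle => ?_⟩
    have : P.IsPrime := hP
    rcases h.eq_branchPrime_or P with ⟨j, rfl⟩ | rfl
    · rw [h.branchPrime_injective hle]
    · exact (hmax i hle).elim

lemma numBranches_eq (h : IsBranchGlueing S N) : numBranches S = m := by
  have := h.isLocalRing
  have hinj : Function.Injective (branchPrime S) :=
    fun i j hij => h.branchPrime_injective hij.le
  rw [numBranches, h.minimalPrimes_eq, ← Set.image_univ, Set.ncard_image_of_injective _ hinj]
  simp

lemma ringKrullDim_eq_one (h : IsBranchGlueing S N) : ringKrullDim S = 1 := by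
  have := h.isLocalRing
  have i₀ : Fin m := ⟨0, h.pos⟩
  have h1 : Ring.KrullDimLE 1 S := by
    rw [Ring.krullDimLE_one_iff]
    intro Q hQ
    rcases h.eq_branchPrime_or Q with ⟨i, rfl⟩ | rfl
    · left; rw [h.minimalPrimes_eq]; exact ⟨i, rfl⟩
    · right; infer_instance
  have h2 : ¬ Ring.KrullDimLE 0 S := by
    intro h0
    have hm : (branchPrime S i₀).IsMaximal := Ideal.IsPrime.isMaximal' (inferInstance)
    have := IsLocalRing.eq_maximalIdeal hm
    have hx : (⟨_, h.X_pow_mem⟩ : S) ∈ IsLocalRing.maximalIdeal S := by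
      rw [h.mem_maximalIdeal_iff _ i₀]
      simp [coeff_X_pow, h.exponent_pos.ne]
    rw [← this, mem_branchPrime] at hx
    simp at hx
  rw [Ring.krullDimLE_iff] at h1 h2
  refine le_antisymm (by simpa using h1) ?_
  rw [not_le] at h2
  exact (WithBot.one_le_iff_pos _).mpr (by simpa using h2)

/-- The coefficients of degree less than `L` on all branches. -/
noncomputable def coeffsBelow (k : Type*) [Field k] (m L : ℕ) :
    (Fin m → k⟦X⟧) →ₗ[k] (Fin m → Fin L → k) :=
  LinearMap.pi fun i => LinearMap.pi fun n => (coeff (n : ℕ)).comp (LinearMap.proj i)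

lemma coeffsBelow_eq_zero_iff {L : ℕ} {f : Fin m → k⟦X⟧} :
    coeffsBelow k m L f = 0 ↔ f ∈ radicalPow k m L := by
  simp only [radicalPow, Set.mem_ofPred_eq, X_pow_dvd_iff, funext_iff]
  constructor
  · intro hf i n hn
    exact hf i ⟨n, hn⟩
  · intro hf i n
    exact hf i n n.2

/-- Truncation below order `L` has finite dimensional image, so finitely many elements of `I`
account for everything up to high order, and `x` divides what remains. -/
lemma fg_of_forall_mem_radicalPow (I : Ideal S) (L : ℕ) (x : S) (hx : x ∈ I)
    (hL : ∀ f ∈ I, f.1 ∈ radicalPow k m L → x ∣ f) : I.FG := by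
  classical
  let κ : S →ₗ[k] (Fin m → Fin L → k) := (coeffsBelow k m L).comp S.val.toLinearMap
  obtain ⟨t, ht⟩ : ((I.restrictScalars k).map κ).FG := IsNoetherian.noetherian _
  have hsub : (t : Set (Fin m → Fin L → k)) ⊆ κ '' (I : Set S) := by
    intro v hv
    have : v ∈ (I.restrictScalars k).map κ := by rw [← ht]; exact Submodule.subset_span hv
    exact this
  obtain ⟨s, hsI, rfl⟩ := Finset.subset_set_image_iff.mp hsub
  refine ⟨insert x s, le_antisymm ?_ ?_⟩
  · rw [Submodule.span_le]
    intro y hy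
    rcases Finset.mem_insert.mp hy with rfl | hy
    · exact hx
    · exact hsI hy
  · intro f hf
    have h1 : κ f ∈ (I.restrictScalars k).map κ := ⟨f, hf, rfl⟩
    rw [← ht, Finset.coe_image, ← Submodule.map_span] at h1
    obtain ⟨g, hg, hgf⟩ := h1
    have hgspan : g ∈ Ideal.span (s : Set S) :=
      Submodule.span_le_restrictScalars k S (s : Set S) hg
    have hgI : g ∈ I := (Ideal.span_le.mpr hsI) hgspan
    have h2 : x ∣ f - g := by
      refine hL _ (I.sub_mem hf hgI) (coeffsBelow_eq_zero_iff.mp ?_)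
      have : κ (f - g) = 0 := by rw [map_sub, hgf, sub_self]
      exact this
    have h3 : f - g ∈ Submodule.span S ((insert x s : Finset S) : Set S) :=
      Ideal.mem_of_dvd _ h2 (Submodule.subset_span (by simp))
    have h4 : g ∈ Submodule.span S ((insert x s : Finset S) : Set S) :=
      Submodule.span_mono (by simp) hgspan
    simpa using add_mem h3 h4

lemma isNoetherianRing (h : IsBranchGlueing S N) : IsNoetherianRing S := by
  have := h.isLocalRing
  have i₀ : Fin m := ⟨0, h.pos⟩
  refine IsNoetherianRing.of_prime fun Q hQ => ?_
  rcases h.eq_branchPrime_or Q with ⟨i, rfl⟩ | rfl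
  -- One factor `X ^ N` is divided out; the other keeps the quotient in `S`.
  · refine fg_of_forall_mem_radicalPow _ (N + N)
      ⟨Function.update (fun _ => X ^ N) i 0, h.radicalPow_subset fun j => ?_⟩ ?_ ?_
    · by_cases hj : j = i
      · subst hj; simp
      · simp [Function.update_of_ne hj]
    · rw [mem_branchPrime]; simp
    · intro f hf hfL
      rw [mem_branchPrime] at hf
      obtain ⟨g, hg⟩ := exists_eq_X_pow_mul_of_mem_radicalPow hfL
      refine ⟨⟨(fun _ => X ^ N) * g, h.radicalPow_subset fun j => dvd_mul_right _ _⟩,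
        Subtype.ext (funext fun j => ?_)⟩
      change f.1 j = (Function.update (fun _ => X ^ N) i 0 : Fin m → k⟦X⟧) j * (X ^ N * g j)
      by_cases hj : j = i
      · subst hj; simp [hf]
      · rw [Function.update_of_ne hj, hg, Pi.mul_apply, pow_add, mul_assoc]
  · refine fg_of_forall_mem_radicalPow _ (N + N) ⟨_, h.X_pow_mem⟩ ?_ ?_
    · rw [h.mem_maximalIdeal_iff _ i₀]
      simp [coeff_X_pow, h.exponent_pos.ne]
    · intro f _ hfL
      obtain ⟨g, hg⟩ := exists_eq_X_pow_mul_of_mem_radicalPow hfL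
      refine ⟨⟨(fun _ => X ^ N) * g, h.radicalPow_subset fun j => dvd_mul_right _ _⟩,
        Subtype.ext (funext fun j => ?_)⟩
      change f.1 j = X ^ N * (X ^ N * g j)
      rw [hg, Pi.mul_apply, pow_add, mul_assoc]

end IsBranchGlueing

namespace IsBranchGlueing

open PowerSeries

variable {k : Type*} [Field k] {m : ℕ} {S : Subalgebra k (Fin m → k⟦X⟧)} {N : ℕ}

lemma val_mem_radicalPow (h : IsBranchGlueing S N) [IsLocalRing S] {n : ℕ} {f : S}
    (hf : f ∈ IsLocalRing.maximalIdeal S ^ n) : f.1 ∈ radicalPow k m n := by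
  set J : Ideal (Fin m → k⟦X⟧) := Ideal.span {fun _ => X}
  have h1 : IsLocalRing.maximalIdeal S ≤ J.comap S.val.toRingHom := by
    intro p hp
    rw [Ideal.mem_comap, Ideal.mem_span_singleton]
    have : ∀ i, X ∣ p.1 i := by
      intro i
      rw [X_dvd_iff]
      simpa using (h.mem_maximalIdeal_iff p i).mp hp
    choose g hg using this
    exact ⟨g, funext hg⟩
  have h2 := Ideal.le_comap_pow S.val.toRingHom n (Ideal.pow_right_mono h1 n hf)
  rw [Ideal.mem_comap, Ideal.span_singleton_pow, Ideal.mem_span_singleton] at h2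
  obtain ⟨g, hg⟩ := h2
  intro j
  exact ⟨g j, congrFun hg j⟩

/-- Together with `val_mem_radicalPow` this says that the adic topology of `S` is the order
topology, up to the shift `n ↦ N * n + N`. -/
lemma mem_maximalIdeal_pow (h : IsBranchGlueing S N) [IsLocalRing S] {n : ℕ} {f : S}
    (hf : f.1 ∈ radicalPow k m (N * n + N)) : f ∈ IsLocalRing.maximalIdeal S ^ n := by
  obtain ⟨g, hg⟩ := exists_eq_X_pow_mul_of_mem_radicalPow hf
  have : f = (⟨_, h.X_pow_mem⟩ : S) ^ n *
      ⟨(fun _ => X ^ N) * g, h.radicalPow_subset fun j => dvd_mul_right _ _⟩ := by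
    refine Subtype.ext (funext fun j => ?_)
    change f.1 j = (X ^ N) ^ n * (X ^ N * g j)
    rw [hg, Pi.mul_apply]
    ring
  rw [this]
  refine Ideal.mul_mem_right _ _ (Ideal.pow_mem_pow ?_ n)
  rw [h.mem_maximalIdeal_iff _ ⟨0, h.pos⟩]
  simp [coeff_X_pow, h.exponent_pos.ne]

lemma isAdicComplete (h : IsBranchGlueing S N) [IsLocalRing S] :
    IsAdicComplete (IsLocalRing.maximalIdeal S) S := by
  have := h.isNoetherianRing
  refine { toIsHausdorff := inferInstance, toIsPrecomplete := ⟨fun F hF => ?_⟩ }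
  simp only [SModEq.sub_mem, smul_eq_mul, Ideal.mul_top] at hF ⊢
  have hFc : ∀ {a b d : ℕ}, d < a → a ≤ b → ∀ i, coeff d ((F a).1 i) = coeff d ((F b).1 i) := by
    intro a b d hd hab i
    have := h.val_mem_radicalPow (hF hab) i
    rw [X_pow_dvd_iff] at this
    exact sub_eq_zero.mp (by simpa using this d hd)
  let L : Fin m → k⟦X⟧ := fun i => PowerSeries.mk fun d => coeff d ((F (d + 1)).1 i)
  have hL : ∀ n, (F n).1 - L ∈ radicalPow k m n := by
    intro n i
    rw [X_pow_dvd_iff]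
    intro d hd
    simp [L, hFc (Nat.lt_succ_self d) hd i]
  have hLS : L ∈ S := by
    have := sub_mem (F N).2 (h.radicalPow_subset (hL N))
    simpa using this
  refine ⟨⟨L, hLS⟩, fun n => ?_⟩
  -- Comparing the two topologies costs a shift, so the limit is first compared with this later term
  -- of the sequence.
  have h1 : n ≤ N * n + N := by nlinarith [h.exponent_pos]
  have h2 := hF h1
  have h3 : F (N * n + N) - ⟨L, hLS⟩ ∈ IsLocalRing.maximalIdeal S ^ n :=
    h.mem_maximalIdeal_pow (hL _)
  simpa using add_mem h2 h3

theorem isCompleteCurveGerm (h : IsBranchGlueing S N) : IsCompleteCurveGerm k S :=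
  have := h.isLocalRing
  { isNoetherianRing := h.isNoetherianRing
    isReduced := isReduced
    isAdicComplete := h.isAdicComplete
    ringKrullDim_eq_one := h.ringKrullDim_eq_one
    residue_bijective := h.residue_bijective }

end IsBranchGlueing

/-! ### Normalisation and delta invariant of a glueing. -/

/-- The delta invariant computed in any model `T` of the normalisation. -/
theorem deltaInvariant_eq_finrank {k R T : Type*} [Field k] [CommRing R] [Algebra k R]
    [CommRing T] [Algebra k T] (ι : R →ₐ[k] T) (j : T →ₐ[k] FractionRing R)
    (hj : Function.Injective j) (hι : ∀ r, j (ι r) = algebraMap R (FractionRing R) r)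
    (hrange : ∀ y, (∃ f, j f = y) ↔ IsIntegral R y) :
    deltaInvariant k R = Module.finrank k (T ⧸ LinearMap.range ι.toLinearMap) := by
  let j' : T →ₗ[k] Normalisation R :=
    { toFun := fun f => ⟨j f, (hrange _).mp ⟨f, rfl⟩⟩
      map_add' := fun a b => Subtype.ext (map_add j a b)
      map_smul' := fun c a => Subtype.ext (map_smul j c a) }
  have hbij : Function.Bijective j' := by
    refine ⟨fun a b hab => hj (congrArg Subtype.val hab), fun y => ?_⟩
    obtain ⟨f, hf⟩ := (hrange y.1).mpr y.2
    exact ⟨f, Subtype.ext hf⟩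
  let e : T ≃ₗ[k] Normalisation R := LinearEquiv.ofBijective j' hbij
  let P := LinearMap.range (Algebra.linearMap R (Normalisation R))
  have hmap : (LinearMap.range ι.toLinearMap).map (e : T →ₗ[k] Normalisation R) =
      P.restrictScalars k := by
    ext y
    constructor
    · rintro ⟨_, ⟨r, rfl⟩, rfl⟩
      exact ⟨r, Subtype.ext (hι r).symm⟩
    · rintro ⟨r, rfl⟩
      exact ⟨ι r, ⟨r, rfl⟩, Subtype.ext (hι r)⟩
  rw [deltaInvariant]
  exact ((Submodule.Quotient.equiv _ _ e hmap).trans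
    (Submodule.Quotient.restrictScalarsEquiv k P)).finrank_eq.symm

namespace IsBranchGlueing

open PowerSeries

variable {k : Type*} [Field k] {m : ℕ} {S : Subalgebra k (Fin m → k⟦X⟧)} {N : ℕ}

lemma mem_nonZeroDivisors_iff (h : IsBranchGlueing S N) (f : S) :
    f ∈ nonZeroDivisors S ↔ ∀ i, f.1 i ≠ 0 := by
  rw [mem_nonZeroDivisors_iff_right]
  constructor
  · intro hf i hi
    have h1 := hf ⟨Pi.single i (X ^ N), h.single_mem i dvd_rfl⟩ (Subtype.ext (funext fun j => by
      by_cases hj : j = i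
      · subst hj; simp [hi]
      · simp [Pi.single_eq_of_ne hj]))
    have := congrFun (congrArg Subtype.val h1) i
    simp at this
  · intro hf g hg
    refine Subtype.ext (funext fun i => ?_)
    have : g.1 i * f.1 i = 0 := congrFun (congrArg Subtype.val hg) i
    exact (mul_eq_zero.mp this).resolve_right (hf i)

/-- Every power series on the branches is a fraction of elements of the glueing. -/
lemma exists_algHom_fractionRing (h : IsBranchGlueing S N) (K : Type*) [CommRing K] [Algebra S K]
    [Algebra k K] [IsScalarTower k S K] [IsFractionRing S K] :
    ∃ j : (Fin m → k⟦X⟧) →ₐ[k] K, Function.Injective j ∧ ∀ r : S, j r.1 = algebraMap S K r := by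
  let s : S := ⟨_, h.X_pow_mem⟩
  have hs : s ∈ nonZeroDivisors S := (h.mem_nonZeroDivisors_iff s).mpr fun i => by simp [s]
  obtain ⟨u, hu⟩ : IsUnit (algebraMap S K s) := IsLocalization.map_units K ⟨s, hs⟩
  have hinj : Function.Injective (algebraMap S K) := IsFractionRing.injective S K
  -- The series `f` becomes the fraction with numerator `X ^ N * f` and denominator `X ^ N`, both in
  -- `S`.
  let c : (Fin m → k⟦X⟧) → S := fun f => ⟨s.1 * f, h.radicalPow_subset fun j => dvd_mul_right _ _⟩
  let j : (Fin m → k⟦X⟧) →ₐ[k] K :=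
    { toFun := fun f => ↑u⁻¹ * algebraMap S K (c f)
      map_one' := by
        have : c 1 = s := Subtype.ext (mul_one _)
        rw [this, ← hu, Units.inv_mul]
      map_mul' := fun f g => by
        have : s * c (f * g) = c f * c g := Subtype.ext (by
          change s.1 * (s.1 * (f * g)) = (s.1 * f) * (s.1 * g)
          ring)
        have h1 := congrArg (algebraMap S K) this
        rw [map_mul, map_mul, ← hu] at h1
        calc (↑u⁻¹ : K) * algebraMap S K (c (f * g))
            = ↑u⁻¹ * ↑u⁻¹ * (↑u * algebraMap S K (c (f * g))) := by
              rw [mul_assoc, Units.inv_mul_cancel_left]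
          _ = _ := by rw [h1]; ring
      map_zero' := by
        have : c 0 = 0 := Subtype.ext (mul_zero _)
        rw [this, map_zero, mul_zero]
      map_add' := fun f g => by
        have : c (f + g) = c f + c g := Subtype.ext (mul_add _ _ _)
        rw [this, map_add, mul_add]
      commutes' := fun r => by
        have : c (algebraMap k _ r) = s * algebraMap k S r := Subtype.ext rfl
        rw [this, map_mul, ← hu, Units.inv_mul_cancel_left,
          ← IsScalarTower.algebraMap_apply] }
  have hj : ∀ f, j f = ↑u⁻¹ * algebraMap S K (c f) := fun _ => rfl
  refine ⟨j, (injective_iff_map_eq_zero j).mpr fun f hf => ?_, fun r => ?_⟩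
  · rw [hj, Units.mul_right_eq_zero] at hf
    have h1 : c f = 0 := hinj (by rw [hf, map_zero])
    funext i
    have h2 : X ^ N * f i = 0 := congrFun (congrArg Subtype.val h1) i
    simpa using h2
  · have : c r.1 = s * r := Subtype.ext rfl
    rw [hj, this, map_mul, ← hu, Units.inv_mul_cancel_left]

/-- It suffices to treat a series on a single branch. It is a scalar multiple of an idempotent plus
an element of positive order whose `N`-th power lies in `S`. -/
lemma isIntegral_algHom (h : IsBranchGlueing S N) {K : Type*} [CommRing K] [Algebra S K]
    [Algebra k K] [IsScalarTower k S K] (j : (Fin m → k⟦X⟧) →ₐ[k] K)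
    (hj : ∀ r : S, j r.1 = algebraMap S K r) (f : Fin m → k⟦X⟧) : IsIntegral S (j f) := by
  have hidem : ∀ i, IsIntegral S (j (Pi.single i 1)) := by
    intro i
    nontriviality S
    refine ⟨Polynomial.X ^ 2 - Polynomial.X,
      Polynomial.monic_X_pow_sub ((Polynomial.degree_X_le (R := S)).trans_lt (by norm_num)), ?_⟩
    rw [Polynomial.eval₂_sub, Polynomial.eval₂_pow, Polynomial.eval₂_X, ← map_pow, ← map_sub]
    convert map_zero j
    rw [sub_eq_zero, pow_two, ← Pi.single_mul, one_mul]
  have hT : ∀ i (g : k⟦X⟧), IsIntegral S (j (Pi.single i g)) := by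
    intro i g
    obtain ⟨g', hg'⟩ := exists_eq_C_add_X_mul g
    have h1 : (Pi.single i g : Fin m → k⟦X⟧) =
        coeff 0 g • (Pi.single i 1 : Fin m → k⟦X⟧) + Pi.single i (X * g') := by
      rw [← Pi.single_smul, ← Pi.single_add]
      conv_lhs => rw [hg']
      rw [smul_eq_C_mul, mul_one]
    rw [h1, map_add, map_smul]
    refine IsIntegral.add ?_ ?_
    · rw [algebra_compatible_smul S (coeff 0 g)]
      exact (hidem i).smul _
    · refine IsIntegral.of_pow h.exponent_pos ?_
      have : (Pi.single i (X * g') ^ N : Fin m → k⟦X⟧) = Pi.single i ((X * g') ^ N) := by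
        funext l
        by_cases hl : l = i
        · subst hl; simp
        · simp [Pi.single_eq_of_ne hl, h.exponent_pos.ne']
      rw [← map_pow, this]
      have h2 := hj ⟨Pi.single i ((X * g') ^ N),
        h.single_mem i (by rw [mul_pow]; exact dvd_mul_right _ _)⟩
      rw [h2]
      exact isIntegral_algebraMap
  rw [← Finset.univ_sum_single f, map_sum]
  exact IsIntegral.sum _ fun i _ => hT i _

/-- The projections to the branches extend to maps from `K` to `L` which are jointly injective. The
image of an integral element in each factor is integral over `k⟦X⟧`, hence a power series. -/
lemma exists_algHom_eq_of_isIntegral (h : IsBranchGlueing S N) {K : Type*} [CommRing K]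
    [Algebra S K] [Algebra k K] [IsScalarTower k S K] [IsFractionRing S K]
    (j : (Fin m → k⟦X⟧) →ₐ[k] K) (hj : ∀ r : S, j r.1 = algebraMap S K r) (L : Type*) [Field L]
    [Algebra k⟦X⟧ L] [IsFractionRing k⟦X⟧ L] {y : K} (hy : IsIntegral S y) : ∃ f, j f = y := by
  let s : S := ⟨_, h.X_pow_mem⟩
  have hs : s ∈ nonZeroDivisors S := (h.mem_nonZeroDivisors_iff s).mpr fun i => by simp [s]
  let pr : Fin m → S →+* k⟦X⟧ := fun i => (Pi.evalRingHom (fun _ => k⟦X⟧) i).comp S.val.toRingHom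
  have hunit : ∀ i (x : nonZeroDivisors S), IsUnit (((algebraMap k⟦X⟧ L).comp (pr i)) x) := by
    intro i x
    have : (x : S).1 i ≠ 0 := (h.mem_nonZeroDivisors_iff x).mp x.2 i
    refine IsUnit.mk0 _ fun h0 => this ?_
    exact (IsFractionRing.injective k⟦X⟧ L) (by rw [map_zero]; exact h0)
  let π : Fin m → K →+* L := fun i => IsLocalization.lift (hunit i)
  have hπ : ∀ i r, π i (algebraMap S K r) = algebraMap k⟦X⟧ L (r.1 i) :=
    fun i r => IsLocalization.lift_eq (hunit i) r
  have hπ0 : ∀ y, (∀ i, π i y = 0) → y = 0 := by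
    intro y hy
    obtain ⟨⟨a, b⟩, hab⟩ := IsLocalization.surj (nonZeroDivisors S) y
    have ha : a = 0 := by
      refine Subtype.ext (funext fun i => ?_)
      refine (IsFractionRing.injective k⟦X⟧ L) ?_
      rw [← hπ, ← hab, map_mul, hy, zero_mul]
      exact (map_zero _).symm
    simp only [ha, map_zero] at hab
    exact (IsUnit.mul_left_eq_zero (IsLocalization.map_units K b)).mp hab
  have hπj : ∀ i f, π i (j f) = algebraMap k⟦X⟧ L (f i) := by
    intro i f
    let c : S := ⟨s.1 * f, h.radicalPow_subset fun j => dvd_mul_right _ _⟩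
    have h1 : algebraMap S K s * j f = algebraMap S K c := by
      rw [← hj, ← hj, ← map_mul]
    have h2 := congrArg (π i) h1
    rw [map_mul, hπ, hπ] at h2
    have h3 : c.1 i = s.1 i * f i := rfl
    rw [h3, map_mul] at h2
    refine mul_left_cancel₀ ?_ h2
    intro h0
    have : s.1 i = 0 := (IsFractionRing.injective k⟦X⟧ L) (by rw [map_zero]; exact h0)
    exact (h.mem_nonZeroDivisors_iff s).mp hs i this
  have hint : ∀ i, ∃ g : k⟦X⟧, algebraMap k⟦X⟧ L g = π i y := by
    intro i
    have : IsIntegral k⟦X⟧ (π i y) :=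
      hy.map_of_comp_eq (pr i) (π i) (RingHom.ext fun r => (hπ i r).symm)
    exact IsIntegrallyClosed.isIntegral_iff.mp this
  choose g hg using hint
  refine ⟨g, ?_⟩
  rw [← sub_eq_zero]
  refine hπ0 _ fun i => ?_
  rw [map_sub, hπj, hg, sub_self]

theorem deltaInvariant_eq (h : IsBranchGlueing S N) :
    deltaInvariant k S = Module.finrank k ((Fin m → k⟦X⟧) ⧸ Subalgebra.toSubmodule S) := by
  obtain ⟨j, h1, h2⟩ := h.exists_algHom_fractionRing (FractionRing S)
  rw [deltaInvariant_eq_finrank S.val j h1 h2 fun y => ⟨?_, fun hy =>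
    h.exists_algHom_eq_of_isIntegral j h2 (FractionRing k⟦X⟧) hy⟩]
  swap
  · rintro ⟨f, rfl⟩
    exact h.isIntegral_algHom j h2 f
  have : LinearMap.range S.val.toLinearMap = Subalgebra.toSubmodule S := by
    ext f
    simp
  rw [this]

end IsBranchGlueing

/-! ### The two types as linear conditions on coefficients. -/

section

namespace PowerSeries

variable {R : Type*} [CommRing R] (f g : R⟦X⟧)

lemma coeff_zero_mul_eq : coeff 0 (f * g) = coeff 0 f * coeff 0 g := by simp

lemma coeff_one_mul_eq : coeff 1 (f * g) = coeff 0 f * coeff 1 g + coeff 1 f * coeff 0 g := by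
  rw [coeff_mul, Finset.Nat.sum_antidiagonal_eq_sum_range_succ_mk]
  simp [Finset.sum_range_succ]

lemma coeff_two_mul_eq : coeff 2 (f * g) =
    coeff 0 f * coeff 2 g + coeff 1 f * coeff 1 g + coeff 2 f * coeff 0 g := by
  rw [coeff_mul, Finset.Nat.sum_antidiagonal_eq_sum_range_succ_mk]
  simp [Finset.sum_range_succ]

lemma coeff_three_mul_eq : coeff 3 (f * g) = coeff 0 f * coeff 3 g + coeff 1 f * coeff 2 g
    + coeff 2 f * coeff 1 g + coeff 3 f * coeff 0 g := by
  rw [coeff_mul, Finset.Nat.sum_antidiagonal_eq_sum_range_succ_mk]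
  simp [Finset.sum_range_succ]

end PowerSeries

open PowerSeries

/-- The type I glueing of `m` branches, with the cuspidal branch `l`, by linear conditions. -/
noncomputable def glueI (k : Type*) [Field k] {m : ℕ} (l : Fin m) :
    Subalgebra k (Fin m → k⟦X⟧) where
  carrier := {f | (∀ i, coeff 0 (f i) = coeff 0 (f l)) ∧ coeff 1 (f l) = 0 ∧
    coeff 3 (f l) = ∑ i ∈ Finset.univ.erase l, coeff 1 (f i)}
  mul_mem' := by
    rintro f g ⟨hf0, hf1, hf3⟩ ⟨hg0, hg1, hg3⟩
    -- Since the linear coefficients vanish on `l`, the third coefficient on `l` obeys the Leibniz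
    -- rule at the origin, as the first coefficients on the other branches always do.
    simp only [Set.mem_ofPred_eq, Pi.mul_apply, coeff_zero_mul_eq, coeff_one_mul_eq,
      coeff_three_mul_eq, hf1, hg1, hf3, hg3, Finset.sum_add_distrib]
    refine ⟨fun i => by rw [hf0, hg0], by ring, ?_⟩
    have h1 : ∑ i ∈ Finset.univ.erase l, coeff 0 (f i) * coeff 1 (g i) =
        coeff 0 (f l) * ∑ i ∈ Finset.univ.erase l, coeff 1 (g i) := by
      rw [Finset.mul_sum]
      exact Finset.sum_congr rfl fun i _ => by rw [hf0]
    have h2 : ∑ i ∈ Finset.univ.erase l, coeff 1 (f i) * coeff 0 (g i) =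
        (∑ i ∈ Finset.univ.erase l, coeff 1 (f i)) * coeff 0 (g l) := by
      rw [Finset.sum_mul]
      exact Finset.sum_congr rfl fun i _ => by rw [hg0]
    rw [h1, h2]
    ring
  add_mem' := by
    rintro f g ⟨hf0, hf1, hf3⟩ ⟨hg0, hg1, hg3⟩
    simp only [Set.mem_ofPred_eq, Pi.add_apply, map_add, hf1, hg1, hf3, hg3,
      Finset.sum_add_distrib]
    exact ⟨fun i => by rw [hf0, hg0], by ring, trivial⟩
  algebraMap_mem' := fun r => by
    simp

lemma mem_glueI {k : Type*} [Field k] {m : ℕ} {l : Fin m} {f : Fin m → k⟦X⟧} :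
    f ∈ glueI k l ↔ (∀ i, coeff 0 (f i) = coeff 0 (f l)) ∧ coeff 1 (f l) = 0 ∧
      coeff 3 (f l) = ∑ i ∈ Finset.univ.erase l, coeff 1 (f i) := Iff.rfl

/-- The type II glueing of `m` branches, with the tangent branches `p` and `l`, by linear
conditions. -/
noncomputable def glueII (k : Type*) [Field k] {m : ℕ} (p l : Fin m) :
    Subalgebra k (Fin m → k⟦X⟧) where
  carrier := {f | (∀ i, coeff 0 (f i) = coeff 0 (f l)) ∧ coeff 1 (f l) = coeff 1 (f p) ∧
    coeff 2 (f l) = coeff 2 (f p) + ∑ i ∈ (Finset.univ.erase l).erase p, coeff 1 (f i)}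
  mul_mem' := by
    rintro f g ⟨hf0, hf1, hf2⟩ ⟨hg0, hg1, hg2⟩
    -- The products of linear coefficients in the second coefficients on `l` and on `p` are equal
    -- and cancel; what is left is again a Leibniz rule.
    simp only [Set.mem_ofPred_eq, Pi.mul_apply, coeff_zero_mul_eq, coeff_one_mul_eq,
      coeff_two_mul_eq, hf1, hg1, hf2, hg2, Finset.sum_add_distrib]
    refine ⟨fun i => by rw [hf0, hg0], by rw [hf0 p, hg0 p], ?_⟩
    have h1 : ∑ i ∈ (Finset.univ.erase l).erase p, coeff 0 (f i) * coeff 1 (g i) =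
        coeff 0 (f l) * ∑ i ∈ (Finset.univ.erase l).erase p, coeff 1 (g i) := by
      rw [Finset.mul_sum]
      exact Finset.sum_congr rfl fun i _ => by rw [hf0]
    have h2 : ∑ i ∈ (Finset.univ.erase l).erase p, coeff 1 (f i) * coeff 0 (g i) =
        (∑ i ∈ (Finset.univ.erase l).erase p, coeff 1 (f i)) * coeff 0 (g l) := by
      rw [Finset.sum_mul]
      exact Finset.sum_congr rfl fun i _ => by rw [hg0]
    rw [h1, h2, hf0 p, hg0 p]
    ring
  add_mem' := by
    rintro f g ⟨hf0, hf1, hf2⟩ ⟨hg0, hg1, hg2⟩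
    simp only [Set.mem_ofPred_eq, Pi.add_apply, map_add, hf1, hg1, hf2, hg2,
      Finset.sum_add_distrib]
    exact ⟨fun i => by rw [hf0, hg0], trivial, by ring⟩
  algebraMap_mem' := fun r => by
    simp

lemma mem_glueII {k : Type*} [Field k] {m : ℕ} {p l : Fin m} {f : Fin m → k⟦X⟧} :
    f ∈ glueII k p l ↔ (∀ i, coeff 0 (f i) = coeff 0 (f l)) ∧ coeff 1 (f l) = coeff 1 (f p) ∧
      coeff 2 (f l) = coeff 2 (f p) + ∑ i ∈ (Finset.univ.erase l).erase p, coeff 1 (f i) :=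
  Iff.rfl

section

variable {k : Type*} [Field k] {m : ℕ}

lemma coeff_eq_zero_of_mem_radicalPow {N n : ℕ} (hn : n < N) {f : Fin m → k⟦X⟧}
    (hf : f ∈ radicalPow k m N) (i : Fin m) : coeff n (f i) = 0 :=
  X_pow_dvd_iff.mp (hf i) n hn

lemma isBranchGlueing_glueI (l : Fin m) : IsBranchGlueing (glueI k l) 4 where
  pos := l.pos
  exponent_pos := by norm_num
  coeff_zero_eq := fun f hf i j => by rw [hf.1 i, hf.1 j]
  radicalPow_subset := fun f hf => by
    have h := fun n (hn : n < 4) => coeff_eq_zero_of_mem_radicalPow hn hf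
    simp [SetLike.mem_coe, mem_glueI, h 0, h 1, h 3, -coeff_zero_eq_constantCoeff]

lemma isBranchGlueing_glueII (p l : Fin m) : IsBranchGlueing (glueII k p l) 3 where
  pos := l.pos
  exponent_pos := by norm_num
  coeff_zero_eq := fun f hf i j => by rw [hf.1 i, hf.1 j]
  radicalPow_subset := fun f hf => by
    have h := fun n (hn : n < 3) => coeff_eq_zero_of_mem_radicalPow hn hf
    simp [SetLike.mem_coe, mem_glueII, h 0, h 1, h 2, -coeff_zero_eq_constantCoeff]

/-- The coordinate `t_i ⊕ t_l ^ n`. -/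
noncomputable def tangentCoord (k : Type*) [Field k] {m : ℕ} (l i : Fin m) (n : ℕ) :
    Fin m → k⟦X⟧ :=
  Pi.single i X + Pi.single l (X ^ n)

lemma tangentCoord_self {l i : Fin m} (h : i ≠ l) (n : ℕ) : tangentCoord k l i n i = X := by
  simp [tangentCoord, h]

lemma tangentCoord_last {l i : Fin m} (h : i ≠ l) (n : ℕ) :
    tangentCoord k l i n l = X ^ n := by
  simp [tangentCoord, h.symm]

lemma tangentCoord_of_ne {l i j : Fin m} (hi : j ≠ i) (hl : j ≠ l) (n : ℕ) :
    tangentCoord k l i n j = 0 := by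
  simp [tangentCoord, hi, hl]

lemma coeff_zero_tangentCoord {l i : Fin m} (h : i ≠ l) {n : ℕ} (hn : n ≠ 0) (j : Fin m) :
    coeff 0 (tangentCoord k l i n j) = 0 := by
  by_cases hi : j = i
  · subst hi; simp [tangentCoord_self h]
  by_cases hl : j = l
  · subst hl; simp [tangentCoord_last h, hn.symm]
  simp [tangentCoord_of_ne hi hl]

lemma sum_coeff_one_tangentCoord {l i : Fin m} (h : i ≠ l) (n : ℕ) {s : Finset (Fin m)}
    (hl : l ∉ s) :
    ∑ j ∈ s, coeff 1 (tangentCoord k l i n j) = if i ∈ s then 1 else 0 := by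
  have : ∀ j ∈ s, coeff 1 (tangentCoord k l i n j) = if i = j then 1 else 0 := by
    intro j hj
    by_cases hi : i = j
    · subst hi; simp [tangentCoord_self h]
    · rw [if_neg hi, tangentCoord_of_ne (Ne.symm hi) (by rintro rfl; exact hl hj)]; simp
  rw [Finset.sum_congr rfl this, Finset.sum_ite_eq]

lemma tangentCoord_mem_glueI {l i : Fin m} (h : i ≠ l) : tangentCoord k l i 3 ∈ glueI k l := by
  refine ⟨fun j => ?_, ?_, ?_⟩
  · rw [coeff_zero_tangentCoord h (by norm_num), coeff_zero_tangentCoord h (by norm_num)]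
  · simp [tangentCoord_last h, coeff_X_pow]
  · rw [sum_coeff_one_tangentCoord h _ (by simp), tangentCoord_last h]
    simp [h, coeff_X_pow]

lemma single_sq_mem_glueI {l i : Fin m} : (Pi.single i (X ^ 2) : Fin m → k⟦X⟧) ∈ glueI k l := by
  have h : ∀ n, n ≠ 2 → ∀ j, coeff n ((Pi.single i (X ^ 2) : Fin m → k⟦X⟧) j) = 0 := by
    intro n hn j
    by_cases hj : j = i
    · subst hj; simp [coeff_X_pow, hn]
    · simp [Pi.single_eq_of_ne hj]
  refine ⟨fun j => ?_, h 1 (by norm_num) l, ?_⟩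
  · rw [h 0 (by norm_num), h 0 (by norm_num)]
  · rw [h 3 (by norm_num), Finset.sum_eq_zero fun j _ => h 1 (by norm_num) j]

lemma tangentCoord_mem_glueII {p l i : Fin m} (hp : i ≠ p) (h : i ≠ l) (hpl : p ≠ l) :
    tangentCoord k l i 2 ∈ glueII k p l := by
  refine ⟨fun j => ?_, ?_, ?_⟩
  · rw [coeff_zero_tangentCoord h (by norm_num), coeff_zero_tangentCoord h (by norm_num)]
  · simp [tangentCoord_last h, coeff_X_pow, tangentCoord_of_ne hp.symm hpl]
  · rw [sum_coeff_one_tangentCoord h _ (by simp), tangentCoord_last h,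
      tangentCoord_of_ne hp.symm hpl]
    simp [h, hp]

lemma tangentCoord_mem_glueII_self {p l : Fin m} (hpl : p ≠ l) :
    tangentCoord k l p 1 ∈ glueII k p l := by
  refine ⟨fun j => ?_, ?_, ?_⟩
  · rw [coeff_zero_tangentCoord hpl (by norm_num), coeff_zero_tangentCoord hpl (by norm_num)]
  · simp [tangentCoord_last hpl, tangentCoord_self hpl]
  · rw [sum_coeff_one_tangentCoord hpl _ (by simp), tangentCoord_last hpl, tangentCoord_self hpl]
    simp

lemma single_sq_mem_glueII {p l i : Fin m} (hp : i ≠ p) (h : i ≠ l) :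
    (Pi.single i (X ^ 2) : Fin m → k⟦X⟧) ∈ glueII k p l := by
  have h1 : ∀ n, n ≠ 2 → ∀ j, coeff n ((Pi.single i (X ^ 2) : Fin m → k⟦X⟧) j) = 0 := by
    intro n hn j
    by_cases hj : j = i
    · subst hj; simp [coeff_X_pow, hn]
    · simp [Pi.single_eq_of_ne hj]
  refine ⟨fun j => ?_, ?_, ?_⟩
  · rw [h1 0 (by norm_num), h1 0 (by norm_num)]
  · rw [h1 1 (by norm_num), h1 1 (by norm_num)]
  · rw [Finset.sum_eq_zero fun j _ => h1 1 (by norm_num) j]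
    simp [Pi.single_eq_of_ne hp.symm, Pi.single_eq_of_ne h.symm]

lemma paramI_last {l : Fin m} (hl : l.val + 1 = m) : paramI k m l = Pi.single l (X ^ 2) := by
  funext j
  by_cases hj : j = l
  · subst hj; simp [paramI, hl]
  · simp [paramI, hl, hj]

lemma paramI_of_ne {l i : Fin m} (hl : l.val + 1 = m) (h : i ≠ l) :
    paramI k m i = tangentCoord k l i 3 := by
  have hi : i.val + 1 ≠ m := fun hi => h (Fin.ext (by omega))
  funext j
  by_cases hji : j = i
  · subst hji; simp [paramI, hi, tangentCoord_self h]
  by_cases hjl : j = l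
  · subst hjl; simp [paramI, hi, hji, hl, tangentCoord_last h]
  · have : j.val + 1 ≠ m := fun hj => hjl (Fin.ext (by omega))
    simp [paramI, hi, hji, this, tangentCoord_of_ne hji hjl]

lemma paramII_eq {l : Fin m} (hl : l.val + 1 = m) {i : Fin (m - 1)} {i' : Fin m}
    (hi : i'.val = i.val) :
    paramII k m i = tangentCoord k l i' (if i'.val = 0 then 1 else 2) := by
  have h : i' ≠ l := fun h => by have := i.2; subst h; omega
  funext j
  by_cases hji : j = i'
  · subst hji; simp [paramII, tangentCoord_self h, hi]
  have hji' : j.val ≠ i.val := fun h => hji (Fin.ext (by omega))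
  by_cases hjl : j = l
  · subst hjl
    rw [tangentCoord_last h]
    simp only [paramII, hji', if_false, hl, if_true, hi]
    split_ifs <;> simp
  · have : j.val + 1 ≠ m := fun hj => hjl (Fin.ext (by omega))
    simp [paramII, hji', this, tangentCoord_of_ne hji hjl]

/-- For the inclusion of `glueI`, subtract from `f` a polynomial in the coordinates with the same
terms of order at most three on every branch. The cubic term on `l` comes out right without
adjustment: the linear terms of the other branches contribute exactly the sum that the last
condition of `glueI` prescribes. -/
theorem typeI_eq_glueI {l : Fin m} (hl : l.val + 1 = m) : typeI k m = glueI k l := by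
  refine le_antisymm (Algebra.adjoin_le (Set.union_subset ?_
    (isBranchGlueing_glueI l).radicalPow_subset)) ?_
  · rintro _ ⟨i, rfl⟩
    by_cases h : i = l
    · subst h; rw [paramI_last hl]; exact single_sq_mem_glueI
    · rw [paramI_of_ne hl h]; exact tangentCoord_mem_glueI h
  · intro f hf
    have hx : ∀ i, i ≠ l → tangentCoord k l i 3 ∈ typeI k m := fun i hi =>
      Algebra.subset_adjoin (Or.inl ⟨i, paramI_of_ne hl hi⟩)
    have hz : Pi.single l (X ^ 2) ∈ typeI k m :=
      Algebra.subset_adjoin (Or.inl ⟨l, paramI_last hl⟩)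
    set p : Fin m → k⟦X⟧ := algebraMap k _ (coeff 0 (f l)) + coeff 2 (f l) • (Pi.single l (X ^ 2) : Fin m → k⟦X⟧)
      + ∑ i ∈ Finset.univ.erase l, (coeff 1 (f i) • tangentCoord k l i 3
        + coeff 2 (f i) • tangentCoord k l i 3 ^ 2 + coeff 3 (f i) • tangentCoord k l i 3 ^ 3)
      with hp
    have hpS : p ∈ typeI k m := by
      refine add_mem (add_mem (Subalgebra.algebraMap_mem _ _) (Subalgebra.smul_mem _ hz _))
        (sum_mem fun i hi => ?_)
      have hi := hx i (Finset.ne_of_mem_erase hi)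
      exact add_mem (add_mem (Subalgebra.smul_mem _ hi _)
        (Subalgebra.smul_mem _ (pow_mem hi 2) _)) (Subalgebra.smul_mem _ (pow_mem hi 3) _)
    have hr : f - p ∈ radicalPow k m 4 := by
      intro j
      obtain ⟨g, hg⟩ := exists_eq_add_X_pow_four_mul (f j)
      have hc : (algebraMap k (Fin m → k⟦X⟧) (coeff 0 (f l))) j = C (coeff 0 (f l)) := rfl
      by_cases hj : j = l
      · subst hj
        have hs : ∑ i ∈ Finset.univ.erase j, (coeff 1 (f i) • tangentCoord k j i 3
            + coeff 2 (f i) • tangentCoord k j i 3 ^ 2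
            + coeff 3 (f i) • tangentCoord k j i 3 ^ 3) j =
            C (coeff 3 (f j)) * X ^ 3 + X ^ 4 * ∑ i ∈ Finset.univ.erase j,
              (C (coeff 2 (f i)) * X ^ 2 + C (coeff 3 (f i)) * X ^ 5) := by
          rw [hf.2.2, map_sum, Finset.sum_mul, Finset.mul_sum, ← Finset.sum_add_distrib]
          refine Finset.sum_congr rfl fun i hi => ?_
          simp only [Pi.add_apply, Pi.smul_apply, Pi.pow_apply,
            tangentCoord_last (Finset.ne_of_mem_erase hi), smul_eq_C_mul]
          ring
        rw [Pi.sub_apply, hp, Pi.add_apply, Pi.add_apply, Finset.sum_apply, hs, Pi.smul_apply,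
          Pi.single_eq_same, hc, smul_eq_C_mul]
        refine ⟨g - ∑ i ∈ Finset.univ.erase j,
              (C (coeff 2 (f i)) * X ^ 2 + C (coeff 3 (f i)) * X ^ 5), ?_⟩
        have h1 := hf.2.1
        rw [h1, map_zero] at hg
        linear_combination hg
      · have hs : ∑ i ∈ Finset.univ.erase l, (coeff 1 (f i) • tangentCoord k l i 3
            + coeff 2 (f i) • tangentCoord k l i 3 ^ 2
            + coeff 3 (f i) • tangentCoord k l i 3 ^ 3) j =
            C (coeff 1 (f j)) * X + C (coeff 2 (f j)) * X ^ 2 + C (coeff 3 (f j)) * X ^ 3 := by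
          rw [Finset.sum_eq_single_of_mem j (by simp [hj])]
          · simp only [Pi.add_apply, Pi.smul_apply, Pi.pow_apply, tangentCoord_self hj,
              smul_eq_C_mul]
          · intro i _ hij
            simp [tangentCoord_of_ne hij.symm hj]
        rw [Pi.sub_apply, hp, Pi.add_apply, Pi.add_apply, Finset.sum_apply, hs, Pi.smul_apply,
          Pi.single_eq_of_ne hj, hc, ← hf.1 j]
        refine ⟨g, ?_⟩
        rw [smul_zero]
        linear_combination hg
    have := add_mem (Algebra.subset_adjoin (Or.inr hr) : f - p ∈ typeI k m) hpS
    rwa [sub_add_cancel] at this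

/-- Again `f` is approximated by a polynomial in the coordinates, now up to order two. The two
conditions of `glueII` say that the terms of order one and two which the other branches force on `l`
are those of `f`. -/
theorem typeII_eq_glueII {p l : Fin m} (hp : p.val = 0) (hl : l.val + 1 = m) (hpl : p ≠ l) :
    typeII k m = glueII k p l := by
  set e : Fin m → ℕ := fun i => if i.val = 0 then 1 else 2
  have hep : e p = 1 := if_pos hp
  have hei : ∀ i, i ≠ p → e i = 2 := fun i hi => if_neg fun h => hi (Fin.ext (by omega))
  refine le_antisymm (Algebra.adjoin_le (Set.union_subset ?_
    (isBranchGlueing_glueII p l).radicalPow_subset)) ?_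
  · rintro _ ⟨i, rfl⟩
    set i' : Fin m := ⟨i.val, by omega⟩
    have hil : i' ≠ l := fun h => by
      have := i.2
      have := congrArg Fin.val h
      simp only [i'] at this
      omega
    rw [paramII_eq hl (i' := i') rfl]
    by_cases h : i' = p
    · rw [h]
      change tangentCoord k l p (e p) ∈ _
      rw [hep]
      exact tangentCoord_mem_glueII_self hpl
    · change tangentCoord k l i' (e i') ∈ _
      rw [hei _ h]
      exact tangentCoord_mem_glueII h hil hpl
  · intro f hf
    have hx : ∀ i, i ≠ l → tangentCoord k l i (e i) ∈ typeII k m := fun i hi =>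
      Algebra.subset_adjoin (Or.inl ⟨⟨i.val, by
        have : i.val ≠ l.val := fun h => hi (Fin.ext h)
        omega⟩, paramII_eq hl rfl⟩)
    set q : Fin m → k⟦X⟧ := algebraMap k _ (coeff 0 (f l))
      + ∑ i ∈ Finset.univ.erase l, (coeff 1 (f i) • tangentCoord k l i (e i)
        + coeff 2 (f i) • tangentCoord k l i (e i) ^ 2)
      with hq
    have hqS : q ∈ typeII k m := by
      refine add_mem (Subalgebra.algebraMap_mem _ _) (sum_mem fun i hi => ?_)
      have hi := hx i (Finset.ne_of_mem_erase hi)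
      exact add_mem (Subalgebra.smul_mem _ hi _) (Subalgebra.smul_mem _ (pow_mem hi 2) _)
    have hr : f - q ∈ radicalPow k m 3 := by
      intro j
      obtain ⟨g, hg⟩ := exists_eq_add_X_pow_four_mul (f j)
      have hc : (algebraMap k (Fin m → k⟦X⟧) (coeff 0 (f l))) j = C (coeff 0 (f l)) := rfl
      by_cases hj : j = l
      · subst hj
        have hs : ∑ i ∈ Finset.univ.erase j, (coeff 1 (f i) • tangentCoord k j i (e i)
            + coeff 2 (f i) • tangentCoord k j i (e i) ^ 2) j =
            C (coeff 1 (f j)) * X + C (coeff 2 (f j)) * X ^ 2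
              + X ^ 3 * ∑ i ∈ (Finset.univ.erase j).erase p, C (coeff 2 (f i)) * X := by
          rw [hf.2.1, hf.2.2, map_add, map_sum, add_mul, Finset.sum_mul, Finset.mul_sum,
            ← Finset.add_sum_erase _ _ (show p ∈ Finset.univ.erase j by simp [hpl])]
          simp only [Pi.add_apply, Pi.smul_apply, Pi.pow_apply, hep,
            tangentCoord_last hpl, smul_eq_C_mul]
          have : ∀ i ∈ (Finset.univ.erase j).erase p,
              C (coeff 1 (f i)) * tangentCoord k j i (e i) j
                + C (coeff 2 (f i)) * tangentCoord k j i (e i) j ^ 2 =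
              C (coeff 1 (f i)) * X ^ 2 + X ^ 3 * (C (coeff 2 (f i)) * X) := by
            intro i hi
            rw [hei i (Finset.ne_of_mem_erase hi),
              tangentCoord_last (Finset.ne_of_mem_erase (Finset.mem_of_mem_erase hi))]
            ring
          rw [Finset.sum_congr rfl this, Finset.sum_add_distrib]
          ring
        rw [Pi.sub_apply, hq, Pi.add_apply, Finset.sum_apply, hs, hc]
        refine ⟨C (coeff 3 (f j)) + X * g
          - ∑ i ∈ (Finset.univ.erase j).erase p, C (coeff 2 (f i)) * X, ?_⟩
        linear_combination hg
      · have hs : ∑ i ∈ Finset.univ.erase l, (coeff 1 (f i) • tangentCoord k l i (e i)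
            + coeff 2 (f i) • tangentCoord k l i (e i) ^ 2) j =
            C (coeff 1 (f j)) * X + C (coeff 2 (f j)) * X ^ 2 := by
          rw [Finset.sum_eq_single_of_mem j (by simp [hj])]
          · simp only [Pi.add_apply, Pi.smul_apply, Pi.pow_apply, tangentCoord_self hj,
              smul_eq_C_mul]
          · intro i _ hij
            simp [tangentCoord_of_ne hij.symm hj]
        rw [Pi.sub_apply, hq, Pi.add_apply, Finset.sum_apply, hs, hc, ← hf.1 j]
        refine ⟨C (coeff 3 (f j)) + X * g, ?_⟩
        linear_combination hg
    have := add_mem (Algebra.subset_adjoin (Or.inr hr) : f - q ∈ typeII k m) hqS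
    rwa [sub_add_cancel] at this

lemma finrank_quotient_of_surjective {V W : Type*} [AddCommGroup V] [Module k V]
    [AddCommGroup W] [Module k W] (P : Submodule k V) (φ : V →ₗ[k] W)
    (hφ : Function.Surjective φ) (hP : LinearMap.ker φ = P) :
    Module.finrank k (V ⧸ P) = Module.finrank k W := by
  subst hP
  exact (φ.quotKerEquivOfSurjective hφ).finrank_eq

/-- The differences of the values at the origin of the branches `i` and `l`. -/
noncomputable def valueDiff (k : Type*) [Field k] {m : ℕ} (l : Fin m) :
    (Fin m → k⟦X⟧) →ₗ[k] ({i : Fin m // i ≠ l} → k) :=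
  LinearMap.pi fun i => (coeff 0).comp (LinearMap.proj i.1) - (coeff 0).comp (LinearMap.proj l)

lemma valueDiff_eq_zero_iff {l : Fin m} {f : Fin m → k⟦X⟧} :
    valueDiff k l f = 0 ↔ ∀ i, coeff 0 (f i) = coeff 0 (f l) := by
  constructor
  · intro h i
    by_cases hi : i = l
    · rw [hi]
    · exact sub_eq_zero.mp (congrFun h ⟨i, hi⟩)
  · intro h
    funext i
    exact sub_eq_zero.mpr (h i.1)

lemma finrank_valueDiff_codomain (l : Fin m) :
    Module.finrank k ({i : Fin m // i ≠ l} → k) + 1 = m := by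
  have h1 : Fintype.card {i : Fin m // i ≠ l} = m - 1 := by
    rw [Fintype.card_subtype_compl]; simp
  have := l.pos
  rw [Module.finrank_fintype_fun_eq_card, h1]
  omega

/-- The conditions are independent: constants on the branches other than `l` realise the `m - 1`
differences of values, while `X` and `X ^ 3` on `l` realise the other two. -/
lemma finrank_quotient_glueI (l : Fin m) :
    Module.finrank k ((Fin m → k⟦X⟧) ⧸ Subalgebra.toSubmodule (glueI k l)) = m + 1 := by
  let pr : Fin m → ℕ → (Fin m → k⟦X⟧) →ₗ[k] k := fun i n => (coeff n).comp (LinearMap.proj i)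
  rw [finrank_quotient_of_surjective _ ((valueDiff k l).prod ((pr l 1).prod
    (pr l 3 - ∑ i ∈ Finset.univ.erase l, pr i 1))) ?_ ?_]
  · have := finrank_valueDiff_codomain (k := k) l
    simp only [Module.finrank_prod, Module.finrank_self]
    omega
  · rintro ⟨v, a, b⟩
    refine ⟨fun j => if h : j = l then C a * X + C b * X ^ 3 else C (v ⟨j, h⟩), ?_⟩
    have hs : ∑ i ∈ Finset.univ.erase l,
        coeff 1 (if h : i = l then C a * X + C b * X ^ 3 else C (v ⟨i, h⟩)) = 0 :=
      Finset.sum_eq_zero fun i hi => by simp [Finset.ne_of_mem_erase hi]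
    refine Prod.ext (funext fun i => ?_) (Prod.ext ?_ ?_)
    · simp [valueDiff, i.2]
    · simp [pr, coeff_X_pow]
    · simp [pr, LinearMap.sum_apply, hs, -Finset.sum_erase_eq_sub]
  · ext f
    simp [mem_glueI, valueDiff_eq_zero_iff, pr, sub_eq_zero, -coeff_zero_eq_constantCoeff,
      LinearMap.sum_apply]

lemma finrank_quotient_glueII {p l : Fin m} (hpl : p ≠ l) :
    Module.finrank k ((Fin m → k⟦X⟧) ⧸ Subalgebra.toSubmodule (glueII k p l)) = m + 1 := by
  let pr : Fin m → ℕ → (Fin m → k⟦X⟧) →ₗ[k] k := fun i n => (coeff n).comp (LinearMap.proj i)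
  rw [finrank_quotient_of_surjective _ ((valueDiff k l).prod ((pr l 1 - pr p 1).prod
    (pr l 2 - (pr p 2 + ∑ i ∈ (Finset.univ.erase l).erase p, pr i 1)))) ?_ ?_]
  · have := finrank_valueDiff_codomain (k := k) l
    simp only [Module.finrank_prod, Module.finrank_self]
    omega
  · rintro ⟨v, a, b⟩
    refine ⟨fun j => if h : j = l then C a * X + C b * X ^ 2 else C (v ⟨j, h⟩), ?_⟩
    have hs : ∑ i ∈ (Finset.univ.erase l).erase p,
        coeff 1 (if h : i = l then C a * X + C b * X ^ 2 else C (v ⟨i, h⟩)) = 0 :=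
      Finset.sum_eq_zero fun i hi => by
        simp [Finset.ne_of_mem_erase (Finset.mem_of_mem_erase hi)]
    refine Prod.ext (funext fun i => ?_) (Prod.ext ?_ ?_)
    · simp [valueDiff, i.2]
    · simp [pr, coeff_X_pow, hpl, coeff_C]
    · simp [pr, LinearMap.sum_apply, hs, hpl, coeff_C, -Finset.sum_erase_eq_sub]
  · ext f
    simp [mem_glueII, valueDiff_eq_zero_iff, pr, sub_eq_zero, -coeff_zero_eq_constantCoeff,
      LinearMap.sum_apply]

end

end

/-! ### Both types are Gorenstein, and they are not isomorphic. -/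

section

open PowerSeries

/-- A one-dimensional local ring is Gorenstein as soon as, modulo some nonzerodivisor `x`, the
class of one element `y` is a nonzero generator of the socle. -/
theorem isGorensteinDimOne_of_socle {R : Type*} [CommRing R] [IsLocalRing R] {x y : R}
    (hx : x ∈ IsLocalRing.maximalIdeal R) (hx' : x ∈ nonZeroDivisors R)
    (hy : ∀ h ∈ IsLocalRing.maximalIdeal R, x ∣ y * h) (hxy : ¬ x ∣ y)
    (hgen : ∀ a, (∀ h ∈ IsLocalRing.maximalIdeal R, x ∣ a * h) → ∃ r, x ∣ a - r * y) :
    IsGorensteinDimOne R := by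
  refine ⟨x, hx, hx', ?_⟩
  set W := Submodule.torsionBySet R (R ⧸ Ideal.span {x}) (IsLocalRing.maximalIdeal R : Set R)
  have hmem : ∀ a : R, Ideal.Quotient.mk (Ideal.span {x}) a ∈ W ↔
      ∀ h ∈ IsLocalRing.maximalIdeal R, x ∣ a * h := by
    intro a
    rw [Submodule.mem_torsionBySet_iff]
    have key : ∀ h : R, h • Ideal.Quotient.mk (Ideal.span {x}) a = 0 ↔ x ∣ a * h := by
      intro h
      rw [← Ideal.mem_span_singleton, ← Ideal.Quotient.eq_zero_iff_mem, map_mul, mul_comm]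
      rfl
    constructor
    · intro H h hh
      exact (key h).mp (H ⟨h, hh⟩)
    · rintro H ⟨h, hh⟩
      exact (key h).mpr (H h hh)
  have hzero : ∀ a : R, Ideal.Quotient.mk (Ideal.span {x}) a = 0 ↔ x ∣ a := fun a => by
    rw [Ideal.Quotient.eq_zero_iff_mem, Ideal.mem_span_singleton]
  rw [isSimpleModule_iff_toSpanSingleton_surjective]
  constructor
  · refine ⟨⟨⟨_, (hmem y).mpr hy⟩, 0, fun h => hxy ?_⟩⟩
    rw [← hzero]
    exact congrArg Subtype.val h
  · rintro ⟨a', ha⟩ hne ⟨b', hb⟩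
    obtain ⟨a, rfl⟩ := Ideal.Quotient.mk_surjective a'
    obtain ⟨b, rfl⟩ := Ideal.Quotient.mk_surjective b'
    have hxa : ¬ x ∣ a := fun h => hne (Subtype.ext ((hzero a).mpr h))
    obtain ⟨r, hr⟩ := hgen a ((hmem a).mp ha)
    obtain ⟨r', hr'⟩ := hgen b ((hmem b).mp hb)
    -- If `r` were in the maximal ideal, `r * y` and with it `a` would vanish modulo `x`. So a
    -- nonzero socle element is a unit multiple of `y`.
    have hru : IsUnit r := by
      by_contra hru
      refine hxa ((dvd_sub_left ?_).mp hr)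
      rw [mul_comm]
      exact hy r hru
    obtain ⟨u, hu⟩ := hru.exists_left_inv
    refine ⟨r' * u, Subtype.ext ?_⟩
    change Ideal.Quotient.mk _ (r' * u * a) = Ideal.Quotient.mk _ b
    rw [Ideal.Quotient.mk_eq_mk_iff_sub_mem, Ideal.mem_span_singleton]
    have : r' * u * a - b = r' * u * (a - r * y) - (b - r' * y) := by
      linear_combination r' * y * hu
    rw [this]
    exact dvd_sub (Dvd.dvd.mul_left hr _) hr'

section

variable {k : Type*} [Field k] {m : ℕ}

lemma X_sq_dvd_of_coeff {f : k⟦X⟧} (h0 : coeff 0 f = 0) (h1 : coeff 1 f = 0) : X ^ 2 ∣ f := by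
  rw [X_pow_dvd_iff]
  intro n hn
  interval_cases n <;> assumption

lemma X_cube_dvd_of_coeff {f : k⟦X⟧} (h0 : coeff 0 f = 0) (h1 : coeff 1 f = 0)
    (h2 : coeff 2 f = 0) : X ^ 3 ∣ f := by
  rw [X_pow_dvd_iff]
  intro n hn
  interval_cases n <;> assumption

/-- Take `x = X ^ 4` on all branches. Dividing the socle of the quotient by `x` leads to the `q`
which multiply the maximal ideal into the glueing. Testing against coordinates shows that such a `q`
satisfies every condition of `glueI` except the one on the third coefficient, so it lies in the
glueing up to a multiple of `X ^ 3` on `l`. This explains `y = X ^ 7` on `l`. -/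
theorem isGorensteinDimOne_glueI (l : Fin m) (hm : 2 ≤ m) [IsLocalRing (glueI k l)] :
    IsGorensteinDimOne (glueI k l) := by
  have hS := isBranchGlueing_glueI (k := k) l
  obtain ⟨i₀, hi₀⟩ : ∃ i₀ : Fin m, i₀ ≠ l := by
    have : Nontrivial (Fin m) := Fin.nontrivial_iff_two_le.mpr hm
    exact exists_ne l
  let x : glueI k l := ⟨_, hS.X_pow_mem⟩
  let y : glueI k l := ⟨Pi.single l (X ^ 7), hS.single_mem l (pow_dvd_pow _ (by norm_num))⟩
  have hdvd : ∀ {a : glueI k l} {h : Fin m → k⟦X⟧} {hh : h ∈ glueI k l}, x ∣ a * ⟨h, hh⟩ →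
      ∃ s ∈ glueI k l, ∀ i, a.1 i * h i = X ^ 4 * s i := by
    rintro a h hh ⟨s, hs⟩
    exact ⟨s.1, s.2, fun i => congrFun (congrArg Subtype.val hs) i⟩
  have hX4 : (X ^ 4 : k⟦X⟧) ≠ 0 := by simp
  refine isGorensteinDimOne_of_socle (x := x) (y := y) ?_ ?_ ?_ ?_ ?_
  · rw [hS.mem_maximalIdeal_iff _ l]; simp [x]
  · rw [hS.mem_nonZeroDivisors_iff]; simp [x]
  · intro h hh
    obtain ⟨q, hq⟩ : X ∣ h.1 l := by
      rw [X_dvd_iff]; simpa using (hS.mem_maximalIdeal_iff h l).mp hh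
    refine ⟨⟨Pi.single l (X ^ 4 * q), hS.single_mem l (dvd_mul_right _ _)⟩,
      Subtype.ext (funext fun j => ?_)⟩
    change (Pi.single l (X ^ 7) : Fin m → k⟦X⟧) j * h.1 j =
      X ^ 4 * (Pi.single l (X ^ 4 * q) : Fin m → k⟦X⟧) j
    by_cases hj : j = l
    · subst hj; rw [Pi.single_eq_same, Pi.single_eq_same, hq]; ring
    · simp [Pi.single_eq_of_ne hj]
  · rintro ⟨s, hs⟩
    have hs' : ∀ j, (Pi.single l (X ^ 7) : Fin m → k⟦X⟧) j = X ^ 4 * s.1 j :=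
      fun j => congrFun (congrArg Subtype.val hs) j
    have h1 : s.1 l = X ^ 3 := by
      refine mul_left_cancel₀ hX4 ?_
      rw [← hs', Pi.single_eq_same]; ring
    have h2 : ∀ j, j ≠ l → s.1 j = 0 := by
      intro j hj
      refine mul_left_cancel₀ hX4 ?_
      rw [← hs', Pi.single_eq_of_ne hj, mul_zero]
    have h3 := s.2.2.2
    rw [Finset.sum_eq_zero fun i hi => by rw [h2 i (Finset.ne_of_mem_erase hi), map_zero], h1] at h3
    simp [coeff_X_pow] at h3
  · intro a ha
    have hmax : ∀ f (hf : f ∈ glueI k l), coeff 0 (f l) = 0 →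
        (⟨f, hf⟩ : glueI k l) ∈ IsLocalRing.maximalIdeal (glueI k l) :=
      fun f hf h0 => (hS.mem_maximalIdeal_iff _ l).mpr h0
    -- Test against `X ^ 2` on branch `i`: the quotient `s` is an element of the glueing supported
    -- on that branch, so it has order at least two there.
    have hq : ∀ i, ∃ q, a.1 i = X ^ 4 * q := by
      intro i
      obtain ⟨s, hs, has⟩ := hdvd (ha ⟨_, single_sq_mem_glueI (l := l) (i := i)⟩ (hmax _ _ (by
        by_cases h : l = i
        · subst h; simp
        · simp [Pi.single_eq_of_ne h])))
      have has' : ∀ j, j ≠ i → s j = 0 := by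
        intro j hj
        refine mul_left_cancel₀ hX4 ?_
        rw [← has]; simp [Pi.single_eq_of_ne hj]
      have hai : a.1 i * X ^ 2 = X ^ 4 * s i := by simpa using has i
      have hX2 : X ^ 2 ∣ s i := by
        by_cases hi : i = l
        · subst hi
          refine X_sq_dvd_of_coeff ?_ hs.2.1
          rw [← hs.1 i₀, has' i₀ hi₀, map_zero]
        · refine X_sq_dvd_of_coeff ?_ ?_
          · rw [hs.1 i, has' l (Ne.symm hi), map_zero]
          · have h3 := hs.2.2
            rw [has' l (Ne.symm hi), map_zero, Finset.sum_eq_single_of_mem i (by simp [hi])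
              (fun j _ hj => by rw [has' j hj, map_zero])] at h3
            exact h3.symm
      obtain ⟨q, hq⟩ := hX2
      refine ⟨q, mul_right_cancel₀ (b := (X ^ 2 : k⟦X⟧)) (by simp) ?_⟩
      rw [hai, hq]; ring
    choose q hq using hq
    -- Test against `X ^ 2` on `l`: the third coefficient of `X ^ 2 * q l` must vanish, since all
    -- other components do.
    have hql : coeff 1 (q l) = 0 := by
      obtain ⟨s, hs, has⟩ := hdvd (ha ⟨_, single_sq_mem_glueI (l := l) (i := l)⟩
        (hmax _ _ (by simp)))
      have hsl : s l = X ^ 2 * q l := by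
        refine mul_left_cancel₀ hX4 ?_
        rw [← has, Pi.single_eq_same, hq]; ring
      have h3 := hs.2.2
      rw [hsl, Finset.sum_eq_zero fun j hj => by
        have : s j = 0 := by
          refine mul_left_cancel₀ hX4 ?_
          rw [← has]; simp [Finset.ne_of_mem_erase hj]
        rw [this, map_zero]] at h3
      simpa [coeff_X_pow_mul'] using h3
    -- Test against `t_i ⊕ t_l ^ 3`: the third coefficient on `l` is the value of `q l`, the first
    -- on `i` is the value of `q i`.
    have hq0 : ∀ i, coeff 0 (q i) = coeff 0 (q l) := by
      intro i
      by_cases hi : i = l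
      · rw [hi]
      obtain ⟨s, hs, has⟩ := hdvd (ha ⟨_, tangentCoord_mem_glueI hi⟩
        (hmax _ _ (coeff_zero_tangentCoord hi (by norm_num) l)))
      have hs' : ∀ j, s j = q j * tangentCoord k l i 3 j := by
        intro j
        refine mul_left_cancel₀ hX4 ?_
        rw [← has, hq]; ring
      have h3 := hs.2.2
      rw [Finset.sum_eq_single_of_mem i (by simp [hi])] at h3
      · rw [hs', hs', tangentCoord_last hi, tangentCoord_self hi, coeff_mul_X_pow', if_pos le_rfl,
          coeff_one_mul_eq] at h3
        simpa using h3.symm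
      · intro j hj hji
        rw [hs', tangentCoord_of_ne hji (Finset.ne_of_mem_erase hj), mul_zero, map_zero]
    set c := coeff 3 (q l) - ∑ i ∈ Finset.univ.erase l, coeff 1 (q i) with hc
    have hqS : q - (Pi.single l (C c * X ^ 3) : Fin m → k⟦X⟧) ∈ glueI k l := by
      have h1 : ∀ i, i ≠ l → (q - (Pi.single l (C c * X ^ 3) : Fin m → k⟦X⟧) : Fin m → k⟦X⟧) i = q i := fun i hi => by
        simp [Pi.single_eq_of_ne hi]
      have h2 : (q - (Pi.single l (C c * X ^ 3) : Fin m → k⟦X⟧) : Fin m → k⟦X⟧) l = q l - C c * X ^ 3 := by simp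
      have h3 : coeff 0 ((q - (Pi.single l (C c * X ^ 3) : Fin m → k⟦X⟧) : Fin m → k⟦X⟧) l) = coeff 0 (q l) := by
        rw [h2]; simp
      refine ⟨fun i => ?_, ?_, ?_⟩
      · rw [h3]
        by_cases hi : i = l
        · subst hi; exact h3
        · rw [h1 i hi, hq0]
      · rw [h2, map_sub, hql, coeff_C_mul, coeff_X_pow]; simp
      · rw [Finset.sum_congr rfl fun i hi => by rw [h1 i (Finset.ne_of_mem_erase hi)], h2,
          map_sub, coeff_C_mul, coeff_X_pow, hc]
        simp
    refine ⟨algebraMap k _ c, ⟨_, hqS⟩, Subtype.ext (funext fun j => ?_)⟩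
    change a.1 j - C c * (Pi.single l (X ^ 7) : Fin m → k⟦X⟧) j =
      X ^ 4 * (q j - (Pi.single l (C c * X ^ 3) : Fin m → k⟦X⟧) j)
    rw [hq]
    by_cases hj : j = l
    · subst hj; rw [Pi.single_eq_same, Pi.single_eq_same]; ring
    · simp [Pi.single_eq_of_ne hj]

lemma single_cube_mem_glueII {p l i : Fin m} :
    (Pi.single i (X ^ 3) : Fin m → k⟦X⟧) ∈ glueII k p l :=
  (isBranchGlueing_glueII p l).single_mem i dvd_rfl

/-- The same method with `x = X ^ 3`. The element outside the glueing multiplying the maximal ideal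
into it is `X ^ 2` on `l`, whence `y = X ^ 5` on `l`. -/
theorem isGorensteinDimOne_glueII {p l : Fin m} (hpl : p ≠ l) [IsLocalRing (glueII k p l)] :
    IsGorensteinDimOne (glueII k p l) := by
  have hS := isBranchGlueing_glueII (k := k) p l
  let x : glueII k p l := ⟨_, hS.X_pow_mem⟩
  let y : glueII k p l := ⟨Pi.single l (X ^ 5), hS.single_mem l (pow_dvd_pow _ (by norm_num))⟩
  have hdvd : ∀ {a : glueII k p l} {h : Fin m → k⟦X⟧} {hh : h ∈ glueII k p l}, x ∣ a * ⟨h, hh⟩ →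
      ∃ s ∈ glueII k p l, ∀ i, a.1 i * h i = X ^ 3 * s i := by
    rintro a h hh ⟨s, hs⟩
    exact ⟨s.1, s.2, fun i => congrFun (congrArg Subtype.val hs) i⟩
  have hX3 : (X ^ 3 : k⟦X⟧) ≠ 0 := by simp
  refine isGorensteinDimOne_of_socle (x := x) (y := y) ?_ ?_ ?_ ?_ ?_
  · rw [hS.mem_maximalIdeal_iff _ l]; simp [x]
  · rw [hS.mem_nonZeroDivisors_iff]; simp [x]
  · intro h hh
    obtain ⟨q, hq⟩ : X ∣ h.1 l := by
      rw [X_dvd_iff]; simpa using (hS.mem_maximalIdeal_iff h l).mp hh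
    refine ⟨⟨Pi.single l (X ^ 3 * q), hS.single_mem l (dvd_mul_right _ _)⟩,
      Subtype.ext (funext fun j => ?_)⟩
    change (Pi.single l (X ^ 5) : Fin m → k⟦X⟧) j * h.1 j =
      X ^ 3 * (Pi.single l (X ^ 3 * q) : Fin m → k⟦X⟧) j
    by_cases hj : j = l
    · subst hj; rw [Pi.single_eq_same, Pi.single_eq_same, hq]; ring
    · simp [Pi.single_eq_of_ne hj]
  · rintro ⟨s, hs⟩
    have hs' : ∀ j, (Pi.single l (X ^ 5) : Fin m → k⟦X⟧) j = X ^ 3 * s.1 j :=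
      fun j => congrFun (congrArg Subtype.val hs) j
    have h1 : s.1 l = X ^ 2 := by
      refine mul_left_cancel₀ hX3 ?_
      rw [← hs', Pi.single_eq_same]; ring
    have h2 : ∀ j, j ≠ l → s.1 j = 0 := by
      intro j hj
      refine mul_left_cancel₀ hX3 ?_
      rw [← hs', Pi.single_eq_of_ne hj, mul_zero]
    have h3 := s.2.2.2
    rw [Finset.sum_eq_zero fun i hi => by
      rw [h2 i (Finset.ne_of_mem_erase (Finset.mem_of_mem_erase hi)), map_zero], h1, h2 p hpl] at h3
    simp at h3
  · intro a ha
    have hmax : ∀ f (hf : f ∈ glueII k p l), coeff 0 (f l) = 0 →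
        (⟨f, hf⟩ : glueII k p l) ∈ IsLocalRing.maximalIdeal (glueII k p l) :=
      fun f hf h0 => (hS.mem_maximalIdeal_iff _ l).mpr h0
    have hq : ∀ i, ∃ q, a.1 i = X ^ 3 * q := by
      intro i
      by_cases hi : i ≠ p ∧ i ≠ l
      · obtain ⟨hip, hil⟩ := hi
        obtain ⟨s, hs, has⟩ := hdvd (ha ⟨_, single_sq_mem_glueII hip hil⟩ (hmax _ _ (by
          simp [Pi.single_eq_of_ne hil.symm])))
        have has' : ∀ j, j ≠ i → s j = 0 := by
          intro j hj
          refine mul_left_cancel₀ hX3 ?_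
          rw [← has]; simp [Pi.single_eq_of_ne hj]
        have hai : a.1 i * X ^ 2 = X ^ 3 * s i := by simpa using has i
        obtain ⟨q, hq⟩ : X ^ 2 ∣ s i := by
          refine X_sq_dvd_of_coeff ?_ ?_
          · rw [hs.1 i, has' l hil.symm, map_zero]
          · have h3 := hs.2.2
            rw [has' l hil.symm, map_zero, has' p hip.symm, map_zero, zero_add,
              Finset.sum_eq_single_of_mem i (by simp [hip, hil])
              (fun j _ hj => by rw [has' j hj, map_zero])] at h3
            exact h3.symm
        refine ⟨q, mul_right_cancel₀ (b := (X ^ 2 : k⟦X⟧)) (by simp) ?_⟩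
        rw [hai, hq]; ring
      -- On `p` and `l` separately `X ^ 2` is not in the glueing, so `X ^ 3` is the test element. It
      -- gives `a.1 i = s i`, and an element of the glueing supported on one of these branches has
      -- order at least three.
      · obtain ⟨s, hs, has⟩ := hdvd (ha ⟨_, single_cube_mem_glueII (p := p) (l := l) (i := i)⟩
          (hmax _ _ (by
            by_cases h : l = i
            · subst h; simp
            · simp [Pi.single_eq_of_ne h])))
        have has' : ∀ j, j ≠ i → s j = 0 := by
          intro j hj
          refine mul_left_cancel₀ hX3 ?_
          rw [← has]; simp [Pi.single_eq_of_ne hj]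
        have hai : a.1 i = s i := by
          refine mul_left_cancel₀ hX3 ?_
          have := has i
          rw [Pi.single_eq_same] at this
          rw [← this, mul_comm]
        rw [hai]
        have hsum : ∀ j ∈ (Finset.univ.erase l).erase p, coeff 1 (s j) = 0 := by
          intro j hj
          rw [has' j, map_zero]
          rintro rfl
          exact hi ⟨Finset.ne_of_mem_erase hj, Finset.ne_of_mem_erase (Finset.mem_of_mem_erase hj)⟩
        obtain ⟨hs0, hs1, hs2⟩ := hs
        rw [Finset.sum_eq_zero hsum, add_zero] at hs2
        by_cases hip : i = p
        · subst hip
          rw [has' l hpl.symm, map_zero] at hs1 hs2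
          exact X_cube_dvd_of_coeff (by rw [hs0, has' l hpl.symm, map_zero]) hs1.symm hs2.symm
        · have hil : i = l := by by_contra h; exact hi ⟨hip, h⟩
          subst hil
          rw [has' p hpl, map_zero] at hs1 hs2
          exact X_cube_dvd_of_coeff (by rw [← hs0 p, has' p hpl, map_zero]) hs1 hs2
    choose q hq using hq
    have hs' : ∀ {s h : Fin m → k⟦X⟧}, (∀ j, a.1 j * h j = X ^ 3 * s j) → ∀ j, s j = q j * h j := by
      intro s h has j
      refine mul_left_cancel₀ hX3 ?_
      rw [← has, hq]; ring
    obtain ⟨hqp, hql⟩ : coeff 0 (q l) = coeff 0 (q p) ∧ coeff 1 (q l) = coeff 1 (q p) := by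
      obtain ⟨s, hs, has⟩ := hdvd (ha ⟨_, tangentCoord_mem_glueII_self hpl⟩
        (hmax _ _ (coeff_zero_tangentCoord hpl (by norm_num) l)))
      have hs' := hs' has
      obtain ⟨-, h1, h2⟩ := hs
      rw [Finset.sum_eq_zero fun j hj => by
        rw [hs', tangentCoord_of_ne (Finset.ne_of_mem_erase hj)
          (Finset.ne_of_mem_erase (Finset.mem_of_mem_erase hj)), mul_zero, map_zero],
        add_zero] at h2
      rw [hs', hs', tangentCoord_last hpl, tangentCoord_self hpl, pow_one] at h1 h2
      rw [coeff_two_mul_eq, coeff_two_mul_eq] at h2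
      rw [coeff_one_mul_eq, coeff_one_mul_eq] at h1
      simp only [coeff_X] at h1 h2
      norm_num at h1 h2
      exact ⟨by simpa using h1, h2⟩
    have hq0 : ∀ i, coeff 0 (q i) = coeff 0 (q l) := by
      intro i
      by_cases hi : i = l
      · rw [hi]
      by_cases hip : i = p
      · rw [hip, hqp]
      obtain ⟨s, hs, has⟩ := hdvd (ha ⟨_, tangentCoord_mem_glueII hip hi hpl⟩
        (hmax _ _ (coeff_zero_tangentCoord hi (by norm_num) l)))
      have hs' := hs' has
      have h3 := hs.2.2
      rw [hs' p, tangentCoord_of_ne (Ne.symm hip) hpl, mul_zero, map_zero, zero_add,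
        Finset.sum_eq_single_of_mem i (by simp [hi, hip])] at h3
      · rw [hs', hs', tangentCoord_last hi, tangentCoord_self hi, coeff_mul_X_pow', if_pos le_rfl,
          coeff_one_mul_eq] at h3
        simpa using h3.symm
      · intro j hj hji
        rw [hs', tangentCoord_of_ne hji (Finset.ne_of_mem_erase (Finset.mem_of_mem_erase hj)),
          mul_zero, map_zero]
    set c := coeff 2 (q l) - (coeff 2 (q p) +
      ∑ i ∈ (Finset.univ.erase l).erase p, coeff 1 (q i)) with hc
    have hqS : q - (Pi.single l (C c * X ^ 2) : Fin m → k⟦X⟧) ∈ glueII k p l := by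
      have h1 : ∀ i, i ≠ l → (q - (Pi.single l (C c * X ^ 2) : Fin m → k⟦X⟧) : Fin m → k⟦X⟧) i = q i := fun i hi => by
        simp [Pi.single_eq_of_ne hi]
      have h2 : (q - (Pi.single l (C c * X ^ 2) : Fin m → k⟦X⟧) : Fin m → k⟦X⟧) l = q l - C c * X ^ 2 := by simp
      have h3 : coeff 0 ((q - (Pi.single l (C c * X ^ 2) : Fin m → k⟦X⟧) : Fin m → k⟦X⟧) l) = coeff 0 (q l) := by
        rw [h2]; simp
      refine ⟨fun i => ?_, ?_, ?_⟩
      · rw [h3]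
        by_cases hi : i = l
        · subst hi; exact h3
        · rw [h1 i hi, hq0]
      · rw [h2, h1 p hpl, map_sub, hql, coeff_C_mul, coeff_X_pow]; simp
      · rw [Finset.sum_congr rfl fun i hi => by
          rw [h1 i (Finset.ne_of_mem_erase (Finset.mem_of_mem_erase hi))], h2, h1 p hpl,
          map_sub, coeff_C_mul, coeff_X_pow, hc]
        simp
    refine ⟨algebraMap k _ c, ⟨_, hqS⟩, Subtype.ext (funext fun j => ?_)⟩
    change a.1 j - C c * (Pi.single l (X ^ 5) : Fin m → k⟦X⟧) j =
      X ^ 3 * (q j - (Pi.single l (C c * X ^ 2) : Fin m → k⟦X⟧) j)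
    rw [hq]
    by_cases hj : j = l
    · subst hj; rw [Pi.single_eq_same, Pi.single_eq_same]; ring
    · simp [Pi.single_eq_of_ne hj]

theorem isGorensteinGenusTwo_glueI (l : Fin m) (hm : 2 ≤ m) :
    IsGorensteinGenusTwo k (glueI k l) m :=
  have hS := isBranchGlueing_glueI (k := k) l
  have := hS.isLocalRing
  { toIsCompleteCurveGerm := hS.isCompleteCurveGerm
    numBranches_eq := hS.numBranches_eq
    genus_eq_two := by
      rw [singularityGenus, hS.numBranches_eq, hS.deltaInvariant_eq, finrank_quotient_glueI]
      push_cast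
      ring
    gorenstein := isGorensteinDimOne_glueI l hm }

theorem isGorensteinGenusTwo_glueII {p l : Fin m} (hpl : p ≠ l) :
    IsGorensteinGenusTwo k (glueII k p l) m :=
  have hS := isBranchGlueing_glueII (k := k) p l
  have := hS.isLocalRing
  { toIsCompleteCurveGerm := hS.isCompleteCurveGerm
    numBranches_eq := hS.numBranches_eq
    genus_eq_two := by
      rw [singularityGenus, hS.numBranches_eq, hS.deltaInvariant_eq, finrank_quotient_glueII hpl]
      push_cast
      ring
    gorenstein := isGorensteinDimOne_glueII hpl }

/-- The branches of the type II glueing are smooth. -/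
lemma exists_mem_glueII_apply_eq {p l : Fin m} (hpl : p ≠ l) (j : Fin m) (g : k⟦X⟧) :
    ∃ f ∈ glueII k p l, f j = g := by
  by_cases hj : j = p ∨ j = l
  · refine ⟨fun i => if i = p ∨ i = l then g else C (coeff 0 g), ⟨fun i => ?_, ?_, ?_⟩, by simp [hj]⟩
    · by_cases hi : i = p ∨ i = l <;> simp [hi]
    · simp
    · simp only [or_true, true_or, if_true]
      rw [Finset.sum_eq_zero, add_zero]
      intro i hi
      rw [if_neg]
      · simp
      · simpa using hi
  · push Not at hj
    refine ⟨fun i => if i = j then g else if i = l then C (coeff 0 g) + C (coeff 1 g) * X ^ 2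
      else C (coeff 0 g), ⟨fun i => ?_, ?_, ?_⟩, by simp⟩
    · by_cases hi : i = j <;> by_cases hi' : i = l <;> simp [hi, hi', hj.2.symm]
    · simp [hj.1.symm, hj.2.symm, hpl, coeff_X_pow]
    · rw [Finset.sum_eq_single_of_mem j (by simp [hj.1, hj.2])]
      · simp [hj.1.symm, hj.2.symm, hpl]
      · intro i hi hij
        have : i ≠ l := Finset.ne_of_mem_erase (Finset.mem_of_mem_erase hi)
        simp [hij, this]

/-- An isomorphism matches branch primes, and every branch of type II projects onto `k⟦X⟧`. Hence on
the cuspidal branch of type I the image of the maximal ideal would be generated by one element `x`.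
That image contains `X ^ 2` and `X ^ 3`, while `x` has order at least two; this would force `X` to
be a unit times the component of an element of the glueing, whose linear coefficient vanishes on
`l`. -/
theorem isEmpty_glueI_algEquiv_glueII {l : Fin m} (hm : 2 ≤ m) {p l' : Fin m} (hpl : p ≠ l') :
    IsEmpty (glueI k l ≃ₐ[k] glueII k p l') := by
  refine ⟨fun e => ?_⟩
  have hI := isBranchGlueing_glueI (k := k) l
  have hII := isBranchGlueing_glueII (k := k) p l'
  have := hI.isLocalRing
  have := hII.isLocalRing
  obtain ⟨i₀, hi₀⟩ : ∃ i₀ : Fin m, i₀ ≠ l := by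
    have : Nontrivial (Fin m) := Fin.nontrivial_iff_two_le.mpr hm
    exact exists_ne l
  have hmax : ∀ f, e f ∈ IsLocalRing.maximalIdeal (glueII k p l') ↔
      f ∈ IsLocalRing.maximalIdeal (glueI k l) := by
    intro f
    rw [IsLocalRing.mem_maximalIdeal, IsLocalRing.mem_maximalIdeal, mem_nonunits_iff,
      mem_nonunits_iff, MulEquiv.isUnit_map]
  let Q : Ideal (glueII k p l') :=
    (IsBranchGlueing.branchPrime (glueI k l) l).comap (e.symm : glueII k p l' →+* glueI k l)
  have hQmem : ∀ f, e f ∈ Q ↔ f.1 l = 0 := by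
    intro f
    rw [Ideal.mem_comap, IsBranchGlueing.mem_branchPrime]
    change (e.symm (e f)).1 l = 0 ↔ _
    rw [e.symm_apply_apply]
  have hQp : Q.IsPrime := Ideal.IsPrime.comap _
  obtain ⟨j, hj⟩ : ∃ j, Q = IsBranchGlueing.branchPrime (glueII k p l') j := by
    refine (hII.eq_branchPrime_or Q).resolve_right fun hQ => ?_
    have h1 : (⟨_, hI.X_pow_mem⟩ : glueI k l) ∈ IsLocalRing.maximalIdeal (glueI k l) := by
      rw [hI.mem_maximalIdeal_iff _ l]; simp
    rw [← hmax, ← hQ, hQmem] at h1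
    simp at h1
  obtain ⟨f, hf, hfj⟩ := exists_mem_glueII_apply_eq (k := k) hpl j X
  let x : glueI k l := e.symm ⟨f, hf⟩
  have hx : x ∈ IsLocalRing.maximalIdeal (glueI k l) := by
    rw [← hmax, e.apply_symm_apply, hII.mem_maximalIdeal_iff _ j]
    simp [hfj]
  have key : ∀ a ∈ IsLocalRing.maximalIdeal (glueI k l), ∃ b ∈ glueI k l,
      a.1 l = x.1 l * b l := by
    intro a ha
    rw [← hmax, hII.mem_maximalIdeal_iff _ j] at ha
    obtain ⟨q, hq⟩ : X ∣ (e a).1 j := by rw [X_dvd_iff]; simpa using ha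
    obtain ⟨g, hg, hgj⟩ := exists_mem_glueII_apply_eq (k := k) hpl j q
    refine ⟨(e.symm ⟨g, hg⟩).1, (e.symm ⟨g, hg⟩).2, ?_⟩
    have h1 : e (a - x * e.symm ⟨g, hg⟩) ∈ Q := by
      rw [hj, IsBranchGlueing.mem_branchPrime, map_sub, map_mul, e.apply_symm_apply,
        e.apply_symm_apply]
      change (e a).1 j - f j * g j = 0
      rw [hq, hfj, hgj, sub_self]
    rw [hQmem] at h1
    exact sub_eq_zero.mp h1
  obtain ⟨u, hu⟩ : X ^ 2 ∣ x.1 l :=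
    X_sq_dvd_of_coeff ((hI.mem_maximalIdeal_iff x l).mp hx) x.2.2.1
  obtain ⟨b, -, hb⟩ := key ⟨_, single_sq_mem_glueI (l := l) (i := l)⟩ (by
    rw [hI.mem_maximalIdeal_iff _ l]; simp)
  obtain ⟨b', hb'S, hb'⟩ := key ⟨_, tangentCoord_mem_glueI hi₀⟩ (by
    rw [hI.mem_maximalIdeal_iff _ l]; exact coeff_zero_tangentCoord hi₀ (by norm_num) l)
  have hX2 : (X ^ 2 : k⟦X⟧) ≠ 0 := by simp
  have h1 : u * b l = 1 := by
    refine mul_left_cancel₀ hX2 ?_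
    have : X ^ 2 = x.1 l * b l := by simpa using hb
    rw [← mul_assoc, ← hu, ← this, mul_one]
  have h2 : u * b' l = X := by
    refine mul_left_cancel₀ hX2 ?_
    have : X ^ 3 = x.1 l * b' l := by
      rw [← tangentCoord_last hi₀]; exact hb'
    rw [← mul_assoc, ← hu, ← this]; ring
  have h3 := congrArg (coeff 0) h1
  have h4 := congrArg (coeff 0) h2
  have h5 := congrArg (coeff 1) h2
  rw [coeff_zero_mul_eq] at h3 h4
  rw [coeff_one_mul_eq, hb'S.2.1] at h5
  have hu0 : coeff 0 u ≠ 0 := by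
    intro h
    rw [h, zero_mul] at h3
    simp at h3
  have hb0 : coeff 0 (b' l) = 0 := by
    refine (mul_eq_zero.mp (h4.trans ?_)).resolve_left hu0
    simp
  rw [hb0, mul_zero, mul_zero, add_zero, coeff_one_X] at h5
  exact zero_ne_one h5

end

end

/-! ### Finite algebras over a complete local ring. -/

section FiniteOverComplete

/-- A finite module over a complete ring is complete. -/
theorem isPrecomplete_of_finite {R M : Type*} [CommRing R] (I : Ideal R) [IsPrecomplete I R]
    [AddCommGroup M] [Module R M] [Module.Finite R M] : IsPrecomplete I M := by
  rw [← AdicCompletion.of_surjective_iff]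
  intro x
  obtain ⟨t, rfl⟩ := AdicCompletion.ofTensorProduct_surjective_of_finite I M x
  induction t using TensorProduct.induction_on with
  | zero => exact ⟨0, by simp⟩
  | tmul r a =>
    obtain ⟨r, rfl⟩ := AdicCompletion.of_surjective I R r
    refine ⟨r • a, ?_⟩
    rw [AdicCompletion.ofTensorProduct_tmul]
    ext n
    simp
    rfl
  | add a b ha hb =>
    obtain ⟨a', ha⟩ := ha
    obtain ⟨b', hb⟩ := hb
    exact ⟨a' + b', by rw [map_add, map_add, ha, hb]⟩

/-- In a domain complete for an ideal `I` with artinian quotient, there is a single maximal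
ideal. -/
theorem isLocalRing_of_isAdicComplete_of_isArtinianRing {A : Type*} [CommRing A] [IsDomain A]
    (I : Ideal A) [IsAdicComplete I A] [IsArtinianRing (A ⧸ I)] : IsLocalRing A := by
  have hjac : I ≤ Ideal.jacobson ⊥ := IsAdicComplete.le_jacobson_bot I
  have hunit : ∀ a : A, a - 1 ∈ I → IsUnit a := by
    intro a ha
    have := Ideal.mem_jacobson_bot.mp (hjac ha) 1
    simpa using this
  refine IsLocalRing.of_isUnit_or_isUnit_one_sub_self fun a => ?_
  -- Modulo `I` the ideals generated by the powers of `a` stabilise, which makes `a ^ n * y ^ n`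
  -- idempotent there. Once lifted to the domain `A` the idempotent is zero or one, so `a` is
  -- nilpotent or a unit modulo `I`.
  obtain ⟨n, y', hy⟩ := IsArtinian.exists_pow_succ_smul_dvd (Ideal.Quotient.mk I a)
    (1 : A ⧸ I)
  obtain ⟨y, rfl⟩ := Ideal.Quotient.mk_surjective y'
  have h1 : a ^ (n + 1) * y - a ^ n ∈ I := by
    rw [← Ideal.Quotient.mk_eq_mk_iff_sub_mem]
    simpa using hy
  have h2 : ∀ j, a ^ (n + j) * y ^ j - a ^ n ∈ I := by
    intro j
    induction j with
    | zero => simp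
    | succ j ih =>
      have : a ^ (n + (j + 1)) * y ^ (j + 1) - a ^ n =
        a ^ j * y ^ j * (a ^ (n + 1) * y - a ^ n) + (a ^ (n + j) * y ^ j - a ^ n) := by ring
      rw [this]
      exact I.add_mem (I.mul_mem_left _ h1) ih
  set e₀ := a ^ n * y ^ n with he₀
  have hidem : e₀ ^ 2 - e₀ ∈ I := by
    have : e₀ ^ 2 - e₀ = y ^ n * (a ^ (n + n) * y ^ n - a ^ n) := by rw [he₀]; ring
    rw [this]
    exact I.mul_mem_left _ (h2 n)
  obtain ⟨e, he, hee₀⟩ := HenselianRing.is_henselian (I := I)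
    (Polynomial.X ^ 2 - Polynomial.X : Polynomial A)
    (Polynomial.monic_X_pow_sub ((Polynomial.degree_X_le (R := A)).trans_lt (by norm_num)))
    e₀ (by simpa using hidem) (by
      -- The derivative `2 * e₀ - 1` is its own inverse modulo `I`, since its square is `1 + 4 * (e₀
      -- ^ 2 - e₀)`.
      refine IsUnit.of_mul_eq_one (Ideal.Quotient.mk I (2 * e₀ - 1)) ?_
      rw [← map_mul, ← map_one (Ideal.Quotient.mk I), Ideal.Quotient.mk_eq_mk_iff_sub_mem]
      have : Polynomial.eval e₀ (Polynomial.derivative (Polynomial.X ^ 2 - Polynomial.X))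
          * (2 * e₀ - 1) - 1 = 4 * (e₀ ^ 2 - e₀) := by
        simp
        ring
      rw [this]
      exact I.mul_mem_left _ hidem)
  have he' : e * (e - 1) = 0 := by
    have : e ^ 2 - e = 0 := by simpa [Polynomial.IsRoot] using he
    linear_combination this
  rcases mul_eq_zero.mp he' with h0 | h0
  · right
    have h3 : a ^ n ∈ I := by
      have h4 : e₀ ∈ I := by
        rw [h0, zero_sub] at hee₀
        exact (neg_mem_iff (H := I)).mp hee₀
      have : a ^ n = a ^ n * e₀ - (a ^ (n + n) * y ^ n - a ^ n) := by rw [he₀]; ring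
      rw [this]
      exact I.sub_mem (I.mul_mem_left _ h4) (h2 n)
    have h5 : IsUnit (1 - a ^ n) := hunit _ (by
      have : 1 - a ^ n - 1 = -(a ^ n) := by ring
      rw [this]
      exact I.neg_mem h3)
    exact isUnit_of_dvd_unit (one_sub_dvd_one_sub_pow a n) h5
  · left
    rcases Nat.eq_zero_or_pos n with hn | hn
    · have : IsUnit (a * y) := hunit _ (by simpa [hn] using h1)
      exact isUnit_of_mul_isUnit_left this
    · have h3 : IsUnit e₀ := hunit _ (by
        have : e₀ - 1 = -(e - e₀) + (e - 1) := by ring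
        rw [this, h0, add_zero]
        exact I.neg_mem hee₀)
      exact (isUnit_pow_iff hn.ne').mp (isUnit_of_mul_isUnit_left h3)

variable {k R A : Type*} [Field k] [CommRing R] [Algebra k R] [IsLocalRing R]
  [CommRing A] [Algebra R A] [Algebra k A] [IsScalarTower k R A]

/-- Quotients of a finite algebra by ideals containing the maximal ideal are finite over the
coefficient field. -/
theorem finite_quotient_of_map_maximalIdeal_le
    (hk : Function.Surjective (algebraMap k (IsLocalRing.ResidueField R))) [Module.Finite R A]
    (J : Ideal A) (hJ : (IsLocalRing.maximalIdeal R).map (algebraMap R A) ≤ J) :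
    Module.Finite k (A ⧸ J) := by
  have hdec : ∀ r : R, ∃ c : k, r - algebraMap k R c ∈ IsLocalRing.maximalIdeal R := by
    intro r
    obtain ⟨c, hc⟩ := hk (IsLocalRing.residue R r)
    refine ⟨c, ?_⟩
    rw [← IsLocalRing.residue_eq_zero_iff, map_sub, sub_eq_zero, ← hc]
    rfl
  obtain ⟨s, hs⟩ := (inferInstance : Module.Finite R (A ⧸ J)).fg_top
  refine ⟨⟨s, eq_top_iff.mpr fun x _ => ?_⟩⟩
  have hx : x ∈ Submodule.span R (s : Set (A ⧸ J)) := by rw [hs]; trivial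
  induction hx using Submodule.span_induction with
  | mem x h => exact Submodule.subset_span h
  | zero => exact zero_mem _
  | add x y _ _ hx hy => exact add_mem (hx trivial) (hy trivial)
  | smul r x _ hx =>
    obtain ⟨c, hc⟩ := hdec r
    have : r • x = c • x := by
      obtain ⟨a, rfl⟩ := Ideal.Quotient.mk_surjective x
      change Ideal.Quotient.mk J (r • a) = Ideal.Quotient.mk J (c • a)
      rw [Ideal.Quotient.mk_eq_mk_iff_sub_mem, ← algebraMap_smul R c a, ← sub_smul,
        Algebra.smul_def]
      exact J.mul_mem_right _ (hJ (Ideal.mem_map_of_mem _ hc))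
    rw [this]
    exact Submodule.smul_mem _ _ (hx trivial)

/-- A normal domain which is finite over a complete local ring of dimension one with coefficient
field `k` and does not factor over the residue field, is a power series ring. -/
theorem nonempty_algEquiv_powerSeries_of_finite [IsAlgClosed k] [IsNoetherianRing R]
    [IsAdicComplete (IsLocalRing.maximalIdeal R) R] [Ring.KrullDimLE 1 R]
    (hk : Function.Surjective (algebraMap k (IsLocalRing.ResidueField R)))
    [IsDomain A] [Module.Finite R A] [IsIntegrallyClosed A]
    (hx : ∃ x ∈ IsLocalRing.maximalIdeal R, algebraMap R A x ≠ 0) :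
    Nonempty (A ≃ₐ[k] k⟦X⟧) := by
  set I := (IsLocalRing.maximalIdeal R).map (algebraMap R A) with hI
  have hAR : IsAdicComplete (IsLocalRing.maximalIdeal R) A :=
    { toIsHausdorff := inferInstance
      toIsPrecomplete := isPrecomplete_of_finite _ }
  have hAI : IsAdicComplete I A := (IsAdicComplete.map_algebraMap_iff ..).mpr hAR
  have hfin := finite_quotient_of_map_maximalIdeal_le (A := A) hk
  have hart : IsArtinianRing (A ⧸ I) := by
    have := hfin I le_rfl
    exact IsArtinianRing.of_finite k _
  have hloc : IsLocalRing A := isLocalRing_of_isAdicComplete_of_isArtinianRing I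
  have hnoeth : IsNoetherianRing A := IsNoetherianRing.of_finite R A
  have hIle : I ≤ IsLocalRing.maximalIdeal A :=
    (IsAdicComplete.le_jacobson_bot I).trans (IsLocalRing.jacobson_eq_maximalIdeal ⊥ bot_ne_top).le
  obtain ⟨x, hxm, hx0⟩ := hx
  have hxI : algebraMap R A x ∈ I := Ideal.mem_map_of_mem _ hxm
  have hnf : ¬ IsField A := by
    intro hf
    have := IsLocalRing.isField_iff_maximalIdeal_eq.mp hf
    have h1 := hIle hxI
    rw [this, Ideal.mem_bot] at h1
    exact hx0 h1
  have hbot : IsLocalRing.maximalIdeal A ≠ ⊥ := fun h =>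
    hnf (IsLocalRing.isField_iff_maximalIdeal_eq.mpr h)
  -- By integrality a nonzero prime contracts to a prime strictly above the contraction of zero,
  -- which in dimension at most one is maximal.
  have hprime : ∀ P : Ideal A, P ≠ ⊥ → P.IsPrime → P = IsLocalRing.maximalIdeal A := by
    intro P hP hPp
    obtain ⟨a, haP, ha0⟩ := Submodule.exists_mem_ne_zero_of_ne_bot hP
    have hlt := Ideal.comap_lt_comap_of_integral_mem_sdiff (R := R) (bot_le : (⊥ : Ideal A) ≤ P)
      ⟨haP, by simpa using ha0⟩ (Algebra.IsIntegral.isIntegral a)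
    have hb : ((⊥ : Ideal A).comap (algebraMap R A)).IsPrime :=
      Ideal.IsPrime.comap (hK := Ideal.isPrime_bot) _
    have hmax : (P.comap (algebraMap R A)).IsMaximal := by
      refine (Ring.krullDimLE_one_iff.mp ‹_› _ (Ideal.IsPrime.comap _)).resolve_left ?_
      intro hmin
      rw [minimalPrimes_eq_minimals] at hmin
      exact hlt.not_ge (hmin.2 hb hlt.le)
    exact IsLocalRing.eq_maximalIdeal (Ideal.isMaximal_of_isIntegral_of_isMaximal_comap P hmax)
  have hdvr : IsDiscreteValuationRing A := by
    have htfae : IsDiscreteValuationRing A ↔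
        (IsIntegrallyClosed A ∧ ∃! P : Ideal A, P ≠ ⊥ ∧ P.IsPrime) :=
      (IsDiscreteValuationRing.TFAE A hnf).out 0 3
    refine htfae.mpr ⟨inferInstance, ?_⟩
    exact ⟨_, ⟨hbot, inferInstance⟩, fun P hP => hprime P hP.1 hP.2⟩
  obtain ⟨π, hπ⟩ := IsDiscreteValuationRing.exists_irreducible A
  have hmπ : IsLocalRing.maximalIdeal A = Ideal.span {π} := hπ.maximalIdeal_eq
  obtain ⟨e, he⟩ := IsDiscreteValuationRing.ideal_eq_span_pow_irreducible
    (s := I) (fun h => hx0 (by rw [h] at hxI; simpa using hxI)) hπ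
  have he0 : e ≠ 0 := by
    rintro rfl
    rw [pow_zero, Ideal.span_singleton_one] at he
    exact (IsLocalRing.maximalIdeal.isMaximal A).ne_top (eq_top_iff.mpr (he ▸ hIle))
  obtain ⟨E, -⟩ := PowerSeries.exists_algEquiv_apply_eq_X (k := k) π
    (mem_nonZeroDivisors_of_ne_zero hπ.ne_zero) hπ.not_isUnit
    (by
      intro a
      have := hfin (IsLocalRing.maximalIdeal A) hIle
      -- The residue field of `A` is finite over the algebraically closed field `k`, hence equal to
      -- it; this supplies the constant term.
      have hint : Algebra.IsIntegral k (A ⧸ IsLocalRing.maximalIdeal A) := inferInstance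
      obtain ⟨c, hc⟩ := (IsAlgClosed.algebraMap_bijective_of_isIntegral (k := k)
        (K := A ⧸ IsLocalRing.maximalIdeal A)).2 (Ideal.Quotient.mk _ a)
      have h1 : a - algebraMap k A c ∈ IsLocalRing.maximalIdeal A := by
        rw [← Ideal.Quotient.mk_eq_mk_iff_sub_mem, ← hc]
        rfl
      rw [hmπ, Ideal.mem_span_singleton] at h1
      obtain ⟨b, hb⟩ := h1
      exact ⟨c, b, by rw [← hb]; ring⟩)
    (by
      intro a ha
      refine IsHausdorff.haus (inferInstance : IsHausdorff (IsLocalRing.maximalIdeal A) A) a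
        fun n => ?_
      rw [SModEq.zero, smul_eq_mul, Ideal.mul_top, hmπ, Ideal.span_singleton_pow,
        Ideal.mem_span_singleton]
      exact ha n)
    (by
      intro c
      set s : ℕ → A := fun n => ∑ i ∈ Finset.range n, algebraMap k A (c i) * π ^ i with hs
      have hsdvd : ∀ a b, a ≤ b → π ^ a ∣ s a - s b := by
        intro a b hab
        rw [dvd_sub_comm, hs]
        simp only
        rw [← Finset.sum_range_add_sum_Ico _ hab, add_sub_cancel_left]
        exact Finset.dvd_sum fun i hi =>
          Dvd.dvd.mul_left (pow_dvd_pow _ (Finset.mem_Ico.mp hi).1) _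
      have hmod : ∀ (n : ℕ) (a b : A), a ≡ b [SMOD (I ^ n • ⊤ : Submodule A A)] ↔
          π ^ (e * n) ∣ a - b := by
        intro n a b
        rw [SModEq.sub_mem, smul_eq_mul, Ideal.mul_top, he, Ideal.span_singleton_pow,
          Ideal.mem_span_singleton, ← pow_mul]
      -- Since `I` is generated by `π ^ e`, completeness for `I` gives the limit of the partial sums
      -- along multiples of `e`, and the other partial sums follow.
      obtain ⟨L, hL⟩ := IsPrecomplete.prec (inferInstance : IsPrecomplete I A)
        (f := fun n => s (e * n)) (fun {a b} hab => by
          rw [hmod]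
          exact hsdvd _ _ (Nat.mul_le_mul_left e hab))
      refine ⟨L, fun n => ?_⟩
      have h1 : n ≤ e * n := Nat.le_mul_of_pos_left n (Nat.pos_of_ne_zero he0)
      have h2 := hL n
      rw [hmod] at h2
      have h3 := (pow_dvd_pow π h1).trans h2
      have h4 := dvd_add (hsdvd n _ h1) h3
      rw [sub_add_sub_cancel] at h4
      exact (dvd_sub_comm).mp h4)
  exact ⟨E⟩

end FiniteOverComplete

/-! ### A germ inside the product of its branches. -/

section StructureTheorem

/-- An element of a finite product is integral if its components are. -/
theorem isIntegral_of_forall_isIntegral_apply {R ι : Type*} [CommRing R] [Fintype ι]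
    {A : ι → Type*} [∀ i, CommRing (A i)] [∀ i, Algebra R (A i)] (x : ∀ i, A i)
    (h : ∀ i, IsIntegral R (x i)) : IsIntegral R x := by
  choose p hp hpx using h
  refine ⟨∏ i, p i, Polynomial.monic_prod_of_monic _ _ fun i _ => hp i, ?_⟩
  rw [← Polynomial.aeval_def]
  funext i
  have h1 : (Polynomial.aeval x (∏ i, p i)) i = Polynomial.aeval (x i) (∏ i, p i) :=
    (Polynomial.aeval_algHom_apply (Pi.evalAlgHom R A i) x _).symm
  rw [h1, map_prod]
  exact Finset.prod_eq_zero (Finset.mem_univ i) (by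
    rw [Polynomial.aeval_def]; exact hpx i)

variable {k R F : Type*} [Field k] [CommRing R] [Algebra k R] [IsLocalRing R]

/-- The normalisation of a branch is a power series ring. -/
theorem exists_algHom_powerSeries_of_field [IsAlgClosed k] [IsNoetherianRing R]
    [IsAdicComplete (IsLocalRing.maximalIdeal R) R] [Ring.KrullDimLE 1 R]
    (hk : Function.Surjective (algebraMap k (IsLocalRing.ResidueField R)))
    [Field F] [Algebra R F] [Algebra k F] [IsScalarTower k R F]
    [Module.Finite R (integralClosure R F)]
    (hfrac : ∀ y : F, ∃ r s : R, algebraMap R F s ≠ 0 ∧ algebraMap R F s * y = algebraMap R F r)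
    (hx : ∃ x ∈ IsLocalRing.maximalIdeal R, algebraMap R F x ≠ 0) :
    ∃ f : k⟦X⟧ →ₐ[k] F, Function.Injective f ∧ ∀ y, (∃ g, f g = y) ↔ IsIntegral R y := by
  have : IsFractionRing (integralClosure R F) F := by
    refine IsFractionRing.of_field _ _ fun y => ?_
    obtain ⟨r, s, hs, h⟩ := hfrac y
    refine ⟨algebraMap R _ r, algebraMap R _ s, ?_⟩
    rw [eq_div_iff (by exact hs), mul_comm]
    exact h
  have : IsIntegrallyClosed (integralClosure R F) :=
    (isIntegrallyClosed_iff_isIntegrallyClosedIn F).mpr inferInstance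
  obtain ⟨E⟩ := nonempty_algEquiv_powerSeries_of_finite (A := integralClosure R F) hk (by
    obtain ⟨x, hx, h⟩ := hx
    exact ⟨x, hx, fun h' => h (congrArg Subtype.val h')⟩)
  let v : integralClosure R F →ₐ[k] F := (integralClosure R F).val.restrictScalars k
  refine ⟨v.comp E.symm.toAlgHom, ?_, fun y => ⟨?_, fun hy => ?_⟩⟩
  · exact Subtype.val_injective.comp E.symm.injective
  · rintro ⟨g, rfl⟩
    exact (E.symm g).2
  · exact ⟨E ⟨y, hy⟩, by simp [v]⟩

/-- Structure theorem for reduced complete curve germs whose normalisation is finite: they sit in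
the product of the power series rings of their branches. -/
theorem IsCompleteCurveGerm.exists_algHom_pi [IsAlgClosed k]
    (h : IsCompleteCurveGerm k R) (hnzd : ∃ x ∈ IsLocalRing.maximalIdeal R, x ∈ nonZeroDivisors R)
    (hδ : deltaInvariant k R ≠ 0) :
    ∃ ι : R →ₐ[k] (Fin (numBranches R) → k⟦X⟧), Function.Injective ι ∧
      Module.finrank k ((Fin (numBranches R) → k⟦X⟧) ⧸ LinearMap.range ι.toLinearMap) =
        deltaInvariant k R := by
  have := h.isNoetherianRing
  have := h.isReduced
  have := h.isAdicComplete
  have hdim : Ring.KrullDimLE 1 R := by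
    rw [Ring.krullDimLE_iff]
    exact h.ringKrullDim_eq_one.le
  set K := FractionRing R with hK
  obtain ⟨x, hxm, hx⟩ := hnzd
  have hKred : IsReduced K := isReduced_localizationPreserves (nonZeroDivisors R) K inferInstance
  have hKnoeth : IsNoetherianRing K :=
    IsLocalization.isNoetherianRing (nonZeroDivisors R) K inferInstance
  -- A prime of the fraction ring contracts to one without nonzerodivisors. It misses `x`, so it is
  -- not maximal and, in dimension one, must be minimal.
  have hmin : ∀ P : Ideal K, P.IsPrime → P.comap (algebraMap R K) ∈ minimalPrimes R := by
    intro P hP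
    have h1 := (IsLocalization.isPrime_iff_isPrime_disjoint (nonZeroDivisors R) K P).mp hP
    refine (Ring.krullDimLE_one_iff.mp hdim _ h1.1).resolve_right fun hmax => ?_
    have h2 := IsLocalRing.eq_maximalIdeal hmax
    exact Set.disjoint_left.mp h1.2 hx (by rw [h2]; exact hxm)
  have hinj : ∀ P Q : Ideal K, P.comap (algebraMap R K) ≤ Q.comap (algebraMap R K) → P ≤ Q := by
    intro P Q hPQ
    rw [← IsLocalization.map_under (nonZeroDivisors R) K P,
      ← IsLocalization.map_under (nonZeroDivisors R) K Q]
    exact Ideal.map_mono hPQ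
  have hKdim : Ring.KrullDimLE 0 K := by
    rw [Ring.krullDimLE_zero_iff]
    intro P hP
    obtain ⟨Q, hQ, hPQ⟩ := Ideal.exists_le_maximal P hP.ne_top
    have hQ' := hmin Q hQ.isPrime
    rw [minimalPrimes_eq_minimals] at hQ'
    have h3 := hQ'.2 (Ideal.IsPrime.comap (hK := hP) _) (Ideal.comap_mono hPQ)
    have : Q = P := le_antisymm (hinj _ _ h3) hPQ
    rwa [← this]
  have hKart : IsArtinianRing K := isArtinianRing_iff_krullDimLE_zero.mpr hKdim
  have hcard : Nat.card (MaximalSpectrum K) = numBranches R := by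
    rw [numBranches, ← Nat.card_coe_set_eq]
    refine Nat.card_congr (Equiv.ofBijective (fun P : MaximalSpectrum K =>
      (⟨P.asIdeal.comap (algebraMap R K), hmin _ P.isMaximal.isPrime⟩ : minimalPrimes R)) ⟨?_, ?_⟩)
    · intro P Q hPQ
      have := congrArg Subtype.val hPQ
      exact MaximalSpectrum.ext (le_antisymm (hinj _ _ this.le) (hinj _ _ this.ge))
    · rintro ⟨P, hP⟩
      have h4 := IsLocalization.minimalPrimes_comap (nonZeroDivisors R) K ⊥
      rw [Ideal.comap_bot_of_injective _ (IsFractionRing.injective R K)] at h4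
      have hP' : P ∈ (⊥ : Ideal R).minimalPrimes := hP
      rw [h4] at hP'
      obtain ⟨Q, hQ, rfl⟩ := hP'
      have hQp : Q.IsPrime := hQ.1.1
      exact ⟨⟨Q, Ring.krullDimLE_zero_iff.mp hKdim Q hQp⟩, rfl⟩
  -- `finrank` is zero on an infinite dimensional space, so a nonzero `δ` carries the finiteness of
  -- the normalisation.
  have hfinN : Module.Finite R (Normalisation R) := by
    have h5 : Module.Finite k
        (Normalisation R ⧸ LinearMap.range (Algebra.linearMap R (Normalisation R))) :=
      FiniteDimensional.of_finrank_pos (Nat.pos_of_ne_zero hδ)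
    have h6 : Module.Finite R
        (Normalisation R ⧸ LinearMap.range (Algebra.linearMap R (Normalisation R))) :=
      Module.Finite.of_restrictScalars_finite k R _
    exact Module.Finite.of_submodule_quotient
      (LinearMap.range (Algebra.linearMap R (Normalisation R)))
  let e := IsArtinianRing.equivPi K
  have hbranch : ∀ P : MaximalSpectrum K, ∃ f : k⟦X⟧ →ₐ[k] (K ⧸ P.asIdeal),
      Function.Injective f ∧ ∀ y, (∃ g, f g = y) ↔ IsIntegral R y := by
    intro P
    let _ : Field (K ⧸ P.asIdeal) := Ideal.Quotient.field _
    have hmap : ∀ s ∈ nonZeroDivisors R, algebraMap R (K ⧸ P.asIdeal) s ≠ 0 := by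
      intro s hs
      have hu : IsUnit (algebraMap R K s) := IsLocalization.map_units K ⟨s, hs⟩
      exact (hu.map (Ideal.Quotient.mk P.asIdeal)).ne_zero
    have : Module.Finite R (integralClosure R (K ⧸ P.asIdeal)) := by
      let q : K →ₐ[R] K ⧸ P.asIdeal := Ideal.Quotient.mkₐ R P.asIdeal
      let g : Normalisation R →ₗ[R] integralClosure R (K ⧸ P.asIdeal) :=
        { toFun := fun y => ⟨q y, y.2.map q⟩
          map_add' := fun a b => Subtype.ext (map_add q _ _)
          map_smul' := fun c a => Subtype.ext (map_smul q _ _) }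
      refine Module.Finite.of_surjective g fun y => ?_
      classical
      -- Extension by zero to the other factors keeps the element integral, so the normalisation
      -- maps onto the integral closure in each factor and finiteness passes to it.
      let z : (Q : MaximalSpectrum K) → K ⧸ Q.asIdeal := Pi.single P y.1
      have hz : IsIntegral R z := by
        have := Fintype.ofFinite (MaximalSpectrum K)
        refine isIntegral_of_forall_isIntegral_apply _ fun Q => ?_
        by_cases hQ : Q = P
        · subst hQ
          have h9 : z Q = y.1 := Pi.single_eq_same _ _
          rw [h9]
          exact y.2
        · simpa [z, Pi.single_eq_of_ne hQ] using isIntegral_zero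
      refine ⟨⟨e.symm z, (isIntegral_algEquiv (e.symm.restrictScalars R)).mpr hz⟩, ?_⟩
      refine Subtype.ext ?_
      have h7 : e (e.symm z) P = y.1 := by
        rw [e.apply_symm_apply]
        exact Pi.single_eq_same _ _
      exact h7
    refine exists_algHom_powerSeries_of_field h.residue_bijective.2 (fun y => ?_)
      ⟨x, hxm, hmap x hx⟩
    obtain ⟨y, rfl⟩ := Ideal.Quotient.mk_surjective y
    obtain ⟨⟨r, s⟩, hrs⟩ := IsLocalization.surj (nonZeroDivisors R) y
    refine ⟨r, s, hmap _ s.2, ?_⟩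
    have := congrArg (Ideal.Quotient.mk P.asIdeal) hrs
    rw [map_mul, mul_comm] at this
    exact this
  choose f hf hfint using hbranch
  let σ : Fin (numBranches R) ≃ MaximalSpectrum K :=
    (finCongr hcard.symm).trans (Finite.equivFin (MaximalSpectrum K)).symm
  let j₀ : (Fin (numBranches R) → k⟦X⟧) →ₐ[k] (∀ P : MaximalSpectrum K, K ⧸ P.asIdeal) :=
    AlgHom.pi fun P => (f P).comp (Pi.evalAlgHom k (fun _ => k⟦X⟧) (σ.symm P))
  have hj₀ : Function.Injective j₀ := by
    intro a b hab
    funext i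
    have := congrFun hab (σ i)
    have := hf _ this
    simpa using this
  let j : (Fin (numBranches R) → k⟦X⟧) →ₐ[k] K :=
    (e.symm.restrictScalars k).toAlgHom.comp j₀
  have hj : Function.Injective j := e.symm.injective.comp hj₀
  have hrange : ∀ y, (∃ g, j g = y) ↔ IsIntegral R y := by
    intro y
    constructor
    · rintro ⟨g, rfl⟩
      have := Fintype.ofFinite (MaximalSpectrum K)
      refine (isIntegral_algEquiv (e.symm.restrictScalars R)).mpr ?_
      exact isIntegral_of_forall_isIntegral_apply _ fun P => (hfint P _).mp ⟨_, rfl⟩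
    · intro hy
      have h8 : ∀ P, IsIntegral R (e y P) := fun P =>
        hy.map (Ideal.Quotient.mkₐ R P.asIdeal)
      choose g hg using fun P => (hfint P _).mpr (h8 P)
      refine ⟨fun i => g (σ i), ?_⟩
      change e.symm (j₀ _) = y
      rw [AlgEquiv.symm_apply_eq]
      funext P
      simp [j₀, hg]
  have hιex : ∀ r : R, ∃ g, j g = algebraMap R K r := fun r =>
    (hrange _).mpr isIntegral_algebraMap
  let eJ : (Fin (numBranches R) → k⟦X⟧) ≃ₐ[k] j.range := AlgEquiv.ofInjective j hj
  let ι : R →ₐ[k] (Fin (numBranches R) → k⟦X⟧) :=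
    eJ.symm.toAlgHom.comp ((IsScalarTower.toAlgHom k R K).codRestrict j.range hιex)
  have hι : ∀ r, j (ι r) = algebraMap R K r := by
    intro r
    exact congrArg Subtype.val (eJ.apply_symm_apply _)
  refine ⟨ι, fun a b hab => ?_, (deltaInvariant_eq_finrank ι j hj hι hrange).symm⟩
  have := hι a
  rw [hab, hι b] at this
  exact (IsFractionRing.injective R K this).symm

end StructureTheorem

/-- A Gorenstein curve singularity of genus two is a subring of codimension `m + 1` of the product
of the `m` power series rings of its branches. -/
theorem IsGorensteinGenusTwo.exists_algHom_pi {k R : Type*} [Field k] [IsAlgClosed k] [CommRing R]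
    [Algebra k R] {m : ℕ} (h : IsGorensteinGenusTwo k R m) :
    ∃ ι : R →ₐ[k] (Fin m → k⟦X⟧), Function.Injective ι ∧
      Module.finrank k ((Fin m → k⟦X⟧) ⧸ LinearMap.range ι.toLinearMap) = m + 1 := by
  have := h.isLocalRing
  have hδ : deltaInvariant k R = m + 1 := by
    have := h.genus_eq_two
    rw [singularityGenus, h.numBranches_eq] at this
    omega
  obtain ⟨x, hx, hx', -⟩ := h.gorenstein
  have h1 := h.toIsCompleteCurveGerm.exists_algHom_pi ⟨x, hx, hx'⟩ (by omega)
  rwa [h.numBranches_eq, hδ] at h1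

/-! ### The Gorenstein property as a simple socle in the product of branches. -/

section

open PowerSeries

/-- In a Gorenstein ring of dimension one, elements of an overring which multiply the maximal
ideal into the ring are, modulo the ring, multiples of each other. -/
theorem IsGorensteinDimOne.mem_range_or_exists {R T : Type*} [CommRing R] [IsLocalRing R]
    [CommRing T] (hG : IsGorensteinDimOne R) (ι : R →+* T) (hι : Function.Injective ι)
    (hreg : ∀ x ∈ nonZeroDivisors R, ι x ∈ nonZeroDivisors T) {q₁ q₂ : T}
    (h₁ : ∀ f ∈ IsLocalRing.maximalIdeal R, q₁ * ι f ∈ ι.range)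
    (h₂ : ∀ f ∈ IsLocalRing.maximalIdeal R, q₂ * ι f ∈ ι.range) :
    q₁ ∈ ι.range ∨ ∃ r, q₂ - ι r * q₁ ∈ ι.range := by
  obtain ⟨x, hx, hx', hsimple⟩ := hG
  have hxT := hreg x hx'
  obtain ⟨r₁, hr₁⟩ := h₁ x hx
  obtain ⟨r₂, hr₂⟩ := h₂ x hx
  -- Multiplication by `x` carries elements multiplying the maximal ideal into `R` to the socle of
  -- `R / xR`, and those of `R` itself to zero.
  have hmem : ∀ (q : T) (r : R), ι r = q * ι x →
      (∀ f ∈ IsLocalRing.maximalIdeal R, q * ι f ∈ ι.range) →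
      Ideal.Quotient.mk (Ideal.span {x}) r ∈ Submodule.torsionBySet R (R ⧸ Ideal.span {x})
        (IsLocalRing.maximalIdeal R : Set R) := by
    intro q r hr hq
    rw [Submodule.mem_torsionBySet_iff]
    rintro ⟨f, hf⟩
    obtain ⟨s, hs⟩ := hq f hf
    change Ideal.Quotient.mk (Ideal.span {x}) (f * r) = 0
    rw [Ideal.Quotient.eq_zero_iff_mem, Ideal.mem_span_singleton]
    refine ⟨s, hι ?_⟩
    rw [map_mul, map_mul, hs, hr]
    ring
  by_cases h0 : Ideal.Quotient.mk (Ideal.span {x}) r₁ = 0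
  · left
    rw [Ideal.Quotient.eq_zero_iff_mem, Ideal.mem_span_singleton] at h0
    obtain ⟨s, hs⟩ := h0
    refine ⟨s, ?_⟩
    rw [hs, map_mul, mul_comm] at hr₁
    exact (mul_cancel_right_mem_nonZeroDivisors hxT).mp hr₁
  · right
    obtain ⟨r, hr⟩ := (isSimpleModule_iff_toSpanSingleton_surjective.mp hsimple).2
      ⟨_, hmem q₁ r₁ hr₁ h₁⟩ (fun h => h0 (congrArg Subtype.val h)) ⟨_, hmem q₂ r₂ hr₂ h₂⟩
    have h3 : Ideal.Quotient.mk (Ideal.span {x}) (r * r₁) =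
      Ideal.Quotient.mk (Ideal.span {x}) r₂ := congrArg Subtype.val hr
    rw [eq_comm, Ideal.Quotient.mk_eq_mk_iff_sub_mem, Ideal.mem_span_singleton] at h3
    obtain ⟨s, hs⟩ := h3
    refine ⟨r, s, ?_⟩
    refine (mul_cancel_right_mem_nonZeroDivisors hxT).mp ?_
    have := congrArg ι hs
    rw [map_sub, map_mul, map_mul, hr₁, hr₂] at this
    rw [mul_comm, ← this]
    ring

variable {k : Type*} [Field k] {m : ℕ}

/-- A linear map from the power series ring to a finite dimensional space is not injective. -/
lemma PowerSeries.exists_ne_zero_map_eq_zero {V : Type*} [AddCommGroup V] [Module k V]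
    [FiniteDimensional k V] (Λ : k⟦X⟧ →ₗ[k] V) : ∃ p, p ≠ 0 ∧ Λ p = 0 := by
  by_contra! h
  have hinj : Function.Injective Λ := (injective_iff_map_eq_zero Λ).mpr fun p hp => by
    by_contra hne
    exact h p hne hp
  have := FiniteDimensional.of_injective Λ hinj
  let n := Module.finrank k k⟦X⟧ + 1
  let c : k⟦X⟧ →ₗ[k] (Fin n → k) := LinearMap.pi fun i => coeff (i : ℕ)
  have hc : Function.Surjective c := fun v =>
    ⟨PowerSeries.mk fun i => if h : i < n then v ⟨i, h⟩ else 0, by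
      funext i; simp [c]⟩
  have h1 := LinearMap.finrank_le_finrank_of_surjective hc
  rw [Module.finrank_fin_fun] at h1
  omega

/-- A subalgebra of finite codimension contains a power of the radical. -/
theorem exists_radicalPow_subset_of_finite (S : Subalgebra k (Fin m → k⟦X⟧))
    [FiniteDimensional k ((Fin m → k⟦X⟧) ⧸ Subalgebra.toSubmodule S)] :
    ∃ N, 0 < N ∧ radicalPow k m N ⊆ S := by
  let Q := (Fin m → k⟦X⟧) ⧸ Subalgebra.toSubmodule S
  let b := Module.finBasis k Q
  choose t ht using fun j => Submodule.mkQ_surjective (Subalgebra.toSubmodule S) (b j)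
  have hmk : ∀ f, (Subalgebra.toSubmodule S).mkQ f = 0 ↔ f ∈ S := fun f => by
    rw [Submodule.mkQ_apply, Submodule.Quotient.mk_eq_zero, Subalgebra.mem_toSubmodule]
  have key : ∀ i : Fin m, ∃ n, ∀ g : k⟦X⟧, X ^ n ∣ g → (Pi.single i g : Fin m → k⟦X⟧) ∈ S := by
    intro i
    let s : k⟦X⟧ →ₗ[k] (Fin m → k⟦X⟧) := LinearMap.single k (fun _ => k⟦X⟧) i
    -- Finitely many conditions on `p`: that `p` on branch `i` lies in `S` and multiplies
    -- representatives `t j` of a basis of the quotient into `S`. Some nonzero `p` meets them, and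
    -- it then multiplies all of the product into `S`.
    let Λ : k⟦X⟧ →ₗ[k] Q × (Fin (Module.finrank k Q) → Q) :=
      ((Subalgebra.toSubmodule S).mkQ.comp s).prod
        (LinearMap.pi fun j => (Subalgebra.toSubmodule S).mkQ.comp
          ((LinearMap.mulRight k (t j)).comp s))
    obtain ⟨p, hp, hΛ⟩ := PowerSeries.exists_ne_zero_map_eq_zero Λ
    have h1 : s p ∈ S := (hmk _).mp (congrArg Prod.fst hΛ)
    have h2 : ∀ j, s p * t j ∈ S := fun j => (hmk _).mp (congrFun (congrArg Prod.snd hΛ) j)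
    have h3 : ∀ f, s p * f ∈ S := by
      intro f
      have h4 : f - ∑ j, b.repr ((Subalgebra.toSubmodule S).mkQ f) j • t j ∈ S := by
        rw [← hmk, map_sub, map_sum]
        simp only [map_smul, ht]
        rw [b.sum_repr, sub_self]
      have h5 : s p * f = s p * (f - ∑ j, b.repr ((Subalgebra.toSubmodule S).mkQ f) j • t j) +
          ∑ j, b.repr ((Subalgebra.toSubmodule S).mkQ f) j • (s p * t j) := by
        rw [mul_sub, Finset.mul_sum]
        simp
      rw [h5]
      exact add_mem (mul_mem h1 h4) (sum_mem fun j _ => S.smul_mem (h2 j) _)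
    obtain ⟨n, u, rfl⟩ : ∃ n, ∃ u : k⟦X⟧ˣ, p = X ^ n * (u : k⟦X⟧) := by
      obtain ⟨n, h⟩ := IsDiscreteValuationRing.associated_pow_irreducible hp
        (PowerSeries.X_irreducible (R := k))
      obtain ⟨u, hu⟩ := h.symm
      exact ⟨n, u, hu.symm⟩
    refine ⟨n, fun g hg => ?_⟩
    obtain ⟨q, rfl⟩ := hg
    have h6 := h3 (Pi.single i ((↑u⁻¹ : k⟦X⟧) * q))
    convert h6 using 1
    change _ = (Pi.single i (X ^ n * (u : k⟦X⟧)) : Fin m → k⟦X⟧) * _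
    rw [← Pi.single_mul]
    congr 1
    rw [mul_assoc, ← mul_assoc (u : k⟦X⟧), Units.mul_inv, one_mul]
  choose n hn using key
  refine ⟨∑ i, n i + 1, Nat.succ_pos _, fun f hf => ?_⟩
  rw [SetLike.mem_coe, ← Finset.univ_sum_single f]
  refine sum_mem fun i _ => hn i _ ((pow_dvd_pow _ ?_).trans (hf i))
  exact (Finset.single_le_sum (fun j _ => Nat.zero_le (n j)) (Finset.mem_univ i)).trans
    (Nat.le_succ _)

/-- The elements of a local subalgebra have a well defined value at the origin. -/
theorem coeff_zero_eq_of_isLocalRing (S : Subalgebra k (Fin m → k⟦X⟧)) [IsLocalRing S]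
    {f : Fin m → k⟦X⟧} (hf : f ∈ S) (i j : Fin m) : coeff 0 (f i) = coeff 0 (f j) := by
  by_contra hne
  have hnu : ∀ l, ¬ IsUnit ((⟨f, hf⟩ : S) - algebraMap k S (coeff 0 (f l))) := by
    intro l hu
    have h1 := hu.map ((Pi.evalRingHom (fun _ : Fin m => k⟦X⟧) l).comp S.val.toRingHom)
    have h2 : ((Pi.evalRingHom (fun _ : Fin m => k⟦X⟧) l).comp S.val.toRingHom)
        ((⟨f, hf⟩ : S) - algebraMap k S (coeff 0 (f l))) = f l - C (coeff 0 (f l)) := rfl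
    rw [h2, isUnit_iff_constantCoeff] at h1
    simp at h1
  -- With two different values at the origin, subtracting each from `f` would give two nonunits
  -- whose difference is a nonzero scalar.
  have hu : IsUnit (((⟨f, hf⟩ : S) - algebraMap k S (coeff 0 (f i))) +
      -((⟨f, hf⟩ : S) - algebraMap k S (coeff 0 (f j)))) := by
    have : ((⟨f, hf⟩ : S) - algebraMap k S (coeff 0 (f i))) +
      -((⟨f, hf⟩ : S) - algebraMap k S (coeff 0 (f j))) =
        algebraMap k S (coeff 0 (f j) - coeff 0 (f i)) := by
      rw [map_sub]; ring
    rw [this]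
    exact (IsUnit.mk0 _ (sub_ne_zero.mpr (Ne.symm hne))).map _
  rcases IsLocalRing.isUnit_or_isUnit_of_isUnit_add hu with h | h
  · exact hnu i h
  · exact hnu j ((IsUnit.neg_iff _).mp h)

/-- The socle of the quotient of `k⟦t_1⟧ × ⋯ × k⟦t_m⟧` by `S` is at most one-dimensional. -/
def HasSimpleSocle (S : Subalgebra k (Fin m → k⟦X⟧)) : Prop :=
  ∀ q₁ q₂ : Fin m → k⟦X⟧, (∀ f ∈ S, (∀ i, coeff 0 (f i) = 0) → q₁ * f ∈ S) →
    (∀ f ∈ S, (∀ i, coeff 0 (f i) = 0) → q₂ * f ∈ S) → q₁ ∈ S ∨ ∃ c : k, q₂ - c • q₁ ∈ S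

/-- Gorenstein curve singularities of genus two as glueings of their branches. -/
theorem IsGorensteinGenusTwo.exists_isBranchGlueing [IsAlgClosed k] {R : Type*} [CommRing R]
    [Algebra k R] (hm : 0 < m) (h : IsGorensteinGenusTwo k R m) :
    ∃ (S : Subalgebra k (Fin m → k⟦X⟧)) (N : ℕ), Nonempty (R ≃ₐ[k] S) ∧ IsBranchGlueing S N ∧
      HasSimpleSocle S ∧
      Module.finrank k ((Fin m → k⟦X⟧) ⧸ Subalgebra.toSubmodule S) = m + 1 := by
  have := h.isLocalRing
  obtain ⟨ι, hι, hfr⟩ := h.exists_algHom_pi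
  let E : R ≃ₐ[k] ι.range := AlgEquiv.ofInjective ι hι
  have hSub : Subalgebra.toSubmodule ι.range = LinearMap.range ι.toLinearMap := by
    ext f; rfl
  rw [← hSub] at hfr
  have hfin : FiniteDimensional k ((Fin m → k⟦X⟧) ⧸ Subalgebra.toSubmodule ι.range) :=
    FiniteDimensional.of_finrank_pos (by omega)
  have hloc : IsLocalRing ι.range := E.toRingEquiv.isLocalRing
  obtain ⟨N, hN, hsub⟩ := exists_radicalPow_subset_of_finite ι.range
  have hS : IsBranchGlueing ι.range N :=
    ⟨hm, hN, fun f hf i j => coeff_zero_eq_of_isLocalRing ι.range hf i j, hsub⟩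
  refine ⟨ι.range, N, ⟨E⟩, hS, ?_, hfr⟩
  have hmax : ∀ f ∈ IsLocalRing.maximalIdeal R, ∀ i, coeff 0 (ι f i) = 0 := by
    intro f hf i
    have h1 : E f ∈ IsLocalRing.maximalIdeal ι.range := by
      rw [IsLocalRing.mem_maximalIdeal, mem_nonunits_iff]
      intro hu
      exact hf (by simpa using hu.map E.symm)
    exact (hS.mem_maximalIdeal_iff _ i).mp h1
  have hreg : ∀ x ∈ nonZeroDivisors R, ι x ∈ nonZeroDivisors (Fin m → k⟦X⟧) := by
    intro x hx
    have h1 : E x ∈ nonZeroDivisors ι.range := by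
      rw [mem_nonZeroDivisors_iff_right] at hx ⊢
      intro z hz
      have h2 := hx (E.symm z) (by
        apply E.injective
        rw [map_mul, E.apply_symm_apply, hz, map_zero])
      simpa using h2
    rw [hS.mem_nonZeroDivisors_iff] at h1
    rw [mem_nonZeroDivisors_iff_right]
    intro z hz
    funext i
    exact (mul_eq_zero.mp (congrFun hz i)).resolve_right (h1 i)
  intro q₁ q₂ h₁ h₂
  have hq : ∀ q : Fin m → k⟦X⟧,
      (∀ f ∈ ι.range, (∀ i, coeff 0 (f i) = 0) → q * f ∈ ι.range) →
      ∀ f ∈ IsLocalRing.maximalIdeal R, q * ι.toRingHom f ∈ ι.toRingHom.range :=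
    fun q hq f hf => hq _ ⟨f, rfl⟩ (hmax f hf)
  rcases h.gorenstein.mem_range_or_exists ι.toRingHom hι hreg (hq _ h₁) (hq _ h₂) with h3 | ⟨r, h3⟩
  · exact Or.inl h3
  · right
    have h4 : q₂ - ι r * q₁ ∈ ι.range := h3
    -- The multiplier `r` may be replaced by its value at the origin: their difference is in the
    -- maximal ideal, which `q₁` multiplies into `S`.
    refine ⟨coeff 0 (ι r ⟨0, hm⟩), ?_⟩
    set c := coeff 0 (ι r ⟨0, hm⟩)
    have h5 := h₁ (ι r - algebraMap k _ c) (sub_mem ⟨r, rfl⟩ (Subalgebra.algebraMap_mem _ _))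
      (fun i => by
        have h6 : coeff 0 (ι r i) = c := hS.coeff_zero_eq _ ⟨r, rfl⟩ _ _
        change coeff 0 (ι r i - C c) = 0
        rw [map_sub, h6]
        simp)
    have h7 : q₂ - c • q₁ = (q₂ - ι r * q₁) + q₁ * (ι r - algebraMap k _ c) := by
      rw [Algebra.smul_def]; ring
    rw [h7]
    exact add_mem h4 h5

end

/-! ### Two functionals cut out a genus two glueing. -/

section

open PowerSeries

section

variable {k : Type*} [Field k] {m : ℕ}

/-- The ideal `(t_1, …, t_m) ^ n` as a subspace. -/
def radicalPowSubmodule (k : Type*) [Field k] (m n : ℕ) : Submodule k (Fin m → k⟦X⟧) where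
  carrier := radicalPow k m n
  add_mem' := fun hf hg j => dvd_add (hf j) (hg j)
  zero_mem' := fun _ => dvd_zero _
  smul_mem' := fun c f hf j => by
    rw [Pi.smul_apply, smul_eq_C_mul]
    exact Dvd.dvd.mul_left (hf j) _

lemma mul_mem_radicalPow {a b : ℕ} {f g : Fin m → k⟦X⟧} (hf : f ∈ radicalPow k m a)
    (hg : g ∈ radicalPow k m b) : f * g ∈ radicalPow k m (a + b) := fun j => by
  rw [pow_add]
  exact mul_dvd_mul (hf j) (hg j)

variable {S : Subalgebra k (Fin m → k⟦X⟧)} {N : ℕ}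

/-- If the elements of order `a` and those of order `b` lie in `S` up to higher order, so do those
of order `a + b`. -/
lemma exists_sub_mem_radicalPow_add {a b : ℕ}
    (ha : ∀ f ∈ radicalPow k m a, ∃ s ∈ S, f - s ∈ radicalPow k m (a + 1))
    (hb : ∀ f ∈ radicalPow k m b, ∃ s ∈ S, f - s ∈ radicalPow k m (b + 1)) :
    ∀ f ∈ radicalPow k m (a + b), ∃ s ∈ S, f - s ∈ radicalPow k m (a + b + 1) := by
  intro f hf
  obtain ⟨g, rfl⟩ := exists_eq_X_pow_mul_of_mem_radicalPow hf
  set u : Fin m → k⟦X⟧ := fun _ => X ^ a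
  set v : Fin m → k⟦X⟧ := (fun _ => X ^ b) * g
  have hu : u ∈ radicalPow k m a := fun _ => dvd_rfl
  have hv : v ∈ radicalPow k m b := fun _ => dvd_mul_right _ _
  obtain ⟨s, hs, hs'⟩ := ha u hu
  obtain ⟨t, ht, ht'⟩ := hb v hv
  refine ⟨s * t, mul_mem hs ht, ?_⟩
  have hsa : s ∈ radicalPow k m a := by
    have := sub_mem (show u ∈ radicalPowSubmodule k m a from hu)
      (show u - s ∈ radicalPowSubmodule k m a from radicalPow_mono (Nat.le_succ a) hs')
    rwa [sub_sub_cancel] at this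
  have h1 := mul_mem_radicalPow hs' hv
  have h2 := mul_mem_radicalPow hsa ht'
  have h3 : (fun _ => X ^ (a + b)) * g - s * t = (u - s) * v + s * (v - t) := by
    have : (fun _ => X ^ (a + b)) * g = u * v := by
      funext i
      simp only [u, v, Pi.mul_apply, pow_add]
      ring
    rw [this]
    ring
  rw [h3]
  refine (radicalPowSubmodule k m (a + b + 1)).add_mem ?_ h2
  rwa [show a + b + 1 = a + 1 + b by omega]

/-- If all elements of order at least `a` lie in `S` up to higher order, they lie in `S`. -/
lemma IsBranchGlueing.radicalPow_subset_of_forall (hS : IsBranchGlueing S N) {a : ℕ}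
    (h : ∀ n, a ≤ n → ∀ f ∈ radicalPow k m n, ∃ s ∈ S, f - s ∈ radicalPow k m (n + 1)) :
    radicalPow k m a ⊆ S := by
  have key : ∀ d n, a ≤ n → N ≤ n + d → radicalPow k m n ⊆ S := by
    intro d
    induction d with
    | zero => exact fun n _ hn => (radicalPow_mono hn).trans hS.radicalPow_subset
    | succ d ih =>
      intro n han hn f hf
      obtain ⟨s, hs, hs'⟩ := h n han f hf
      have := ih (n + 1) (by omega) (by omega) hs'
      simpa using add_mem this hs
  exact key N a le_rfl (by omega)

/-- A glueing with `δ = m + 1` has two independent elements of positive order modulo `S`. -/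
lemma IsBranchGlueing.exists_independent (hS : IsBranchGlueing S N)
    (hfr : Module.finrank k ((Fin m → k⟦X⟧) ⧸ Subalgebra.toSubmodule S) = m + 1) :
    ∃ q₁ ∈ radicalPow k m 1, ∃ q₂ ∈ radicalPow k m 1,
      ∀ c₁ c₂ : k, c₁ • q₁ + c₂ • q₂ ∈ S → c₁ = 0 ∧ c₂ = 0 := by
  have hfin : FiniteDimensional k ((Fin m → k⟦X⟧) ⧸ Subalgebra.toSubmodule S) :=
    FiniteDimensional.of_finrank_pos (by omega)
  let l : Fin m := ⟨0, hS.pos⟩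
  have hle : Subalgebra.toSubmodule S ≤ LinearMap.ker (valueDiff k l) := fun f hf =>
    valueDiff_eq_zero_iff.mpr fun i => hS.coeff_zero_eq f hf i l
  let D := (Subalgebra.toSubmodule S).liftQ (valueDiff k l) hle
  have hDr : LinearMap.range D = ⊤ := by
    rw [Submodule.range_liftQ, LinearMap.range_eq_top]
    intro v
    refine ⟨fun j => if h : j = l then 0 else C (v ⟨j, h⟩), ?_⟩
    funext i
    simp [valueDiff, i.2]
  -- Of the codimension `m + 1`, the differences of values take up `m - 1`.
  have hker : Module.finrank k (LinearMap.ker D) = 2 := by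
    have h1 := LinearMap.finrank_range_add_finrank_ker D
    have h2 := finrank_valueDiff_codomain (k := k) l
    rw [hDr, finrank_top] at h1
    omega
  let b := Module.finBasisOfFinrankEq k (LinearMap.ker D) hker
  have hlift : ∀ i, ∃ q ∈ radicalPow k m 1, (Subalgebra.toSubmodule S).mkQ q = (b i).1 := by
    intro i
    obtain ⟨f, hf⟩ := Submodule.mkQ_surjective (Subalgebra.toSubmodule S) (b i).1
    have h3 : valueDiff k l f = 0 := by
      have : D (b i).1 = 0 := (b i).2
      rw [← hf] at this
      simpa [D] using this
    rw [valueDiff_eq_zero_iff] at h3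
    refine ⟨f - algebraMap k _ (coeff 0 (f l)), fun j => ?_, ?_⟩
    · rw [pow_one, X_dvd_iff]
      have h4 := h3 j
      change constantCoeff (f j - C (coeff 0 (f l))) = 0
      rw [← h4]
      simp
    · rw [map_sub, hf, sub_eq_self, Submodule.mkQ_apply, Submodule.Quotient.mk_eq_zero]
      exact Subalgebra.algebraMap_mem S _
  obtain ⟨q₁, hq₁, h₁⟩ := hlift 0
  obtain ⟨q₂, hq₂, h₂⟩ := hlift 1
  refine ⟨q₁, hq₁, q₂, hq₂, fun c₁ c₂ h => ?_⟩
  have h5 : (Subalgebra.toSubmodule S).mkQ (c₁ • q₁ + c₂ • q₂) = 0 := by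
    rw [Submodule.mkQ_apply, Submodule.Quotient.mk_eq_zero]
    exact h
  rw [map_add, map_smul, map_smul, h₁, h₂] at h5
  have h6 : c₁ • b 0 + c₂ • b 1 = 0 := Subtype.ext h5
  have h7 := Fintype.linearIndependent_iff.mp b.linearIndependent ![c₁, c₂]
    (by simpa [Fin.sum_univ_two] using h6)
  exact ⟨h7 0, h7 1⟩

/-- Two functionals vanishing on a glueing with `δ = m + 1`, in triangular position, cut it out. -/
lemma IsBranchGlueing.mem_iff_of_functionals (hS : IsBranchGlueing S N)
    (hfr : Module.finrank k ((Fin m → k⟦X⟧) ⧸ Subalgebra.toSubmodule S) = m + 1)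
    (φ₁ φ₂ : (Fin m → k⟦X⟧) →ₗ[k] k) (h₁ : ∀ f ∈ S, φ₁ f = 0) (h₂ : ∀ f ∈ S, φ₂ f = 0)
    {u w : Fin m → k⟦X⟧} (hu : u ∈ radicalPow k m 1) (hw : w ∈ radicalPow k m 1)
    (hu₁ : φ₁ u ≠ 0) (hw₁ : φ₁ w = 0) (hw₂ : φ₂ w ≠ 0) (f : Fin m → k⟦X⟧) :
    f ∈ S ↔ (∀ i j, coeff 0 (f i) = coeff 0 (f j)) ∧ φ₁ f = 0 ∧ φ₂ f = 0 := by
  have hfin : FiniteDimensional k ((Fin m → k⟦X⟧) ⧸ Subalgebra.toSubmodule S) :=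
    FiniteDimensional.of_finrank_pos (by omega)
  let l : Fin m := ⟨0, hS.pos⟩
  -- On the quotient by `S` this induces a surjection between spaces of equal dimension `m + 1`,
  -- hence an injection.
  let Ψ := (valueDiff k l).prod (φ₁.prod φ₂)
  have hval : ∀ g ∈ radicalPow k m 1, valueDiff k l g = 0 := fun g hg => by
    rw [valueDiff_eq_zero_iff]
    intro i
    rw [coeff_eq_zero_of_mem_radicalPow one_pos hg, coeff_eq_zero_of_mem_radicalPow one_pos hg]
  have hsurj : Function.Surjective Ψ := by
    rintro ⟨v, a, b⟩
    set f₀ : Fin m → k⟦X⟧ := fun j => if h : j = l then 0 else C (v ⟨j, h⟩) with hf₀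
    have h0 : valueDiff k l f₀ = v := by
      funext i
      simp [valueDiff, hf₀, i.2]
    set α := (a - φ₁ f₀) / φ₁ u with hα
    refine ⟨f₀ + α • u + ((b - φ₂ f₀ - α * φ₂ u) / φ₂ w) • w, ?_⟩
    refine Prod.ext ?_ (Prod.ext ?_ ?_)
    · simp [Ψ, h0, hval u hu, hval w hw]
    · simp [Ψ, hw₁, hα, hu₁]
    · simp [Ψ, hw₂]
  have hle : Subalgebra.toSubmodule S ≤ LinearMap.ker Ψ := fun g hg => by
    have h3 : valueDiff k l g = 0 := valueDiff_eq_zero_iff.mpr fun i => hS.coeff_zero_eq g hg i l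
    simp [Ψ, h₁ g hg, h₂ g hg, h3]
  let D := (Subalgebra.toSubmodule S).liftQ Ψ hle
  have hDs : Function.Surjective D := by
    rw [← LinearMap.range_eq_top, Submodule.range_liftQ, LinearMap.range_eq_top]
    exact hsurj
  have hdim : Module.finrank k ((Fin m → k⟦X⟧) ⧸ Subalgebra.toSubmodule S) =
      Module.finrank k (({i : Fin m // i ≠ l} → k) × k × k) := by
    have := finrank_valueDiff_codomain (k := k) l
    rw [hfr, Module.finrank_prod, Module.finrank_prod, Module.finrank_self]
    omega
  have hDi := (LinearMap.injective_iff_surjective_of_finrank_eq_finrank hdim).mpr hDs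
  constructor
  · exact fun hf => ⟨fun i j => hS.coeff_zero_eq f hf i j, h₁ f hf, h₂ f hf⟩
  · rintro ⟨h3, h4, h5⟩
    have h6 : D ((Subalgebra.toSubmodule S).mkQ f) = 0 := by
      have h7 : valueDiff k l f = 0 := valueDiff_eq_zero_iff.mpr fun i => h3 i l
      change Ψ f = 0
      simp [Ψ, h4, h5, h7]
    have h8 := (injective_iff_map_eq_zero D).mp hDi _ h6
    rwa [Submodule.mkQ_apply, Submodule.Quotient.mk_eq_zero, Subalgebra.mem_toSubmodule] at h8

/-- The value of a functional on monomials with prescribed leading coefficients. -/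
lemma map_coeff_mul_X_pow (φ : (Fin m → k⟦X⟧) →ₗ[k] k) (v : Fin m → k) (n : ℕ) :
    φ (fun i => C (v i) * X ^ n) = (fun i => φ (Pi.single i (X ^ n))) ⬝ᵥ v := by
  have : (fun i => C (v i) * X ^ n) =
      ∑ i, v i • (Pi.single i (X ^ n) : Fin m → k⟦X⟧) := by
    funext j
    rw [Finset.sum_apply, Finset.sum_eq_single j]
    · simp [smul_eq_C_mul]
    · intro i _ hij
      simp [Pi.single_eq_of_ne hij.symm]
    · simp
  rw [this, map_sum, dotProduct]
  exact Finset.sum_congr rfl fun i _ => by rw [map_smul, smul_eq_mul, mul_comm]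

/-- A genus two Gorenstein glueing is cut out by two functionals depending on the coefficients of
order at most three. -/
theorem IsBranchGlueing.exists_functionals (hS : IsBranchGlueing S N) (hsoc : HasSimpleSocle S)
    (hfr : Module.finrank k ((Fin m → k⟦X⟧) ⧸ Subalgebra.toSubmodule S) = m + 1) :
    ∃ a b c e : Fin m → k, a ≠ 0 ∧ (b = 0 → c ≠ 0) ∧ ∀ f, f ∈ S ↔
      (∀ i j, coeff 0 (f i) = coeff 0 (f j)) ∧ a ⬝ᵥ (fun i => coeff 1 (f i)) = 0 ∧
      b ⬝ᵥ (fun i => coeff 3 (f i)) + c ⬝ᵥ (fun i => coeff 2 (f i)) +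
        e ⬝ᵥ (fun i => coeff 1 (f i)) = 0 := by
  obtain ⟨q₁, hq₁, q₂, hq₂, hq⟩ := hS.exists_independent hfr
  have hone : ∀ f : Fin m → k⟦X⟧, (∀ i, coeff 0 (f i) = 0) ↔ f ∈ radicalPow k m 1 := by
    intro f
    refine ⟨fun h i => ?_, fun h i => coeff_eq_zero_of_mem_radicalPow one_pos h i⟩
    rw [pow_one, X_dvd_iff]
    simpa using h i
  have hn1 : ¬ radicalPow k m 1 ⊆ S := fun h => by
    have := hq 1 0 (by simpa using h hq₁)
    simp at this
  -- Otherwise `q₁` and `q₂` would both multiply the maximal ideal into `S`, and independence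
  -- contradicts the simple socle.
  have hn2 : ¬ radicalPow k m 2 ⊆ S := fun h => by
    have hkill : ∀ q ∈ radicalPow k m 1, ∀ f ∈ S, (∀ i, coeff 0 (f i) = 0) → q * f ∈ S :=
      fun q hq f _ hf => by
        have h0 := mul_mem_radicalPow hq ((hone f).mp hf)
        rw [one_add_one_eq_two] at h0
        exact h h0
    rcases hsoc q₁ q₂ (hkill _ hq₁) (hkill _ hq₂) with h1 | ⟨c, h1⟩
    · have := hq 1 0 (by simpa using h1)
      simp at this
    · have := hq (-c) 1 (by
        have : -c • q₁ + (1 : k) • q₂ = q₂ - c • q₁ := by rw [one_smul, neg_smul]; ring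
        rwa [this])
      simp at this
  -- If every linear part came from `S`, products would produce all leading terms of every positive
  -- order, and `S` would contain the whole radical. So some functional vanishes on `S` and on order
  -- two but not on the radical.
  obtain ⟨u, hu, hu'⟩ : ∃ u ∈ radicalPow k m 1,
      u ∉ Subalgebra.toSubmodule S ⊔ radicalPowSubmodule k m 2 := by
    by_contra! hcon
    have hP : ∀ f ∈ radicalPow k m 1, ∃ s ∈ S, f - s ∈ radicalPow k m 2 := by
      intro f hf
      obtain ⟨s, hs, r, hr, hsr⟩ := Submodule.mem_sup.mp (hcon f hf)
      exact ⟨s, hs, by rw [← hsr, add_sub_cancel_left]; exact hr⟩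
    refine hn1 (hS.radicalPow_subset_of_forall fun n hn => ?_)
    induction n, hn using Nat.le_induction with
    | base => exact hP
    | succ n hn ih => exact exists_sub_mem_radicalPow_add ih hP
  obtain ⟨φ₁, hφu, hφ₁⟩ := Submodule.exists_le_ker_of_notMem hu'
  have hφ₁S : ∀ f ∈ S, φ₁ f = 0 := fun f hf => hφ₁ (Submodule.mem_sup_left hf)
  have hφ₁2 : ∀ f ∈ radicalPow k m 2, φ₁ f = 0 := fun f hf => hφ₁ (Submodule.mem_sup_right hf)
  obtain ⟨w, hw, hw'⟩ := Set.not_subset.mp hn2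
  obtain ⟨φ₂, hφw, hφ₂⟩ := Submodule.exists_le_ker_of_notMem
    (p := Subalgebra.toSubmodule S) (v := w) hw'
  have hφ₂S : ∀ f ∈ S, φ₂ f = 0 := fun f hf => hφ₂ hf
  have hmem := hS.mem_iff_of_functionals hfr φ₁ φ₂ hφ₁S hφ₂S hu
    (radicalPow_mono one_le_two hw) hφu (hφ₁2 w hw) hφw
  have hmem2 : ∀ f ∈ radicalPow k m 2, φ₂ f = 0 → f ∈ S := by
    intro f hf h
    rw [hmem]
    refine ⟨fun i j => ?_, hφ₁2 f hf, h⟩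
    rw [coeff_eq_zero_of_mem_radicalPow two_pos hf, coeff_eq_zero_of_mem_radicalPow two_pos hf]
  -- If `φ₂` were nonzero on some `g` of order four, multiples of `g` would correct every element of
  -- order two or three into `S` without changing its leading term. Orders two and three generate
  -- all higher orders by addition, so `radicalPow k m 2` would lie in `S`.
  have h4 : ∀ f ∈ radicalPow k m 4, φ₂ f = 0 := by
    by_contra! hcon
    obtain ⟨g, hg, hφg⟩ := hcon
    have hstep : ∀ n, 2 ≤ n → n + 1 ≤ 4 → ∀ f ∈ radicalPow k m n, ∃ s ∈ S,
        f - s ∈ radicalPow k m (n + 1) := by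
      intro n hn hn' f hf
      refine ⟨f - (φ₂ f / φ₂ g) • g, ?_, ?_⟩
      · refine hmem2 _ ((radicalPowSubmodule k m 2).sub_mem (radicalPow_mono hn hf)
          ((radicalPowSubmodule k m 2).smul_mem _
            (radicalPow_mono (show 2 ≤ 4 by norm_num) hg))) ?_
        rw [map_sub, map_smul, smul_eq_mul, div_mul_cancel₀ _ hφg, sub_self]
      · rw [sub_sub_cancel]
        exact (radicalPowSubmodule k m (n + 1)).smul_mem _ (radicalPow_mono hn' hg)
    have h2 := hstep 2 le_rfl (by norm_num)
    have h3 := hstep 3 (by norm_num) le_rfl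
    refine hn2 (hS.radicalPow_subset_of_forall fun n hn => ?_)
    induction n using Nat.strong_induction_on with
    | _ n ih =>
      rcases Nat.lt_or_ge n 4 with hlt | hge
      · interval_cases n
        · exact h2
        · exact h3
      · have := exists_sub_mem_radicalPow_add h2 (ih (n - 2) (by omega) (by omega))
        rwa [show 2 + (n - 2) = n by omega] at this
  have hsing : ∀ (i : Fin m) (n : ℕ), (Pi.single i (X ^ n) : Fin m → k⟦X⟧) ∈ radicalPow k m n := by
    intro i n j
    by_cases hj : j = i
    · subst hj; simp
    · simp [Pi.single_eq_of_ne hj]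
  have hexp : ∀ (φ : (Fin m → k⟦X⟧) →ₗ[k] k), (∀ f ∈ S, φ f = 0) →
      (∀ f ∈ radicalPow k m 4, φ f = 0) → ∀ f, (∀ i j, coeff 0 (f i) = coeff 0 (f j)) →
      φ f = (fun i => φ (Pi.single i (X ^ 3))) ⬝ᵥ (fun i => coeff 3 (f i)) +
        (fun i => φ (Pi.single i (X ^ 2))) ⬝ᵥ (fun i => coeff 2 (f i)) +
        (fun i => φ (Pi.single i (X ^ 1))) ⬝ᵥ (fun i => coeff 1 (f i)) := by
    intro φ hφS hφ4 f hf
    let l : Fin m := ⟨0, hS.pos⟩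
    rw [← map_coeff_mul_X_pow, ← map_coeff_mul_X_pow, ← map_coeff_mul_X_pow, ← map_add, ← map_add,
      ← sub_eq_zero, ← map_sub]
    set g := f - ((fun i => C (coeff 3 (f i)) * X ^ 3) + (fun i => C (coeff 2 (f i)) * X ^ 2) +
      fun i => C (coeff 1 (f i)) * X ^ 1) with hg
    have h5 : g - algebraMap k _ (coeff 0 (f l)) ∈ radicalPow k m 4 := by
      intro i
      rw [X_pow_dvd_iff]
      intro n hn
      change coeff n (g i - C (coeff 0 (f l))) = 0
      rw [hg, hf l i]
      interval_cases n <;> simp [coeff_X_pow, coeff_C]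
    have h6 := hφ4 _ h5
    rwa [map_sub, hφS _ (Subalgebra.algebraMap_mem S _), sub_zero] at h6
  refine ⟨fun i => φ₁ (Pi.single i (X ^ 1)), fun i => φ₂ (Pi.single i (X ^ 3)),
    fun i => φ₂ (Pi.single i (X ^ 2)), fun i => φ₂ (Pi.single i (X ^ 1)), ?_, ?_, ?_⟩
  · intro h0
    apply hφu
    have h7 := hexp φ₁ hφ₁S (fun f hf => hφ₁2 f (radicalPow_mono (by norm_num) hf)) u
      (fun i j => by rw [(hone u).mpr hu, (hone u).mpr hu])
    rw [h7, h0]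
    have h8 : ∀ n, 2 ≤ n → (fun i => φ₁ (Pi.single i (X ^ n))) = 0 := fun n hn =>
      funext fun i => hφ₁2 _ (radicalPow_mono hn (hsing i n))
    simp [h8 3 (by norm_num), h8 2 le_rfl]
  · intro hb hc
    apply hφw
    rw [hexp φ₂ hφ₂S h4 w (fun i j => by
      rw [coeff_eq_zero_of_mem_radicalPow two_pos hw, coeff_eq_zero_of_mem_radicalPow two_pos hw]),
      hb, hc]
    have h9 : (fun i => coeff 1 (w i)) = 0 :=
      funext fun i => coeff_eq_zero_of_mem_radicalPow one_lt_two hw i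
    rw [h9]
    simp
  · intro f
    rw [hmem]
    refine and_congr_right fun hf => ?_
    have h8 : ∀ n, 2 ≤ n → (fun i => φ₁ (Pi.single i (X ^ n))) = 0 := fun n hn =>
      funext fun i => hφ₁2 _ (radicalPow_mono hn (hsing i n))
    rw [hexp φ₁ hφ₁S (fun f hf => hφ₁2 f (radicalPow_mono (by norm_num) hf)) f hf,
      hexp φ₂ hφ₂S h4 f hf, h8 3 (by norm_num), h8 2 le_rfl]
    simp

end

end

/-! ### Multiplicativity restricts the functionals; automorphisms of the product. -/

section

open PowerSeries

section

variable {k : Type*} [Field k] {m : ℕ}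

/-- The pairs `(v, w, z)` of leading coefficients allowed by two functionals are closed under
multiplication of power series. -/
def IsMulClosedJet (a b c e : Fin m → k) : Prop :=
  ∀ v w z v' w' z' : Fin m → k, a ⬝ᵥ v = 0 → b ⬝ᵥ z + c ⬝ᵥ w + e ⬝ᵥ v = 0 →
    a ⬝ᵥ v' = 0 → b ⬝ᵥ z' + c ⬝ᵥ w' + e ⬝ᵥ v' = 0 →
    b ⬝ᵥ (v * w' + w * v') + c ⬝ᵥ (v * v') = 0

/-- The entry `z l` can absorb the second constraint, so the quadratic coefficients are free. Taking
`v' = 0` and `w'` a basis vector gives `b i * v i = 0` on the whole hyperplane `a ⬝ᵥ v = 0`, which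
must therefore be the hyperplane `v l = 0`. Squares of basis vectors in it then remove the other
entries of `c`. -/
lemma IsMulClosedJet.exists_support_of_ne_zero {a b c e : Fin m → k}
    (h : IsMulClosedJet a b c e) (ha : a ≠ 0) (hb : b ≠ 0) :
    ∃ l, a l ≠ 0 ∧ b l ≠ 0 ∧ ∀ j, j ≠ l → a j = 0 ∧ b j = 0 ∧ c j = 0 := by
  obtain ⟨l, hl⟩ := Function.ne_iff.mp hb
  rw [Pi.zero_apply] at hl
  have h1 : ∀ v, a ⬝ᵥ v = 0 → ∀ i, b i * v i = 0 := by
    intro v hv i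
    have := h v 0 (Pi.single l (-(e ⬝ᵥ v) / b l)) 0 (Pi.single i 1) (Pi.single l (-c i / b l)) hv
      (by rw [dotProduct_single, mul_div_cancel₀ _ hl]; simp) (by simp)
      (by rw [dotProduct_single, mul_div_cancel₀ _ hl]; simp)
    have h2 : v * Pi.single i 1 = Pi.single i (v i) := by
      rw [← Pi.single_mul_right, mul_one]
    simpa [h2] using this
  have haj : ∀ j, j ≠ l → a j = 0 := by
    intro j hj
    have := h1 (Pi.single j (a l) - Pi.single l (a j))
      (by rw [dotProduct_sub, dotProduct_single, dotProduct_single]; ring) l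
    simpa [Pi.single_eq_of_ne hj.symm, hl] using this
  have hal : a l ≠ 0 := fun h0 => ha (funext fun j => by
    by_cases hj : j = l
    · rw [hj, h0, Pi.zero_apply]
    · exact haj j hj)
  refine ⟨l, hal, hl, fun j hj => ⟨haj j hj, ?_, ?_⟩⟩
  · have := h1 (Pi.single j 1) (by rw [dotProduct_single, haj j hj, zero_mul]) j
    simpa using this
  · have hav : a ⬝ᵥ Pi.single j 1 = 0 := by rw [dotProduct_single, haj j hj, zero_mul]
    have hz : b ⬝ᵥ Pi.single l (-e j / b l) + c ⬝ᵥ 0 + e ⬝ᵥ Pi.single j 1 = 0 := by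
      rw [dotProduct_single, mul_div_cancel₀ _ hl]; simp
    have := h (Pi.single j 1) 0 (Pi.single l (-e j / b l)) (Pi.single j 1) 0
      (Pi.single l (-e j / b l)) hav hz hav hz
    rw [← Pi.single_mul] at this
    simpa using this

/-- Now `w l` absorbs the second constraint, and the diagonal quadratic form with coefficients `c`
vanishes on the hyperplane `a ⬝ᵥ v = 0`. Testing it on the vectors with entry `a l` at `j` and `-a
j` at `l` shows that at most two branches are involved. -/
lemma IsMulClosedJet.exists_support_of_eq_zero {a c e : Fin m → k}
    (h : IsMulClosedJet a 0 c e) (ha : a ≠ 0) (hc : c ≠ 0) :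
    ∃ l, a l ≠ 0 ∧ c l ≠ 0 ∧ ((∀ j, j ≠ l → a j = 0 ∧ c j = 0) ∨
      ∃ p, p ≠ l ∧ a p ≠ 0 ∧ c p * a l ^ 2 + c l * a p ^ 2 = 0 ∧
        ∀ j, j ≠ p → j ≠ l → a j = 0 ∧ c j = 0) := by
  obtain ⟨l, hl⟩ := Function.ne_iff.mp hc
  rw [Pi.zero_apply] at hl
  have h1 : ∀ v v', a ⬝ᵥ v = 0 → a ⬝ᵥ v' = 0 → c ⬝ᵥ (v * v') = 0 := by
    intro v v' hv hv'
    have hw : ∀ v, (0 : Fin m → k) ⬝ᵥ (0 : Fin m → k) +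
        c ⬝ᵥ Pi.single l (-(e ⬝ᵥ v) / c l) + e ⬝ᵥ v = 0 := by
      intro v
      rw [dotProduct_single, mul_div_cancel₀ _ hl]; simp
    have := h v _ 0 v' _ 0 hv (hw v) hv' (hw v')
    simpa using this
  have hker : ∀ i j, a ⬝ᵥ (Pi.single i (a j) - Pi.single j (a i)) = 0 := fun i j => by
    rw [dotProduct_sub, dotProduct_single, dotProduct_single]; ring
  have hsq : ∀ j, j ≠ l → c j * a l ^ 2 + c l * a j ^ 2 = 0 := by
    intro j hj
    have h2 := h1 _ _ (hker j l) (hker j l)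
    have h3 : (Pi.single j (a l) - Pi.single l (a j) : Fin m → k) *
        (Pi.single j (a l) - Pi.single l (a j)) =
        Pi.single j (a l ^ 2) + Pi.single l (a j ^ 2) := by
      funext i
      by_cases hij : i = j
      · subst hij; simp [Pi.single_eq_of_ne hj]; ring
      · by_cases hil : i = l
        · subst hil; simp [Pi.single_eq_of_ne hij]; ring
        · simp [Pi.single_eq_of_ne hij, Pi.single_eq_of_ne hil]
    rwa [h3, dotProduct_add, dotProduct_single, dotProduct_single] at h2
  have hmul : ∀ i j, i ≠ l → j ≠ l → i ≠ j → a i * a j = 0 := by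
    intro i j hi hj hij
    have h2 := h1 _ _ (hker i l) (hker j l)
    have h3 : (Pi.single i (a l) - Pi.single l (a i) : Fin m → k) *
        (Pi.single j (a l) - Pi.single l (a j)) = Pi.single l (a i * a j) := by
      funext n
      by_cases hnl : n = l
      · subst hnl; simp [Pi.single_eq_of_ne hi.symm, Pi.single_eq_of_ne hj.symm]
      · by_cases hni : n = i
        · subst hni; simp [Pi.single_eq_of_ne hij, Pi.single_eq_of_ne hnl]
        · simp [Pi.single_eq_of_ne hni, Pi.single_eq_of_ne hnl]
    rw [h3, dotProduct_single] at h2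
    exact (mul_eq_zero.mp h2).resolve_left hl
  have hal : a l ≠ 0 := by
    intro h0
    refine ha (funext fun j => ?_)
    by_cases hj : j = l
    · rw [hj, h0, Pi.zero_apply]
    · have := hsq j hj
      rw [h0] at this
      simpa [hl] using this
  have hcj : ∀ j, j ≠ l → a j = 0 → c j = 0 := by
    intro j hj h0
    have := hsq j hj
    rw [h0] at this
    simpa [hal] using this
  refine ⟨l, hal, hl, ?_⟩
  by_cases hex : ∃ p, p ≠ l ∧ a p ≠ 0
  · obtain ⟨p, hp, hap⟩ := hex
    refine Or.inr ⟨p, hp, hap, hsq p hp, fun j hjp hjl => ?_⟩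
    have h0 : a j = 0 := (mul_eq_zero.mp (hmul j p hjl hp hjp)).resolve_right hap
    exact ⟨h0, hcj j hjl h0⟩
  · push Not at hex
    exact Or.inl fun j hj => ⟨hex j hj, hcj j hj (hex j hj)⟩

lemma dotProduct_eq_of_support {a : Fin m → k} {l : Fin m} (h : ∀ j, j ≠ l → a j = 0)
    (v : Fin m → k) : a ⬝ᵥ v = a l * v l :=
  Finset.sum_eq_single l (fun j _ hj => by rw [h j hj, zero_mul]) (by simp)

lemma dotProduct_eq_of_support_pair {a : Fin m → k} {p l : Fin m} (hpl : p ≠ l)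
    (h : ∀ j, j ≠ p → j ≠ l → a j = 0) (v : Fin m → k) : a ⬝ᵥ v = a p * v p + a l * v l :=
  Finset.sum_eq_add_of_mem p l (Finset.mem_univ _) (Finset.mem_univ _) hpl
    fun j _ hj => by rw [h j hj.1 hj.2, zero_mul]

lemma nonempty_algEquiv_of_forall_mem_iff {S S' : Subalgebra k (Fin m → k⟦X⟧)}
    (Φ : (Fin m → k⟦X⟧) ≃ₐ[k] (Fin m → k⟦X⟧)) (h : ∀ f, f ∈ S ↔ Φ f ∈ S') :
    Nonempty (S ≃ₐ[k] S') := by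
  refine ⟨(Φ.subalgebraMap S).trans (Subalgebra.equivOfEq _ _ ?_)⟩
  ext f
  rw [Subalgebra.mem_map]
  constructor
  · rintro ⟨g, hg, rfl⟩
    exact (h g).mp hg
  · intro hf
    exact ⟨Φ.symm f, (h _).mpr (by rwa [Φ.apply_symm_apply]), Φ.apply_symm_apply f⟩

/-- The permutation of branches. -/
def permuteBranches (k : Type*) [Field k] {m : ℕ} (σ : Equiv.Perm (Fin m)) :
    (Fin m → k⟦X⟧) ≃ₐ[k] (Fin m → k⟦X⟧) where
  toFun f := fun i => f (σ i)
  invFun f := fun i => f (σ.symm i)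
  left_inv f := by simp
  right_inv f := by simp
  map_mul' _ _ := rfl
  map_add' _ _ := rfl
  commutes' _ := rfl

/-- The isomorphism class of the type I glueing does not depend on the cuspidal branch. -/
theorem nonempty_glueI_algEquiv (l l' : Fin m) : Nonempty (glueI k l ≃ₐ[k] glueI k l') := by
  let σ := Equiv.swap l' l
  have hσ : σ l' = l := Equiv.swap_apply_left _ _
  refine nonempty_algEquiv_of_forall_mem_iff (permuteBranches k σ) fun f => ?_
  rw [mem_glueI, mem_glueI]
  change _ ↔ (∀ i, coeff 0 (f (σ i)) = coeff 0 (f (σ l'))) ∧ coeff 1 (f (σ l')) = 0 ∧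
    coeff 3 (f (σ l')) = ∑ i ∈ Finset.univ.erase l', coeff 1 (f (σ i))
  rw [Finset.sum_erase_eq_sub (Finset.mem_univ _), Finset.sum_erase_eq_sub (Finset.mem_univ _),
    Equiv.sum_comp σ (fun i => coeff 1 (f i)), hσ, σ.surjective.forall]

/-- The isomorphism class of the type II glueing does not depend on the tangent branches. -/
theorem nonempty_glueII_algEquiv {p l p' l' : Fin m} (hpl : p ≠ l) (hpl' : p' ≠ l') :
    Nonempty (glueII k p l ≃ₐ[k] glueII k p' l') := by
  let σ : Equiv.Perm (Fin m) := (Equiv.swap l' l).trans (Equiv.swap (Equiv.swap l' l p') p)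
  have hne : Equiv.swap l' l p' ≠ l := fun h => hpl' (by
    have := congrArg (Equiv.swap l' l) h
    rwa [Equiv.swap_apply_self, Equiv.swap_apply_right] at this)
  have hσl : σ l' = l := by
    simp only [σ, Equiv.trans_apply, Equiv.swap_apply_left]
    exact Equiv.swap_apply_of_ne_of_ne hne.symm hpl.symm
  have hσp : σ p' = p := by
    simp only [σ, Equiv.trans_apply, Equiv.swap_apply_left]
  refine nonempty_algEquiv_of_forall_mem_iff (permuteBranches k σ) fun f => ?_
  rw [mem_glueII, mem_glueII]
  change _ ↔ (∀ i, coeff 0 (f (σ i)) = coeff 0 (f (σ l'))) ∧ coeff 1 (f (σ l')) =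
    coeff 1 (f (σ p')) ∧ coeff 2 (f (σ l')) = coeff 2 (f (σ p')) +
      ∑ i ∈ (Finset.univ.erase l').erase p', coeff 1 (f (σ i))
  rw [Finset.sum_erase_eq_sub (by simp [hpl]), Finset.sum_erase_eq_sub (Finset.mem_univ _),
    Finset.sum_erase_eq_sub (by simp [hpl']), Finset.sum_erase_eq_sub (Finset.mem_univ _),
    Equiv.sum_comp σ (fun i => coeff 1 (f i)), hσl, hσp, σ.surjective.forall]

/-- Automorphisms of `k⟦t_1⟧ × ⋯ × k⟦t_m⟧` with prescribed action on the leading coefficients. -/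
theorem exists_algEquiv_pi_coeff (u γ : Fin m → k) (hu : ∀ i, u i ≠ 0) :
    ∃ Φ : (Fin m → k⟦X⟧) ≃ₐ[k] (Fin m → k⟦X⟧), ∀ f i, coeff 0 (Φ f i) = coeff 0 (f i) ∧
      coeff 1 (Φ f i) = u i * coeff 1 (f i) ∧
      coeff 2 (Φ f i) = u i ^ 2 * coeff 2 (f i) + γ i * coeff 1 (f i) ∧
      coeff 3 (Φ f i) = u i ^ 3 * coeff 3 (f i) + 2 * u i * γ i * coeff 2 (f i) := by
  choose ψ hψ using fun i => PowerSeries.exists_algEquiv_coeff (u i) (γ i) (hu i)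
  exact ⟨AlgEquiv.piCongrRight ψ, fun f i => hψ i (f i)⟩

end

end

/-! ### Normal forms and classification. -/

section

open PowerSeries

section

variable {k : Type*} [Field k] {m : ℕ}

/-- The subalgebra `S` is cut out by values at the origin and two functionals. -/
def IsCutOutBy (S : Subalgebra k (Fin m → k⟦X⟧)) (a b c e : Fin m → k) : Prop :=
  ∀ f, f ∈ S ↔ (∀ i j, coeff 0 (f i) = coeff 0 (f j)) ∧ a ⬝ᵥ (fun i => coeff 1 (f i)) = 0 ∧
    b ⬝ᵥ (fun i => coeff 3 (f i)) + c ⬝ᵥ (fun i => coeff 2 (f i)) +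
      e ⬝ᵥ (fun i => coeff 1 (f i)) = 0

lemma coeff_comp_single (n : ℕ) (i : Fin m) (g : k⟦X⟧) :
    (fun j => coeff n ((Pi.single i g : Fin m → k⟦X⟧) j)) = Pi.single i (coeff n g) :=
  funext fun j => Pi.apply_single (fun _ => (coeff n : k⟦X⟧ →ₗ[k] k)) (fun _ => map_zero _) i g j

variable {S : Subalgebra k (Fin m → k⟦X⟧)} {a b c e : Fin m → k}

/-- Every admissible triple is the jet of a polynomial element of `S` without constant term. A
product of two such elements starts with `v * v'` in order two and `v * w' + w * v'` in order three.
-/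
lemma IsCutOutBy.isMulClosedJet (h : IsCutOutBy S a b c e) : IsMulClosedJet a b c e := by
  intro v w z v' w' z' h1 h2 h3 h4
  let J : (Fin m → k) → (Fin m → k) → (Fin m → k) → Fin m → k⟦X⟧ :=
    fun v w z i => C (v i) * X + C (w i) * X ^ 2 + C (z i) * X ^ 3
  have c0 : ∀ v w z i, coeff 0 (J v w z i) = 0 := fun v w z i => by simp [J]
  have c1 : ∀ v w z i, coeff 1 (J v w z i) = v i := fun v w z i => by simp [J, coeff_X_pow]
  have c2 : ∀ v w z i, coeff 2 (J v w z i) = w i := fun v w z i => by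
    simp [J, coeff_X_pow]
  have c3 : ∀ v w z i, coeff 3 (J v w z i) = z i := fun v w z i => by
    simp [J, coeff_X_pow]
  have hJ : ∀ v w z, a ⬝ᵥ v = 0 → b ⬝ᵥ z + c ⬝ᵥ w + e ⬝ᵥ v = 0 → J v w z ∈ S := by
    intro v w z h1 h2
    rw [h]
    simp only [c0, c1, c2, c3]
    exact ⟨fun _ _ => trivial, h1, h2⟩
  have h5 := ((h _).mp (mul_mem (hJ v w z h1 h2) (hJ v' w' z' h3 h4))).2.2
  simp only [Pi.mul_apply, coeff_one_mul_eq, coeff_two_mul_eq, coeff_three_mul_eq, c0, c1, c2, c3,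
    zero_mul, mul_zero, zero_add, add_zero] at h5
  have h6 : e ⬝ᵥ (fun _ : Fin m => (0 : k)) = 0 := dotProduct_zero e
  rw [h6, add_zero] at h5
  exact h5

/-- In a Gorenstein glueing of type I shape, all coefficients of the second functional away from
the cuspidal branch are nonzero. -/
lemma IsCutOutBy.ne_zero_of_simple_socle_I (h : IsCutOutBy S a b c e) (hsoc : HasSimpleSocle S)
    {l : Fin m} (hbl : b l ≠ 0)
    (hj : ∀ j, j ≠ l → a j = 0 ∧ b j = 0 ∧ c j = 0) {i : Fin m} (hi : i ≠ l) : e i ≠ 0 := by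
  intro hei
  have ha' := dotProduct_eq_of_support fun j hjl => (hj j hjl).1
  have hb' := dotProduct_eq_of_support fun j hjl => (hj j hjl).2.1
  have hc' := dotProduct_eq_of_support fun j hjl => (hj j hjl).2.2
  -- If `e i = 0`, neither functional sees branch `i`, so its idempotent multiplies the maximal
  -- ideal into `S`. So does `X ^ 3` on `l`, and the two are independent modulo `S`.
  have hq₁ : ∀ f ∈ S, (∀ j, coeff 0 (f j) = 0) → (Pi.single i 1 : Fin m → k⟦X⟧) * f ∈ S := by
    intro f _ hf
    have h0 : (Pi.single i 1 : Fin m → k⟦X⟧) * f = Pi.single i (f i) := by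
      rw [← Pi.single_mul_left, one_mul]
    rw [h, h0, coeff_comp_single 1, ha', hb', hc', dotProduct_single, hei]
    refine ⟨fun j j' => ?_, ?_, ?_⟩
    · have hz : ∀ j, coeff 0 ((Pi.single i (f i) : Fin m → k⟦X⟧) j) = 0 := by
        intro j
        by_cases hji : j = i
        · subst hji; rw [Pi.single_eq_same, hf]
        · rw [Pi.single_eq_of_ne hji, map_zero]
      rw [hz, hz]
    · simp [Pi.single_eq_of_ne hi.symm]
    · simp [Pi.single_eq_of_ne hi.symm]
  have hq₂ : ∀ f ∈ S, (∀ j, coeff 0 (f j) = 0) → (Pi.single l (X ^ 3) : Fin m → k⟦X⟧) * f ∈ S := by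
    intro f _ hf
    have h0 : (Pi.single l (X ^ 3) : Fin m → k⟦X⟧) * f = Pi.single l (X ^ 3 * f l) := by
      rw [← Pi.single_mul_left]
    have hz : ∀ n, n < 4 → ∀ j, coeff n ((Pi.single l (X ^ 3 * f l) : Fin m → k⟦X⟧) j) = 0 := by
      intro n hn j
      by_cases hjl : j = l
      · subst hjl
        obtain ⟨q, hq⟩ : X ∣ f j := by rw [X_dvd_iff]; simpa using hf j
        rw [Pi.single_eq_same, hq, ← mul_assoc, ← pow_succ]
        exact X_pow_dvd_iff.mp (dvd_mul_right _ q) n hn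
      · rw [Pi.single_eq_of_ne hjl, map_zero]
    rw [h, h0]
    simp only [hz 0 (by norm_num), hz 1 (by norm_num), hz 2 (by norm_num), hz 3 (by norm_num)]
    have h6 : ∀ e : Fin m → k, e ⬝ᵥ (fun _ : Fin m => (0 : k)) = 0 := dotProduct_zero
    simp [h6]
  rcases hsoc _ _ hq₁ hq₂ with h1 | ⟨r, h1⟩
  · have := ((h _).mp h1).1 i l
    simp [Pi.single_eq_of_ne hi.symm] at this
  · have h2 := (h _).mp h1
    have hr : r = 0 := by
      have := h2.1 i l
      simpa [Pi.single_eq_of_ne hi.symm, Pi.single_eq_of_ne hi, smul_eq_C_mul, coeff_X_pow]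
        using this
    rw [hr, zero_smul, sub_zero] at h1
    have h3 := ((h _).mp h1).2.2
    rw [hb', hc', coeff_comp_single 1, dotProduct_single] at h3
    simp [coeff_X_pow, hbl] at h3

/-- In a Gorenstein glueing of type II shape, all coefficients of the second functional away from
the tangent branches are nonzero. -/
lemma IsCutOutBy.ne_zero_of_simple_socle_II (h : IsCutOutBy S a 0 c e) (hsoc : HasSimpleSocle S)
    {l i : Fin m} (hcl : c l ≠ 0) (hi : i ≠ l) (hai : a i = 0) (hci : c i = 0) : e i ≠ 0 := by
  intro hei
  -- The independent pair here is the idempotent of branch `i` and `X ^ 2` on `l`.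
  have hq₁ : ∀ f ∈ S, (∀ j, coeff 0 (f j) = 0) → (Pi.single i 1 : Fin m → k⟦X⟧) * f ∈ S := by
    intro f _ hf
    have h0 : (Pi.single i 1 : Fin m → k⟦X⟧) * f = Pi.single i (f i) := by
      rw [← Pi.single_mul_left, one_mul]
    rw [h, h0, coeff_comp_single 1, coeff_comp_single 2, zero_dotProduct, dotProduct_single,
      dotProduct_single, dotProduct_single, hei, hai, hci]
    refine ⟨fun j j' => ?_, by simp, by simp⟩
    have hz : ∀ j, coeff 0 ((Pi.single i (f i) : Fin m → k⟦X⟧) j) = 0 := by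
      intro j
      by_cases hji : j = i
      · subst hji; rw [Pi.single_eq_same, hf]
      · rw [Pi.single_eq_of_ne hji, map_zero]
    rw [hz, hz]
  have hq₂ : ∀ f ∈ S, (∀ j, coeff 0 (f j) = 0) → (Pi.single l (X ^ 2) : Fin m → k⟦X⟧) * f ∈ S := by
    intro f _ hf
    have h0 : (Pi.single l (X ^ 2) : Fin m → k⟦X⟧) * f = Pi.single l (X ^ 2 * f l) := by
      rw [← Pi.single_mul_left]
    have hz : ∀ n, n < 3 → ∀ j, coeff n ((Pi.single l (X ^ 2 * f l) : Fin m → k⟦X⟧) j) = 0 := by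
      intro n hn j
      by_cases hjl : j = l
      · subst hjl
        obtain ⟨q, hq⟩ : X ∣ f j := by rw [X_dvd_iff]; simpa using hf j
        rw [Pi.single_eq_same, hq, ← mul_assoc, ← pow_succ]
        exact X_pow_dvd_iff.mp (dvd_mul_right _ q) n hn
      · rw [Pi.single_eq_of_ne hjl, map_zero]
    rw [h, h0]
    simp only [hz 0 (by norm_num), hz 1 (by norm_num), hz 2 (by norm_num)]
    have h6 : ∀ e : Fin m → k, e ⬝ᵥ (fun _ : Fin m => (0 : k)) = 0 := dotProduct_zero
    simp [h6]
  rcases hsoc _ _ hq₁ hq₂ with h1 | ⟨r, h1⟩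
  · have := ((h _).mp h1).1 i l
    simp [Pi.single_eq_of_ne hi.symm] at this
  · have h2 := (h _).mp h1
    have hr : r = 0 := by
      have := h2.1 i l
      simpa [Pi.single_eq_of_ne hi.symm, Pi.single_eq_of_ne hi, smul_eq_C_mul, coeff_X_pow]
        using this
    rw [hr, zero_smul, sub_zero] at h1
    have h3 := ((h _).mp h1).2.2
    rw [coeff_comp_single 2, coeff_comp_single 1, zero_dotProduct, dotProduct_single, dotProduct_single] at h3
    simp [coeff_X_pow, hcl] at h3

/-- The second functional of a Gorenstein glueing with `b = 0` is not supported, up to linear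
terms, on a single branch supporting the first one. -/
lemma IsCutOutBy.not_support_singleton (h : IsCutOutBy S a 0 c e) (hsoc : HasSimpleSocle S)
    {l : Fin m} (hal : a l ≠ 0) (hcl : c l ≠ 0) :
    ¬ ∀ j, j ≠ l → a j = 0 ∧ c j = 0 := by
  intro hj
  have ha' := dotProduct_eq_of_support fun j hjl => (hj j hjl).1
  have hc' := dotProduct_eq_of_support fun j hjl => (hj j hjl).2
  -- The maximal ideal would have order at least two on `l`, so `X` and `X ^ 2` on `l` would both
  -- multiply it into `S`, although they are independent modulo `S`.
  have hmemS : ∀ n, 0 < n → ∀ f ∈ S, (∀ j, coeff 0 (f j) = 0) →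
      (Pi.single l (X ^ n) : Fin m → k⟦X⟧) * f ∈ S := by
    intro n hn f hfS hf
    have hf1 : coeff 1 (f l) = 0 := by
      have := ((h f).mp hfS).2.1
      rw [ha'] at this
      exact (mul_eq_zero.mp this).resolve_left hal
    obtain ⟨q, hq⟩ := X_sq_dvd_of_coeff (hf l) hf1
    have h0 : (Pi.single l (X ^ n) : Fin m → k⟦X⟧) * f = Pi.single l (X ^ n * f l) := by
      rw [← Pi.single_mul_left]
    have hz : ∀ r, r < 3 → ∀ j, coeff r ((Pi.single l (X ^ n * f l) : Fin m → k⟦X⟧) j) = 0 := by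
      intro r hr j
      by_cases hjl : j = l
      · subst hjl
        rw [Pi.single_eq_same, hq, ← mul_assoc, ← pow_add]
        exact X_pow_dvd_iff.mp (dvd_mul_right _ q) r (by omega)
      · rw [Pi.single_eq_of_ne hjl, map_zero]
    rw [h, h0]
    simp only [hz 0 (by norm_num), hz 1 (by norm_num), hz 2 (by norm_num)]
    have h6 : ∀ e : Fin m → k, e ⬝ᵥ (fun _ : Fin m => (0 : k)) = 0 := dotProduct_zero
    simp [h6]
  rcases hsoc _ _ (hmemS 1 one_pos) (hmemS 2 two_pos) with h1 | ⟨r, h1⟩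
  · have := ((h _).mp h1).2.1
    rw [ha'] at this
    simp [hal] at this
  · have h2 := (h _).mp h1
    have hr : r = 0 := by
      have := h2.2.1
      rw [ha'] at this
      simpa [coeff_X_pow, hal, smul_eq_C_mul] using this
    rw [hr, zero_smul, sub_zero] at h1
    have h3 := ((h _).mp h1).2.2
    rw [coeff_comp_single 2, coeff_comp_single 1, zero_dotProduct, dotProduct_single, dotProduct_single] at h3
    simp [coeff_X_pow, hcl] at h3

lemma forall_forall_eq_iff {β : Type*} {F : Fin m → β} (l : Fin m) :
    (∀ i j, F i = F j) ↔ ∀ i, F i = F l :=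
  ⟨fun h i => h i l, fun h i j => (h i).trans (h j).symm⟩

/-- The substitution `t ↦ t + γ t ^ 2` on `l` adds `2 γ` times the second coefficient to the third,
so `γ = c l / (2 * b l)` absorbs the term with `c`. Rescaling the other parameters turns their
coefficients in the second functional into those of `glueI`. -/
theorem IsCutOutBy.nonempty_algEquiv_glueI (h : IsCutOutBy S a b c e) (hsoc : HasSimpleSocle S)
    (h2 : (2 : k) ≠ 0) {l : Fin m} (hal : a l ≠ 0) (hbl : b l ≠ 0)
    (hj : ∀ j, j ≠ l → a j = 0 ∧ b j = 0 ∧ c j = 0) : Nonempty (S ≃ₐ[k] glueI k l) := by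
  have he := fun i (hi : i ≠ l) => h.ne_zero_of_simple_socle_I hsoc hbl hj hi
  obtain ⟨Φ, hΦ⟩ := exists_algEquiv_pi_coeff
    (fun i => if i = l then (1 : k) else -(e i / b l)) (fun _ => c l / (2 * b l)) (fun i => by
      by_cases hi : i = l
      · simp [hi]
      · simpa [hi, hbl] using he i hi)
  refine nonempty_algEquiv_of_forall_mem_iff Φ fun f => ?_
  rw [h, mem_glueI, dotProduct_eq_of_support fun j hjl => (hj j hjl).1,
    dotProduct_eq_of_support fun j hjl => (hj j hjl).2.1,
    dotProduct_eq_of_support fun j hjl => (hj j hjl).2.2, forall_forall_eq_iff l]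
  have hsum : ∑ i ∈ Finset.univ.erase l, coeff 1 (Φ f i) =
      -((e ⬝ᵥ fun i => coeff 1 (f i)) - e l * coeff 1 (f l)) / b l := by
    rw [dotProduct, ← Finset.sum_erase_eq_sub (Finset.mem_univ l), neg_div, Finset.sum_div,
      ← Finset.sum_neg_distrib]
    refine Finset.sum_congr rfl fun i hi => ?_
    rw [(hΦ f i).2.1, if_neg (Finset.ne_of_mem_erase hi)]
    ring
  rw [hsum, (hΦ f l).2.1, (hΦ f l).2.2.2]
  simp only [(hΦ f _).1, if_true, mul_eq_zero, hal, false_or, one_ne_zero]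
  refine and_congr_right fun _ => and_congr_right fun h1 => ?_
  rw [h1, mul_zero, sub_zero, eq_div_iff hbl]
  have : (1 ^ 3 * coeff 3 (f l) + 2 * 1 * (c l / (2 * b l)) * coeff 2 (f l)) * b l =
      b l * coeff 3 (f l) + c l * coeff 2 (f l) := by
    field_simp
  rw [this, eq_neg_iff_add_eq_zero]

/-- Scaling by `-a l` and `a p` equates the linear coefficients. By `hrel` the squares of these
scalars are proportional to `c l` and `-c p` with the same factor `r`, so the quadratic terms fit as
well. The terms `γ` on `l` and `p` absorb `e l` and `e p`, and the other branches are rescaled. -/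
theorem IsCutOutBy.nonempty_algEquiv_glueII (h : IsCutOutBy S a 0 c e) (hsoc : HasSimpleSocle S)
    {p l : Fin m} (hpl : p ≠ l) (hal : a l ≠ 0) (hap : a p ≠ 0) (hcl : c l ≠ 0)
    (hrel : c p * a l ^ 2 + c l * a p ^ 2 = 0)
    (hj : ∀ j, j ≠ p → j ≠ l → a j = 0 ∧ c j = 0) : Nonempty (S ≃ₐ[k] glueII k p l) := by
  have he := fun i (hp : i ≠ p) (hl : i ≠ l) =>
    h.ne_zero_of_simple_socle_II hsoc hcl hl (hj i hp hl).1 (hj i hp hl).2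
  set r := a l ^ 2 / c l with hr
  have hr0 : r ≠ 0 := div_ne_zero (pow_ne_zero _ hal) hcl
  obtain ⟨Φ, hΦ⟩ := exists_algEquiv_pi_coeff
    (fun i => if i = l then -a l else if i = p then a p else -(r * e i))
    (fun i => if i = l then r * e l else -(r * e p)) (fun i => by
      by_cases hi : i = l
      · simpa [hi] using hal
      · by_cases hi' : i = p
        · simpa [hi', hpl] using hap
        · simpa [hi, hi', hr0] using he i hi' hi)
  refine nonempty_algEquiv_of_forall_mem_iff Φ fun f => ?_
  rw [h, mem_glueII, dotProduct_eq_of_support_pair hpl fun j hp hl => (hj j hp hl).1,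
    dotProduct_eq_of_support_pair hpl fun j hp hl => (hj j hp hl).2, forall_forall_eq_iff l,
    zero_dotProduct, zero_add]
  have hsum : ∑ i ∈ (Finset.univ.erase l).erase p, coeff 1 (Φ f i) =
      -(r * ((e ⬝ᵥ fun i => coeff 1 (f i)) - e l * coeff 1 (f l) - e p * coeff 1 (f p))) := by
    rw [dotProduct, ← Finset.sum_erase_eq_sub (Finset.mem_univ l),
      ← Finset.sum_erase_eq_sub (by simp [hpl]), Finset.mul_sum, ← Finset.sum_neg_distrib]
    refine Finset.sum_congr rfl fun i hi => ?_
    rw [(hΦ f i).2.1, if_neg (Finset.ne_of_mem_erase (Finset.mem_of_mem_erase hi)),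
      if_neg (Finset.ne_of_mem_erase hi)]
    ring
  rw [hsum, (hΦ f l).2.1, (hΦ f l).2.2.1, (hΦ f p).2.1, (hΦ f p).2.2.1]
  simp only [(hΦ f _).1, if_true, if_neg hpl]
  refine and_congr_right fun _ => and_congr ?_ ?_
  · constructor <;> intro h1 <;> linear_combination -h1
  · have hcp : a p ^ 2 = -(r * c p) := by
      rw [hr]; field_simp; linear_combination hrel
    have hcl' : a l ^ 2 = r * c l := by rw [hr]; field_simp
    have : (-a l) ^ 2 * coeff 2 (f l) + r * e l * coeff 1 (f l) - (a p ^ 2 * coeff 2 (f p) +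
        -(r * e p) * coeff 1 (f p) + -(r * ((e ⬝ᵥ fun i => coeff 1 (f i)) - e l * coeff 1 (f l) -
          e p * coeff 1 (f p)))) = r * (c p * coeff 2 (f p) + c l * coeff 2 (f l) +
          e ⬝ᵥ fun i => coeff 1 (f i)) := by
      rw [neg_sq, hcp, hcl']
      ring
    rw [← sub_eq_zero (a := (-a l) ^ 2 * coeff 2 (f l) + r * e l * coeff 1 (f l)), this, mul_eq_zero]
    simp [hr0]

/-- Classification of Gorenstein curve singularities of genus two. -/
theorem IsGorensteinGenusTwo.nonempty_algEquiv [IsAlgClosed k] (h2 : (2 : k) ≠ 0) (hm : 2 ≤ m)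
    {R : Type*} [CommRing R] [Algebra k R] (h : IsGorensteinGenusTwo k R m) {p l : Fin m}
    (hpl : p ≠ l) : Nonempty (R ≃ₐ[k] glueI k l) ∨ Nonempty (R ≃ₐ[k] glueII k p l) := by
  obtain ⟨S, N, ⟨E⟩, hS, hsoc, hfr⟩ := h.exists_isBranchGlueing (by omega)
  obtain ⟨a, b, c, e, ha, hbc, hcut⟩ := hS.exists_functionals hsoc hfr
  replace hcut : IsCutOutBy S a b c e := hcut
  -- A cubic term in the second functional produces the cuspidal branch of type I; without it two
  -- branches are tangent.
  by_cases hb : b = 0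
  · subst hb
    obtain ⟨l', hal, hcl, hsingle | ⟨p', hpl', hap, hrel, hj⟩⟩ :=
      hcut.isMulClosedJet.exists_support_of_eq_zero ha (hbc rfl)
    · exact absurd hsingle (hcut.not_support_singleton hsoc hal hcl)
    · obtain ⟨E₁⟩ := hcut.nonempty_algEquiv_glueII hsoc hpl' hal hap hcl hrel hj
      obtain ⟨E₂⟩ := nonempty_glueII_algEquiv (k := k) hpl' hpl
      exact Or.inr ⟨(E.trans E₁).trans E₂⟩
  · obtain ⟨l', hal, hbl, hj⟩ := hcut.isMulClosedJet.exists_support_of_ne_zero ha hb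
    obtain ⟨E₁⟩ := hcut.nonempty_algEquiv_glueI hsoc h2 hal hbl hj
    obtain ⟨E₂⟩ := nonempty_glueI_algEquiv (k := k) l' l
    exact Or.inl ⟨(E.trans E₁).trans E₂⟩

end

end

/-! ### Maps from power series rings: kernels of branches and images. -/

section

namespace MvPowerSeries

variable {σ k : Type*} [Fintype σ] [Field k]

/-- A power series is a constant plus a combination of the variables. -/
lemma exists_eq_C_add_sum_X_mul (f : MvPowerSeries σ k) :
    ∃ (c : k) (g : σ → MvPowerSeries σ k), f = algebraMap k _ c + ∑ i, X i * g i := by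
  classical
  -- Each nonconstant monomial is assigned to one variable dividing it, so that no term is counted
  -- twice.
  have hex : ∀ e : σ →₀ ℕ, ∃ o : Option σ, (o = none ↔ e = 0) ∧ ∀ j, o = some j → e j ≠ 0 := by
    intro e
    by_cases he : e = 0
    · exact ⟨none, by simp [he], by simp⟩
    · obtain ⟨i, hi⟩ : ∃ i, e i ≠ 0 := by
        by_contra! h
        exact he (Finsupp.ext h)
      exact ⟨some i, by simp [he], by rintro j ⟨⟩; exact hi⟩
  choose c hc hc' using hex
  let P : σ → MvPowerSeries σ k := fun i e => if c e = some i then coeff e f else 0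
  have hP : ∀ i e, coeff e (P i) = if c e = some i then coeff e f else 0 := fun _ _ => rfl
  have hdvd : ∀ i, X i ∣ P i := by
    intro i
    rw [X_dvd_iff]
    intro e he
    rw [hP, if_neg]
    exact fun h => hc' e i h he
  choose g hg using hdvd
  refine ⟨constantCoeff f, g, ?_⟩
  ext e
  simp_rw [← hg]
  rw [map_add, map_sum, algebraMap_apply, Algebra.algebraMap_self, RingHom.id_apply, coeff_C]
  simp_rw [hP]
  rcases hce : c e with _ | j
  · have he := (hc e).mp hce
    subst he
    simp
  · have he : e ≠ 0 := fun h => by simp [(hc e).mpr h] at hce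
    simp [he]

/-- The elements of the kernel of a parametrised smooth branch are, modulo its equations, multiples
of elements of the kernel by the distinguished variable. -/
lemma exists_eq_mul_of_map_X_eq_mul {α : MvPowerSeries σ k →ₐ[k] k⟦X⟧} {i₀ : σ}
    (hα : α (X i₀) = PowerSeries.X) (r : σ → MvPowerSeries σ k)
    (hr : ∀ i, i ≠ i₀ → α (X i) = PowerSeries.X * α (r i)) {J : Ideal (MvPowerSeries σ k)}
    (hJ : ∀ i, i ≠ i₀ → X i - X i₀ * r i ∈ J) (f : MvPowerSeries σ k) (hf : α f = 0) :
    ∃ g, α g = 0 ∧ f - X i₀ * g ∈ J := by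
  classical
  obtain ⟨c, g, rfl⟩ := exists_eq_C_add_sum_X_mul f
  have hsum : ∑ i, X i * g i = X i₀ * (g i₀ + ∑ i ∈ Finset.univ.erase i₀, r i * g i) +
      ∑ i ∈ Finset.univ.erase i₀, (X i - X i₀ * r i) * g i := by
    rw [← Finset.add_sum_erase _ _ (Finset.mem_univ i₀), mul_add, add_assoc, Finset.mul_sum,
      ← Finset.sum_add_distrib]
    congr 1
    refine Finset.sum_congr rfl fun i _ => ?_
    ring
  have hαsum : α (∑ i ∈ Finset.univ.erase i₀, (X i - X i₀ * r i) * g i) = 0 := by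
    rw [map_sum]
    refine Finset.sum_eq_zero fun i hi => ?_
    rw [map_mul, map_sub, map_mul, hα, hr i (Finset.ne_of_mem_erase hi), sub_self, zero_mul]
  rw [hsum, map_add, map_add, hαsum, map_mul, hα, AlgHom.commutes, add_zero] at hf
  have hc : c = 0 := by
    have := congrArg PowerSeries.constantCoeff hf
    simpa using this
  rw [hc, map_zero, zero_add, mul_eq_zero] at hf
  refine ⟨_, hf.resolve_left PowerSeries.X_ne_zero, ?_⟩
  have h3 : algebraMap k _ c + ∑ i, X i * g i -
      X i₀ * (g i₀ + ∑ i ∈ Finset.univ.erase i₀, r i * g i) =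
      ∑ i ∈ Finset.univ.erase i₀, (X i - X i₀ * r i) * g i := by
    rw [hsum, hc, map_zero, zero_add, add_sub_cancel_left]
  rw [h3]
  exact sum_mem fun i hi => J.mul_mem_right _ (hJ i (Finset.ne_of_mem_erase hi))

/-- Nakayama's lemma for kernels: an ideal is contained in `J` if its elements are, modulo `J`,
multiples of elements of the ideal by nonunits. -/
lemma le_of_forall_exists_sub_mem {K J : Ideal (MvPowerSeries σ k)}
    (h : ∀ f ∈ K, ∃ x g, constantCoeff x = 0 ∧ g ∈ K ∧ f - x * g ∈ J) : K ≤ J := by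
  refine Submodule.le_of_le_smul_of_le_jacobson_bot (I := IsLocalRing.maximalIdeal _)
    (IsNoetherian.noetherian K) (IsLocalRing.maximalIdeal_le_jacobson _) fun f hf => ?_
  obtain ⟨x, g, hx, hg, hfg⟩ := h f hf
  rw [← sub_add_cancel f (x * g)]
  refine add_mem (Submodule.mem_sup_left hfg) (Submodule.mem_sup_right ?_)
  refine Submodule.smul_mem_smul ?_ hg
  rw [IsLocalRing.mem_maximalIdeal, mem_nonunits_iff, isUnit_iff_constantCoeff, hx]
  exact not_isUnit_zero

/-- The kernel of a parametrised smooth branch. -/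
theorem ker_le_of_map_X_eq_mul {α : MvPowerSeries σ k →ₐ[k] k⟦X⟧} {i₀ : σ}
    (hα : α (X i₀) = PowerSeries.X) (r : σ → MvPowerSeries σ k)
    (hr : ∀ i, i ≠ i₀ → α (X i) = PowerSeries.X * α (r i)) {J : Ideal (MvPowerSeries σ k)}
    (hJ : ∀ i, i ≠ i₀ → X i - X i₀ * r i ∈ J) : RingHom.ker α ≤ J := by
  refine le_of_forall_exists_sub_mem fun f hf => ?_
  obtain ⟨g, hg, hfg⟩ := exists_eq_mul_of_map_X_eq_mul hα r hr hJ f hf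
  exact ⟨X i₀, g, by simp, hg, hfg⟩

end MvPowerSeries

open PowerSeries

/-- Even and odd parts, with respect to any parametrisation of `X ^ 2`. -/
lemma PowerSeries.exists_eq_map_add_X_mul_map {k : Type*} [Field k] (h : k⟦X⟧) :
    ∃ A B : k⟦X⟧, ∀ α : k⟦X⟧ →ₐ[k] k⟦X⟧, α X = X ^ 2 → h = α A + X * α B := by
  let E : ℕ → k⟦X⟧ → k⟦X⟧ := fun r h => PowerSeries.mk fun n => coeff (2 * n + r) h
  refine ⟨E 0 h, E 1 h, fun α hα => ?_⟩
  -- The recursion divides by `X ^ 2`, whereas the lemma divides by `X`. The Boolean inserts the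
  -- intermediate stage, in which a factor `X` is kept in front.
  have key := eq_zero_of_forall_exists_eq_X_mul
    (fun p : k⟦X⟧ × Bool => (if p.2 then 1 else X) * (p.1 - α (E 0 p.1) - X * α (E 1 p.1)))
    (fun p => ?_) (h, true)
  · rw [if_pos rfl, one_mul, sub_sub, sub_eq_zero] at key
    exact key
  · obtain ⟨h, b⟩ := p
    rcases b with _ | _
    · exact ⟨(h, true), by simp⟩
    · refine ⟨(PowerSeries.mk fun n => coeff (n + 2) h, false), ?_⟩
      have hE : ∀ r, E r h = algebraMap k _ (coeff r h) +
          X * E r (PowerSeries.mk fun n => coeff (n + 2) h) := by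
        intro r
        ext n
        rcases n with _ | n
        · simp [E]
        · simp only [E, coeff_mk, map_add, coeff_succ_X_mul, algebraMap_apply,
            Algebra.algebraMap_self, RingHom.id_apply, coeff_C, Nat.succ_ne_zero, if_false,
            zero_add]
          rw [show 2 * (n + 1) + r = 2 * n + r + 2 by ring]
      have hh : h = algebraMap k _ (coeff 0 h) + algebraMap k _ (coeff 1 h) * X +
          X ^ 2 * PowerSeries.mk fun n => coeff (n + 2) h := by
        ext n
        rcases n with _ | _ | n <;> simp [coeff_X_pow_mul', coeff_C]
      simp only [if_true, one_mul, Bool.false_eq_true, if_false]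
      rw [hE 0, hE 1, map_add, map_add, map_mul, map_mul, hα, AlgHom.commutes, AlgHom.commutes]
      linear_combination hh

section Range

variable {k : Type*} [Field k] {m n : ℕ}

/-- The homomorphism with prescribed values on the variables. -/
lemma exists_algHom_map_X (x : Fin n → Fin m → k⟦X⟧) (hx : ∀ i j, coeff 0 (x i j) = 0) :
    ∃ φ : MvPowerSeries (Fin n) k →ₐ[k] (Fin m → k⟦X⟧), ∀ i, φ (MvPowerSeries.X i) = x i := by
  have hs : ∀ j, MvPowerSeries.HasSubst (fun i => x i j) := fun j =>
    MvPowerSeries.hasSubst_of_constantCoeff_zero fun i => by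
      have := hx i j
      rw [coeff_zero_eq_constantCoeff_apply] at this
      exact this
  refine ⟨AlgHom.pi fun j => (MvPowerSeries.substAlgHom (hs j) : _ →ₐ[k] k⟦X⟧), fun i => ?_⟩
  funext j
  exact MvPowerSeries.substAlgHom_X (hs j) i

/-- No continuity of `φ` is assumed. Expanding `f` repeatedly as a constant plus multiples of the
variables shows that `φ f` agrees with an element of `S` to any order, and order `N` suffices. -/
lemma algHom_mem_of_forall_map_X_mem {S : Subalgebra k (Fin m → k⟦X⟧)} {N : ℕ}
    (hN : radicalPow k m N ⊆ S) (φ : MvPowerSeries (Fin n) k →ₐ[k] (Fin m → k⟦X⟧))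
    (hφ : ∀ i, φ (MvPowerSeries.X i) ∈ S) (hφ0 : ∀ i, φ (MvPowerSeries.X i) ∈ radicalPow k m 1)
    (f : MvPowerSeries (Fin n) k) : φ f ∈ S := by
  have key : ∀ M f, ∃ s ∈ S, φ f - s ∈ radicalPow k m M := by
    intro M
    induction M with
    | zero => exact fun f => ⟨0, zero_mem _, fun j => by simp⟩
    | succ M ih =>
      intro f
      obtain ⟨c, g, rfl⟩ := MvPowerSeries.exists_eq_C_add_sum_X_mul f
      choose s hs hs' using ih
      refine ⟨algebraMap k _ c +
        ∑ i, φ (MvPowerSeries.X i) * s (g i), add_mem (S.algebraMap_mem _)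
        (sum_mem fun i _ => mul_mem (hφ i) (hs _)), ?_⟩
      rw [map_add, map_sum, AlgHom.commutes, add_sub_add_left_eq_sub, ← Finset.sum_sub_distrib]
      simp_rw [map_mul, ← mul_sub]
      refine (radicalPowSubmodule k m (M + 1)).sum_mem fun i _ => ?_
      rw [add_comm M 1]
      exact mul_mem_radicalPow (hφ0 i) (hs' _)
  obtain ⟨s, hs, h⟩ := key N f
  simpa using add_mem (hN h) hs

/-- A subalgebra containing a power of the radical is the image of a power series ring as soon as
the polynomials in the given elements contain enough monomials. -/
theorem exists_algHom_range_eq {S : Subalgebra k (Fin m → k⟦X⟧)} {N : ℕ}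
    (hN : radicalPow k m N ⊆ S) (x : Fin n → Fin m → k⟦X⟧) (hx : ∀ i j, coeff 0 (x i j) = 0)
    (hxS : ∀ i, x i ∈ S) (hS : S ≤ Algebra.adjoin k (Set.range x ∪ radicalPow k m N))
    (hζ : (fun _ => X ^ 2 : Fin m → k⟦X⟧) ∈ Algebra.adjoin k (Set.range x))
    (hN₀ : ∀ i, (Pi.single i (X ^ N) : Fin m → k⟦X⟧) ∈ Algebra.adjoin k (Set.range x))
    (hN₁ : ∀ i, (Pi.single i (X ^ (N + 1)) : Fin m → k⟦X⟧) ∈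
      Algebra.adjoin k (Set.range x)) :
    ∃ φ : MvPowerSeries (Fin n) k →ₐ[k] (Fin m → k⟦X⟧),
      (∀ i, φ (MvPowerSeries.X i) = x i) ∧ φ.range = S := by
  obtain ⟨φ, hφ⟩ := exists_algHom_map_X x hx
  have hadj : Algebra.adjoin k (Set.range x) ≤ φ.range := by
    rw [Algebra.adjoin_le_iff]
    rintro _ ⟨i, rfl⟩
    exact ⟨_, hφ i⟩
  refine ⟨φ, hφ, le_antisymm ?_ (hS.trans (Algebra.adjoin_le ?_))⟩
  · rintro _ ⟨f, rfl⟩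
    refine algHom_mem_of_forall_map_X_mem hN φ (fun i => by rw [hφ]; exact hxS i) (fun i j => ?_) f
    rw [hφ, pow_one, X_dvd_iff]
    simpa using hx i j
  · refine Set.union_subset ((Algebra.subset_adjoin).trans hadj) fun f hf => ?_
    obtain ⟨ζ, hζ'⟩ := hadj hζ
    replace hζ' : φ ζ = fun _ => X ^ 2 := hζ'
    rw [SetLike.mem_coe, ← Finset.univ_sum_single f]
    refine sum_mem fun i _ => ?_
    -- Needed in order to substitute `ζ` into power series in one variable.
    have hζ0 : MvPowerSeries.constantCoeff ζ = 0 := by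
      obtain ⟨c, g, rfl⟩ := MvPowerSeries.exists_eq_C_add_sum_X_mul ζ
      have h1 := congrArg (fun y => coeff 0 (y i)) hζ'
      simp only [map_add, map_sum, AlgHom.commutes, Pi.add_apply, Finset.sum_apply, map_mul, hφ,
        Pi.mul_apply, coeff_zero_mul_eq, hx, zero_mul, Finset.sum_const_zero, add_zero] at h1
      have h2 : coeff 0 ((algebraMap k (Fin m → k⟦X⟧) c) i) = c := by
        change coeff 0 (C c) = c
        simp
      rw [h2] at h1
      simp [h1]
    have hsub : PowerSeries.HasSubst ζ := PowerSeries.HasSubst.of_constantCoeff_zero hζ0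
    let α : k⟦X⟧ →ₐ[k] (Fin m → k⟦X⟧) := φ.comp (PowerSeries.substAlgHom hsub)
    obtain ⟨h, hh⟩ := hf i
    obtain ⟨A, B, hAB⟩ := PowerSeries.exists_eq_map_add_X_mul_map h
    have h3 := hAB ((Pi.evalAlgHom k (fun _ : Fin m => k⟦X⟧) i).comp α) (by
      change φ (PowerSeries.substAlgHom hsub X) i = _
      rw [PowerSeries.substAlgHom_X, hζ'])
    -- Series in `X ^ 2` are available on all branches through `ζ`. So the two monomials `X ^ N` and
    -- `X ^ (N + 1)` on branch `i` yield everything of order at least `N` there, as even and odd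
    -- parts.
    have h4 : (Pi.single i (f i) : Fin m → k⟦X⟧) =
        Pi.single i (X ^ N) * α A + Pi.single i (X ^ (N + 1)) * α B := by
      rw [← Pi.single_mul_left, ← Pi.single_mul_left, ← Pi.single_add, hh]
      congr 1
      conv_lhs => rw [h3]
      change X ^ N * (α A i + X * α B i) = _
      ring
    rw [h4]
    exact add_mem (mul_mem (hadj (hN₀ i)) ⟨_, rfl⟩) (mul_mem (hadj (hN₁ i)) ⟨_, rfl⟩)

end Range

end

/-! ### Type I: image and kernel of the parametrisation. -/

section

open PowerSeries

section

variable {k : Type*} [Field k] {m : ℕ}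

lemma single_mul_single_self (i : Fin m) (a b : k⟦X⟧) :
    (Pi.single i a * Pi.single i b : Fin m → k⟦X⟧) = Pi.single i (a * b) :=
  (Pi.single_mul (α := fun _ : Fin m => k⟦X⟧) i a b).symm

lemma single_mul_single_of_ne {i j : Fin m} (h : i ≠ j) (a b : k⟦X⟧) :
    (Pi.single i a * Pi.single j b : Fin m → k⟦X⟧) = 0 := by
  funext n
  by_cases hn : n = i
  · subst hn; simp [Pi.single_eq_of_ne h]
  · simp [Pi.single_eq_of_ne hn]

lemma single_pow (i : Fin m) (a : k⟦X⟧) {n : ℕ} (hn : n ≠ 0) :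
    (Pi.single i a : Fin m → k⟦X⟧) ^ n = Pi.single i (a ^ n) := by
  funext j
  by_cases hj : j = i
  · subst hj; simp
  · simp [Pi.single_eq_of_ne hj, hn]

lemma tangentCoord_mul_single {l i : Fin m} (h : i ≠ l) (n : ℕ) (a : k⟦X⟧) :
    tangentCoord k l i n * Pi.single l a = Pi.single l (X ^ n * a) := by
  rw [tangentCoord, add_mul, single_mul_single_of_ne h, zero_add, single_mul_single_self]

lemma tangentCoord_mul_tangentCoord {l i j : Fin m} (hi : i ≠ l) (hj : j ≠ l) (hij : i ≠ j)
    (n r : ℕ) : tangentCoord k l i n * tangentCoord k l j r = Pi.single l (X ^ (n + r)) := by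
  rw [tangentCoord, tangentCoord, add_mul, mul_add, mul_add, single_mul_single_of_ne hij,
    single_mul_single_of_ne hi, single_mul_single_of_ne hj.symm, single_mul_single_self, pow_add]
  simp

lemma tangentCoord_sq {l i : Fin m} (h : i ≠ l) (n : ℕ) :
    tangentCoord k l i n ^ 2 = Pi.single i (X ^ 2) + Pi.single l (X ^ (2 * n)) := by
  rw [tangentCoord, sq, add_mul, mul_add, mul_add, single_mul_single_of_ne h,
    single_mul_single_of_ne h.symm, single_mul_single_self, single_mul_single_self, sq, two_mul,
    pow_add]
  simp

/-- The type I singularity is the image of a power series ring. -/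
theorem exists_algHom_range_eq_typeI {l : Fin m} (hl : l.val + 1 = m) (hm : 2 ≤ m) :
    ∃ φ : MvPowerSeries (Fin m) k →ₐ[k] (Fin m → k⟦X⟧),
      (∀ i, φ (MvPowerSeries.X i) = paramI k m i) ∧ φ.range = typeI k m := by
  have hz := paramI_last (k := k) hl
  have hτ := fun i (h : i ≠ l) => paramI_of_ne (k := k) hl h
  obtain ⟨i₀, hi₀⟩ : ∃ i : Fin m, i ≠ l := by
    have : Nontrivial (Fin m) := Fin.nontrivial_iff_two_le.mpr hm
    exact exists_ne l
  set A := Algebra.adjoin k (Set.range (paramI k m)) with hA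
  have hmem : ∀ i, paramI k m i ∈ A := fun i => Algebra.subset_adjoin ⟨i, rfl⟩
  have hzA : (Pi.single l (X ^ 2) : Fin m → k⟦X⟧) ∈ A := hz ▸ hmem l
  have hτA : ∀ i, i ≠ l → tangentCoord k l i 3 ∈ A := fun i h => hτ i h ▸ hmem i
  -- For `i ≠ l`, the square of `t_i ⊕ t_l ^ 3` exceeds `t_i ^ 2` by `t_l ^ 6`, the cube of the last
  -- coordinate.
  have hw : ∀ i, (Pi.single i (X ^ 2) : Fin m → k⟦X⟧) ∈ A := by
    intro i
    by_cases hi : i = l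
    · rw [hi]; exact hzA
    · have h1 := sub_mem (pow_mem (hτA i hi) 2) (pow_mem hzA 3)
      rwa [tangentCoord_sq hi, single_pow _ _ three_ne_zero, ← pow_mul, add_sub_cancel_right] at h1
  refine exists_algHom_range_eq (N := 4) (fun f hf => Algebra.subset_adjoin (Or.inr hf)) _ ?_
    (fun i => Algebra.subset_adjoin (Or.inl ⟨i, rfl⟩)) le_rfl ?_ ?_ ?_
  · intro i j
    by_cases hi : i = l
    · rw [hi, hz]
      by_cases hj : j = l
      · subst hj; simp
      · simp [Pi.single_eq_of_ne hj]
    · rw [hτ i hi]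
      exact coeff_zero_tangentCoord hi three_ne_zero j
  · have h1 : (fun _ => X ^ 2 : Fin m → k⟦X⟧) = ∑ i, Pi.single i (X ^ 2) :=
      (Finset.univ_sum_single _).symm
    rw [h1]
    exact sum_mem fun i _ => hw i
  · intro i
    have h1 := pow_mem (hw i) 2
    rwa [single_pow _ _ two_ne_zero, ← pow_mul] at h1
  · intro i
    by_cases hi : i = l
    · subst hi
      have h1 := mul_mem (hτA i₀ hi₀) (hw i)
      rwa [tangentCoord_mul_single hi₀, ← pow_add] at h1
    · have h1 := mul_mem (pow_mem (hw i) 2) (hτA i hi)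
      rw [single_pow _ _ two_ne_zero, tangentCoord, mul_add, single_mul_single_of_ne hi,
        single_mul_single_self, ← pow_mul, ← pow_succ, add_zero] at h1
      exact h1

variable (k) in
/-- The equations which hold on, and suffice to define, the type I singularity. -/
structure IsTypeIIdeal (l : Fin m) (J : Ideal (MvPowerSeries (Fin m) k)) : Prop where
  last_mul_sub_mem : ∀ i j, i ≠ l → j ≠ l →
    MvPowerSeries.X l * (MvPowerSeries.X i - MvPowerSeries.X j) ∈ J
  mul_sub_mem : ∀ i j, i ≠ l → j ≠ l → i ≠ j →
    MvPowerSeries.X i * MvPowerSeries.X j - MvPowerSeries.X l ^ 3 ∈ J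
  last_mul_sq_sub_mem : ∀ i, i ≠ l →
    MvPowerSeries.X l * (MvPowerSeries.X i ^ 2 - MvPowerSeries.X l ^ 3) ∈ J

/-- The ideal of the type I singularity. -/
theorem IsTypeIIdeal.ker_le {l : Fin m} (hl : l.val + 1 = m) (hm : 2 ≤ m)
    {J : Ideal (MvPowerSeries (Fin m) k)} (hJ : IsTypeIIdeal k l J)
    {φ : MvPowerSeries (Fin m) k →ₐ[k] (Fin m → k⟦X⟧)}
    (hφ : ∀ i, φ (MvPowerSeries.X i) = paramI k m i) (hJφ : J ≤ RingHom.ker φ) :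
    RingHom.ker φ ≤ J := by
  obtain ⟨i₀, hi₀⟩ : ∃ i : Fin m, i ≠ l := by
    have : Nontrivial (Fin m) := Fin.nontrivial_iff_two_le.mpr hm
    exact exists_ne l
  let x : Fin m → MvPowerSeries (Fin m) k := MvPowerSeries.X
  let β : Fin m → MvPowerSeries (Fin m) k →ₐ[k] k⟦X⟧ :=
    fun j => (Pi.evalAlgHom k (fun _ : Fin m => k⟦X⟧) j).comp φ
  have hβ : ∀ j f, β j f = φ f j := fun _ _ => rfl
  have hβl : β l (x l) = X ^ 2 := by rw [hβ, hφ, paramI_last hl, Pi.single_eq_same]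
  have hβil : ∀ i, i ≠ l → β l (x i) = X ^ 3 := fun i hi => by
    rw [hβ, hφ, paramI_of_ne hl hi, tangentCoord_last hi]
  have hβii : ∀ i, i ≠ l → β i (x i) = X := fun i hi => by
    rw [hβ, hφ, paramI_of_ne hl hi, tangentCoord_self hi]
  have hβij : ∀ i j, i ≠ l → j ≠ i → β i (x j) = 0 := fun i j hi hj => by
    rw [hβ, hφ]
    by_cases hjl : j = l
    · rw [hjl, paramI_last hl, Pi.single_eq_of_ne hi]
    · rw [paramI_of_ne hl hjl, tangentCoord_of_ne hj.symm hi]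
  have hβJ : ∀ j, ∀ f ∈ J, β j f = 0 := fun j f hf => congrFun (hJφ hf) j
  -- The colon ideal `(J : x l)`. Modulo it the variables other than `x l` coincide, leaving the
  -- cusp `(t ^ 2, t ^ 3)`.
  let L : Ideal (MvPowerSeries (Fin m) k) := Submodule.comap (LinearMap.mulLeft _ (x l)) J
  have hL : ∀ f, f ∈ L ↔ x l * f ∈ J := fun _ => Iff.rfl
  have hβL : ∀ f ∈ L, β l f = 0 := fun f hf => by
    have := hβJ l _ ((hL f).mp hf)
    rw [map_mul, hβl] at this
    exact (mul_eq_zero.mp this).resolve_left (pow_ne_zero _ X_ne_zero)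
  have hdec : ∀ f, ∃ (c : k) (a b : MvPowerSeries (Fin m) k),
      f - (algebraMap k _ c + x i₀ * a + x l * b) ∈ L := by
    intro f
    obtain ⟨c, g, rfl⟩ := MvPowerSeries.exists_eq_C_add_sum_X_mul f
    refine ⟨c, ∑ i ∈ Finset.univ.erase l, g i, g l, ?_⟩
    rw [← Finset.add_sum_erase _ _ (Finset.mem_univ l)]
    have : algebraMap k _ c + (MvPowerSeries.X l * g l +
        ∑ i ∈ Finset.univ.erase l, MvPowerSeries.X i * g i) -
        (algebraMap k _ c + x i₀ * ∑ i ∈ Finset.univ.erase l, g i + x l * g l) =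
        ∑ i ∈ Finset.univ.erase l, (x i - x i₀) * g i := by
      simp only [sub_mul, Finset.sum_sub_distrib, Finset.mul_sum, x]
      ring
    rw [this]
    exact sum_mem fun i hi => L.mul_mem_right _
      (hJ.last_mul_sub_mem i i₀ (Finset.ne_of_mem_erase hi) hi₀)
  -- After two expansions `f` is, modulo `L`, `c + c₂ x l + c₁ x i₀` plus quadratic terms. The
  -- orders 0, 2, 3 on the cusp separate the three scalars, which vanish. As `x i₀ ^ 2` is `x l ^ 3`
  -- modulo `L`, the rest is divisible by `x l`, and Nakayama's lemma applies.
  have hker : RingHom.ker (β l) ≤ L := by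
    refine MvPowerSeries.le_of_forall_exists_sub_mem fun f hf => ?_
    obtain ⟨c, g, h, hf'⟩ := hdec f
    obtain ⟨c₁, g₁, g₂, hg⟩ := hdec g
    obtain ⟨c₂, h₁, h₂, hh⟩ := hdec h
    have e1 := hβL _ hf'
    have e2 := hβL _ hg
    have e3 := hβL _ hh
    rw [RingHom.mem_ker] at hf
    simp only [map_sub, map_add, map_mul, hβl, hβil i₀ hi₀, AlgHom.commutes] at e1 e2 e3
    change β l f = 0 at hf
    rw [hf] at e1
    have e4 : algebraMap k k⟦X⟧ c + algebraMap k k⟦X⟧ c₂ * X ^ 2 + algebraMap k k⟦X⟧ c₁ * X ^ 3 +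
        X ^ 4 * (X ^ 2 * β l g₁ + X * β l g₂ + X * β l h₁ + β l h₂) = 0 := by
      linear_combination -e1 - X ^ 3 * e2 - X ^ 2 * e3
    have hc : c = 0 := by
      have := congrArg (coeff 0) e4
      simpa [coeff_X_pow_mul', coeff_X_pow, coeff_C] using this
    have hc₂ : c₂ = 0 := by
      have := congrArg (coeff 2) e4
      simpa [coeff_X_pow_mul', coeff_X_pow, coeff_C] using this
    have hc₁ : c₁ = 0 := by
      have := congrArg (coeff 3) e4
      simpa [coeff_X_pow_mul', coeff_X_pow, coeff_C] using this
    rw [hc, hc₁, hc₂] at e4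
    rw [hc, map_zero, zero_add] at hf'
    rw [hc₁, map_zero, zero_add] at hg
    rw [hc₂, map_zero, zero_add] at hh
    refine ⟨x l, x l ^ 2 * g₁ + x i₀ * g₂ + x i₀ * h₁ + x l * h₂, by simp [x], ?_, ?_⟩
    · rw [RingHom.mem_ker]
      change β l _ = 0
      simp only [map_add, map_mul, map_pow, hβl, hβil i₀ hi₀]
      refine (mul_eq_zero.mp (?_ : X ^ 2 * _ = (0 : k⟦X⟧))).resolve_left
        (pow_ne_zero 2 X_ne_zero)
      simp only [map_zero, zero_mul, zero_add] at e4
      linear_combination e4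
    · have h5 := hJ.last_mul_sq_sub_mem i₀ hi₀
      have h6 : f - x l * (x l ^ 2 * g₁ + x i₀ * g₂ + x i₀ * h₁ + x l * h₂) =
          (f - (x i₀ * g + x l * h)) + x i₀ * (g - (x i₀ * g₁ + x l * g₂)) +
          x l * (h - (x i₀ * h₁ + x l * h₂)) + (x i₀ ^ 2 - x l ^ 3) * g₁ := by ring
      rw [h6]
      exact add_mem (add_mem (add_mem hf' (L.mul_mem_left _ hg)) (L.mul_mem_left _ hh))
        (L.mul_mem_right _ h5)
  intro f hf
  have hfβ : ∀ j, β j f = 0 := fun j => congrFun hf j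
  -- Modulo `Q` products of different variables vanish, so vanishing on each smooth branch already
  -- gives membership.
  let Q : Ideal (MvPowerSeries (Fin m) k) := J ⊔ Ideal.span {x l}
  have hzQ : x l ∈ Q := Submodule.mem_sup_right (Ideal.mem_span_singleton_self _)
  have hfQ : f ∈ Q := by
    obtain ⟨c, g, rfl⟩ := MvPowerSeries.exists_eq_C_add_sum_X_mul f
    have hfi : ∀ i, i ≠ l → algebraMap k k⟦X⟧ c + X * β i (g i) = 0 := by
      intro i hi
      have h1 := hfβ i
      rw [map_add, AlgHom.commutes, map_sum, Finset.sum_eq_single i] at h1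
      · rwa [map_mul, hβii i hi] at h1
      · intro j _ hj
        rw [map_mul, hβij i j hi hj, zero_mul]
      · simp
    have hc : c = 0 := by
      have := congrArg constantCoeff (hfi i₀ hi₀)
      simpa using this
    rw [hc, map_zero, zero_add]
    refine sum_mem fun i _ => ?_
    by_cases hi : i = l
    · rw [hi]; exact Q.mul_mem_right _ hzQ
    · have h1 := hfi i hi
      rw [hc, map_zero, zero_add] at h1
      have h2 : g i ∈ RingHom.ker (β i) := (mul_eq_zero.mp h1).resolve_left X_ne_zero
      refine MvPowerSeries.ker_le_of_map_X_eq_mul (hβii i hi) (fun _ => 0)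
        (fun j hj => by rw [map_zero, mul_zero]; exact hβij i j hi hj)
        (J := Submodule.comap (LinearMap.mulLeft _ (x i)) Q) (fun j hj => ?_) h2
      change x i * (x j - x i * 0) ∈ Q
      rw [mul_zero, sub_zero]
      by_cases hjl : j = l
      · rw [hjl]; exact Q.mul_mem_left _ hzQ
      · rw [← sub_add_cancel (x i * x j) (x l ^ 3)]
        exact add_mem (Submodule.mem_sup_left (hJ.mul_sub_mem i j hi hjl hj.symm))
          (Q.pow_mem_of_mem hzQ 3 (by norm_num))
  obtain ⟨u, hu, v, hv, rfl⟩ := Submodule.mem_sup.mp hfQ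
  obtain ⟨w, rfl⟩ := Ideal.mem_span_singleton'.mp hv
  refine add_mem hu ?_
  have h1 := hfβ l
  rw [map_add, hβJ l u hu, zero_add, map_mul, hβl] at h1
  have h2 : w ∈ RingHom.ker (β l) :=
    (mul_eq_zero.mp h1).resolve_right (pow_ne_zero _ X_ne_zero)
  rw [mul_comm]
  exact hker h2

end

end

/-! ### Type II: image and kernel of the parametrisation. -/

section

open PowerSeries

section

variable {k : Type*} [Field k] {m : ℕ}

lemma tangentCoord_one_pow_mul_single {l i : Fin m} (h : i ≠ l) (n : ℕ) (a : k⟦X⟧) :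
    tangentCoord k l i 1 ^ n * Pi.single l a = Pi.single l (X ^ n * a) := by
  induction n with
  | zero => simp
  | succ n ih => rw [pow_succ', mul_assoc, ih, tangentCoord_mul_single h, pow_one, ← mul_assoc,
      pow_succ']

/-- The type II singularity is the image of a power series ring. -/
theorem exists_algHom_range_eq_typeII {l : Fin m} (hl : l.val + 1 = m) (hm : 3 ≤ m) :
    ∃ φ : MvPowerSeries (Fin (m - 1)) k →ₐ[k] (Fin m → k⟦X⟧),
      (∀ i, φ (MvPowerSeries.X i) = paramII k m i) ∧ φ.range = typeII k m := by
  set o : Fin m := ⟨0, by omega⟩ with ho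
  set o₁ : Fin m := ⟨1, by omega⟩ with ho₁
  have hol : o ≠ l := fun h => by have := congrArg Fin.val h; simp [ho] at this; omega
  have ho₁l : o₁ ≠ l := fun h => by have := congrArg Fin.val h; simp [ho₁] at this; omega
  have hoo₁ : o ≠ o₁ := fun h => by have := congrArg Fin.val h; simp [ho, ho₁] at this
  set A := Algebra.adjoin k (Set.range (paramII k m)) with hA
  have hmem : ∀ i, paramII k m i ∈ A := fun i => Algebra.subset_adjoin ⟨i, rfl⟩
  have hoA : tangentCoord k l o 1 ∈ A := by
    have := hmem ⟨0, by omega⟩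
    rwa [paramII_eq hl (i' := o) rfl, if_pos rfl] at this
  have hτA : ∀ i : Fin m, i ≠ o → i ≠ l → tangentCoord k l i 2 ∈ A := by
    intro i hio hil
    have hi0 : i.val ≠ 0 := fun h => hio (Fin.ext h)
    have hil' : i.val ≠ l.val := fun h => hil (Fin.ext h)
    have := hmem ⟨i.val, by omega⟩
    rwa [paramII_eq hl (i' := i) rfl, if_neg hi0] at this
  -- A product of two different coordinates lives on `l` alone; this separates `l` from the other
  -- branches.
  have hl3 : (Pi.single l (X ^ 3) : Fin m → k⟦X⟧) ∈ A := by
    have := mul_mem hoA (hτA o₁ hoo₁.symm ho₁l)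
    rwa [tangentCoord_mul_tangentCoord hol ho₁l hoo₁] at this
  have hl4 : (Pi.single l (X ^ 4) : Fin m → k⟦X⟧) ∈ A := by
    have := mul_mem hoA hl3
    rwa [tangentCoord_mul_single hol, ← pow_add] at this
  have hw : ∀ i, i ≠ o → i ≠ l → (Pi.single i (X ^ 2) : Fin m → k⟦X⟧) ∈ A := by
    intro i hio hil
    have h1 := sub_mem (pow_mem (hτA i hio hil) 2) hl4
    rwa [tangentCoord_sq hil, add_sub_cancel_right] at h1
  have hpow : ∀ n, n ≠ 0 → tangentCoord k l o 1 ^ n =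
      Pi.single o (X ^ n) + Pi.single l (X ^ n) := by
    intro n hn
    funext j
    by_cases hjo : j = o
    · subst hjo; simp [tangentCoord_self hol, Pi.single_eq_of_ne hol]
    by_cases hjl : j = l
    · subst hjl; simp [tangentCoord_last hol, Pi.single_eq_of_ne hjo]
    · simp [tangentCoord_of_ne hjo hjl, Pi.single_eq_of_ne hjo, Pi.single_eq_of_ne hjl, hn]
  have ho3 : (Pi.single o (X ^ 3) : Fin m → k⟦X⟧) ∈ A := by
    have h1 := sub_mem (pow_mem hoA 3) hl3
    rwa [hpow 3 three_ne_zero, add_sub_cancel_right] at h1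
  have ho4 : (Pi.single o (X ^ 4) : Fin m → k⟦X⟧) ∈ A := by
    have h1 := sub_mem (pow_mem hoA 4) hl4
    rwa [hpow 4 four_ne_zero, add_sub_cancel_right] at h1
  refine exists_algHom_range_eq (N := 3) (fun f hf => Algebra.subset_adjoin (Or.inr hf)) _ ?_
    (fun i => Algebra.subset_adjoin (Or.inl ⟨i, rfl⟩)) le_rfl ?_ ?_ ?_
  · intro i j
    have hi : (⟨i.val, by omega⟩ : Fin m) ≠ l := fun h => by
      have := congrArg Fin.val h
      simp at this
      omega
    rw [paramII_eq hl (i' := ⟨i.val, by omega⟩) rfl]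
    exact coeff_zero_tangentCoord hi (by split_ifs <;> norm_num) j
  · have h1 : (fun _ => X ^ 2 : Fin m → k⟦X⟧) = tangentCoord k l o 1 ^ 2 +
        ∑ i ∈ (Finset.univ.erase l).erase o, Pi.single i (X ^ 2) := by
      have h2 := Finset.add_sum_erase (Finset.univ.erase l)
        (fun i => (Pi.single i (X ^ 2) : Fin m → k⟦X⟧)) (show o ∈ Finset.univ.erase l by simp [hol])
      have h3 := Finset.add_sum_erase Finset.univ
        (fun i => (Pi.single i (X ^ 2) : Fin m → k⟦X⟧)) (Finset.mem_univ l)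
      rw [hpow 2 two_ne_zero, add_comm (Pi.single o (X ^ 2) : Fin m → k⟦X⟧), add_assoc, h2, h3]
      exact (Finset.univ_sum_single _).symm
    rw [h1]
    refine add_mem (pow_mem hoA 2) (sum_mem fun i hi => ?_)
    exact hw i (Finset.ne_of_mem_erase hi) (Finset.ne_of_mem_erase (Finset.mem_of_mem_erase hi))
  · intro i
    by_cases hio : i = o
    · rw [hio]; exact ho3
    by_cases hil : i = l
    · rw [hil]; exact hl3
    have h1 := mul_mem (hw i hio hil) (hτA i hio hil)
    rw [tangentCoord, mul_add, single_mul_single_of_ne hil, single_mul_single_self, ← pow_succ,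
      add_zero] at h1
    exact h1
  · intro i
    by_cases hio : i = o
    · rw [hio]; exact ho4
    by_cases hil : i = l
    · rw [hil]; exact hl4
    have h1 := pow_mem (hw i hio hil) 2
    rwa [single_pow _ _ two_ne_zero, ← pow_mul] at h1

variable (k) in
/-- The equations which hold on, and suffice to define, the type II singularity. -/
structure IsTypeIIIdeal {n : ℕ} (o o₁ : Fin n) (J : Ideal (MvPowerSeries (Fin n) k)) : Prop where
  first_mul_sub_mem : ∀ i, i ≠ o →
    MvPowerSeries.X o * MvPowerSeries.X i - MvPowerSeries.X o * MvPowerSeries.X o₁ ∈ J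
  mul_sub_mem : ∀ i j, i ≠ o → j ≠ o → i ≠ j →
    MvPowerSeries.X i * MvPowerSeries.X j - MvPowerSeries.X o ^ 2 * MvPowerSeries.X o₁ ∈ J
  mul_sub_sq_mem : MvPowerSeries.X o * MvPowerSeries.X o₁ *
    (MvPowerSeries.X o₁ - MvPowerSeries.X o ^ 2) ∈ J

/-- The ideal of the type II singularity. -/
theorem IsTypeIIIdeal.ker_le {l : Fin m} (hl : l.val + 1 = m) {o o₁ : Fin (m - 1)}
    (ho : o.val = 0) (ho₁ : o₁ ≠ o) {J : Ideal (MvPowerSeries (Fin (m - 1)) k)}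
    (hJ : IsTypeIIIdeal k o o₁ J) {φ : MvPowerSeries (Fin (m - 1)) k →ₐ[k] (Fin m → k⟦X⟧)}
    (hφ : ∀ i, φ (MvPowerSeries.X i) = paramII k m i) (hJφ : J ≤ RingHom.ker φ) :
    RingHom.ker φ ≤ J := by
  let ν : Fin (m - 1) → Fin m := fun i => ⟨i.val, by omega⟩
  have hνl : ∀ i, ν i ≠ l := fun i h => by
    have := congrArg Fin.val h
    simp [ν] at this
    omega
  have hν : Function.Injective ν := fun i j h => Fin.ext (by simpa [ν] using h)
  have hν0 : ∀ i, i ≠ o → (ν i).val ≠ 0 := fun i hi h => hi (Fin.ext (h.trans ho.symm))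
  let x : Fin (m - 1) → MvPowerSeries (Fin (m - 1)) k := MvPowerSeries.X
  let β : Fin m → MvPowerSeries (Fin (m - 1)) k →ₐ[k] k⟦X⟧ :=
    fun j => (Pi.evalAlgHom k (fun _ : Fin m => k⟦X⟧) j).comp φ
  have hβ : ∀ j f, β j f = φ f j := fun _ _ => rfl
  have hβo : β l (x o) = X := by
    rw [hβ, hφ, paramII_eq hl (i' := ν o) rfl, if_pos ho, tangentCoord_last (hνl o), pow_one]
  have hβl : ∀ i, i ≠ o → β l (x i) = X ^ 2 := fun i hi => by
    rw [hβ, hφ, paramII_eq hl (i' := ν i) rfl, if_neg (hν0 i hi), tangentCoord_last (hνl i)]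
  have hβii : ∀ i, β (ν i) (x i) = X := fun i => by
    rw [hβ, hφ, paramII_eq hl (i' := ν i) rfl, tangentCoord_self (hνl i)]
  have hβij : ∀ i j, j ≠ i → β (ν i) (x j) = 0 := fun i j hj => by
    rw [hβ, hφ, paramII_eq hl (i' := ν j) rfl,
      tangentCoord_of_ne (fun h => hj (hν h).symm) (hνl i)]
  have hβJ : ∀ j, ∀ f ∈ J, β j f = 0 := fun j f hf => congrFun (hJφ hf) j
  -- In the colon ideal `(J : x o * x o₁)` every variable other than `x o` equals `x o ^ 2`, so the
  -- last branch is a smooth graph over `x o`.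
  have hker : RingHom.ker (β l) ≤ Submodule.comap (LinearMap.mulLeft _ (x o * x o₁)) J := by
    refine MvPowerSeries.ker_le_of_map_X_eq_mul hβo (fun _ => x o)
      (fun i hi => by rw [hβo, ← sq]; exact hβl i hi) fun i hi => ?_
    change x o * x o₁ * (x i - x o * x o) ∈ J
    have h1 : x o * x o₁ * (x i - x o * x o) = x o₁ * (x o * x i - x o * x o₁) +
      x o * x o₁ * (x o₁ - x o ^ 2) := by ring
    rw [h1]
    exact add_mem (J.mul_mem_left _ (hJ.first_mul_sub_mem i hi)) hJ.mul_sub_sq_mem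
  intro f hf
  have hfβ : ∀ j, β j f = 0 := fun j => congrFun hf j
  let Q : Ideal (MvPowerSeries (Fin (m - 1)) k) := J ⊔ Ideal.span {x o * x o₁}
  have hzQ : x o * x o₁ ∈ Q := Submodule.mem_sup_right (Ideal.mem_span_singleton_self _)
  have hoQ : ∀ i, i ≠ o → x o * x i ∈ Q := fun i hi => by
    rw [← sub_add_cancel (x o * x i) (x o * x o₁)]
    exact add_mem (Submodule.mem_sup_left (hJ.first_mul_sub_mem i hi)) hzQ
  have hxQ : ∀ i j, i ≠ j → x i * x j ∈ Q := by
    intro i j hij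
    by_cases hi : i = o
    · rw [hi]; exact hoQ j (fun h => hij (hi.trans h.symm))
    by_cases hj : j = o
    · rw [hj, mul_comm]; exact hoQ i hi
    rw [← sub_add_cancel (x i * x j) (x o ^ 2 * x o₁)]
    refine add_mem (Submodule.mem_sup_left (hJ.mul_sub_mem i j hi hj hij)) ?_
    rw [sq, mul_assoc]
    exact Q.mul_mem_left _ hzQ
  have hfQ : f ∈ Q := by
    obtain ⟨c, g, rfl⟩ := MvPowerSeries.exists_eq_C_add_sum_X_mul f
    have hfi : ∀ i, algebraMap k k⟦X⟧ c + X * β (ν i) (g i) = 0 := by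
      intro i
      have h1 := hfβ (ν i)
      rw [map_add, AlgHom.commutes, map_sum, Finset.sum_eq_single i] at h1
      · rwa [map_mul, hβii i] at h1
      · intro j _ hj
        rw [map_mul, hβij i j hj, zero_mul]
      · simp
    have hc : c = 0 := by
      have := congrArg constantCoeff (hfi o)
      simpa using this
    rw [hc, map_zero, zero_add]
    refine sum_mem fun i _ => ?_
    have h1 := hfi i
    rw [hc, map_zero, zero_add] at h1
    have h2 : g i ∈ RingHom.ker (β (ν i)) := (mul_eq_zero.mp h1).resolve_left X_ne_zero
    refine MvPowerSeries.ker_le_of_map_X_eq_mul (hβii i) (fun _ => 0)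
      (fun j hj => by rw [map_zero, mul_zero]; exact hβij i j hj)
      (J := Submodule.comap (LinearMap.mulLeft _ (x i)) Q) (fun j hj => ?_) h2
    change x i * (x j - x i * 0) ∈ Q
    rw [mul_zero, sub_zero]
    exact hxQ i j hj.symm
  obtain ⟨u, hu, v, hv, rfl⟩ := Submodule.mem_sup.mp hfQ
  obtain ⟨w, rfl⟩ := Ideal.mem_span_singleton'.mp hv
  refine add_mem hu ?_
  have h1 := hfβ l
  rw [map_add, hβJ l u hu, zero_add, map_mul, map_mul, hβo, hβl o₁ ho₁, ← pow_succ'] at h1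
  have h2 : w ∈ RingHom.ker (β l) :=
    (mul_eq_zero.mp h1).resolve_right (pow_ne_zero _ X_ne_zero)
  rw [mul_comm]
  exact hker h2

/-- The equation of the type II singularity with two branches. -/
theorem hasEquations_typeII_two :
    HasEquations (typeII k 2) ![paramII k 2 0, ![0, PowerSeries.X ^ 3]]
      (Ideal.span {MvPowerSeries.X 1 * (MvPowerSeries.X 1 - MvPowerSeries.X 0 ^ 3)}) := by
  set x : Fin 2 → Fin 2 → k⟦X⟧ := ![paramII k 2 0, ![0, PowerSeries.X ^ 3]] with hx
  have hx0 : x 0 = ![X, X] := by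
    funext j
    fin_cases j <;> simp [hx, paramII]
  have hx1 : x 1 = ![0, X ^ 3] := rfl
  set A := Algebra.adjoin k (Set.range x) with hA
  have h0A : x 0 ∈ A := Algebra.subset_adjoin ⟨0, rfl⟩
  have h1A : x 1 ∈ A := Algebra.subset_adjoin ⟨1, rfl⟩
  have hs1 : ∀ a : k⟦X⟧, (Pi.single 1 a : Fin 2 → k⟦X⟧) = ![0, a] := fun a => by
    funext j
    fin_cases j <;> simp
  have hN : radicalPow k 2 3 ⊆ typeII k 2 := fun f hf => Algebra.subset_adjoin (Or.inr hf)
  obtain ⟨φ, hφ, hrange⟩ := exists_algHom_range_eq hN x (fun i j => by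
      fin_cases i <;> fin_cases j <;> simp [hx0, hx1]) (fun i => by
      fin_cases i
      · exact Algebra.subset_adjoin (Or.inl ⟨0, rfl⟩)
      · refine hN fun j => ?_
        fin_cases j <;> simp [hx1]) (by
      refine Algebra.adjoin_mono (Set.union_subset_union_left _ ?_)
      rintro _ ⟨i, rfl⟩
      refine ⟨0, ?_⟩
      have : i = (0 : Fin 1) := Subsingleton.elim (α := Fin 1) _ _
      rw [this]
      rfl) (by
      have := pow_mem h0A 2
      convert this using 1
      funext j
      fin_cases j <;> simp [hx0]) (fun i => by
      fin_cases i
      · convert sub_mem (pow_mem h0A 3) h1A using 1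
        funext j
        fin_cases j <;> simp [hx0, hx1]
      · convert h1A using 1
        exact hs1 _) (fun i => by
      fin_cases i
      · convert sub_mem (pow_mem h0A 4) (mul_mem h0A h1A) using 1
        funext j
        fin_cases j <;> simp [hx0, hx1, ← pow_succ']
      · convert mul_mem h0A h1A using 1
        funext j
        fin_cases j <;> simp [hx0, hx1, ← pow_succ'])
  refine ⟨φ, hφ, hrange, le_antisymm ?_ ?_⟩
  · set y : Fin 2 → MvPowerSeries (Fin 2) k := MvPowerSeries.X with hy
    set J := Ideal.span {y 1 * (y 1 - y 0 ^ 3)} with hJ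
    let β : Fin 2 → MvPowerSeries (Fin 2) k →ₐ[k] k⟦X⟧ :=
      fun j => (Pi.evalAlgHom k (fun _ : Fin 2 => k⟦X⟧) j).comp φ
    have hβ : ∀ j i, β j (y i) = x i j := fun j i => congrFun (hφ i) j
    intro f hf
    -- Vanishing on the first branch makes `f` a multiple of `y 1`. The cofactor vanishes on the
    -- second branch, the graph of `y 1 = y 0 ^ 3`.
    have h1 : f ∈ Ideal.span {y 1} := by
      refine MvPowerSeries.ker_le_of_map_X_eq_mul (α := β 0) (i₀ := 0)
        (by rw [← hy, hβ, hx0]; rfl) (fun _ => 0) (fun i hi => ?_) (fun i hi => ?_)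
        (show f ∈ RingHom.ker (β 0) from congrFun hf 0)
      · obtain rfl : i = 1 := by omega
        rw [← hy, hβ, hx1]
        simp
      · obtain rfl : i = 1 := by omega
        rw [mul_zero, sub_zero]
        exact Ideal.mem_span_singleton_self _
    obtain ⟨w, rfl⟩ := Ideal.mem_span_singleton'.mp h1
    have h2 : β 1 (w * y 1) = 0 := congrFun hf 1
    have h3 : β 1 (y 1) = X ^ 3 := by rw [hβ, hx1]; rfl
    rw [map_mul, h3] at h2
    have h4 : w ∈ RingHom.ker (β 1) :=
      (mul_eq_zero.mp h2).resolve_right (pow_ne_zero _ X_ne_zero)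
    have h5 : β 1 (y 0) = X := by rw [hβ, hx0]; rfl
    have h6 := MvPowerSeries.ker_le_of_map_X_eq_mul (α := β 1) (i₀ := 0)
      (J := Submodule.comap (LinearMap.mulLeft _ (y 1)) J) h5 (fun _ => y 0 ^ 2) (fun i hi => by
        obtain rfl : i = 1 := by omega
        rw [map_pow, h5, ← pow_succ']
        exact h3) (fun i hi => by
        obtain rfl : i = 1 := by omega
        change y 1 * (y 1 - y 0 * y 0 ^ 2) ∈ J
        rw [← pow_succ']
        exact Ideal.mem_span_singleton_self _) h4
    rw [mul_comm]
    exact h6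
  · rw [Ideal.span_le, Set.singleton_subset_iff]
    change φ _ = 0
    rw [map_mul, map_sub, map_pow, hφ, hφ, hx0, hx1]
    funext j
    simp only [Pi.mul_apply, Pi.sub_apply, Pi.pow_apply]
    fin_cases j <;> simp

end

end

/-! ### Verification of the listed equations. -/

section

open PowerSeries

section

variable {k : Type*} [Field k] {m : ℕ}

/-- To prove that the type I singularity has given equations, it suffices to check them. -/
theorem IsTypeIIdeal.hasEquations {l : Fin m} (hl : l.val + 1 = m) (hm : 2 ≤ m)
    {J : Ideal (MvPowerSeries (Fin m) k)} (hJ : IsTypeIIdeal k l J)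
    (hJφ : ∀ φ : MvPowerSeries (Fin m) k →ₐ[k] (Fin m → k⟦X⟧), IsTypeIIdeal k l (RingHom.ker φ) →
      J ≤ RingHom.ker φ) : HasEquations (typeI k m) (paramI k m) J := by
  obtain ⟨φ, hφ, hrange⟩ := exists_algHom_range_eq_typeI (k := k) hl hm
  have hz := paramI_last (k := k) hl
  have hτ := fun i (h : i ≠ l) => paramI_of_ne (k := k) hl h
  have hle := hJφ φ
    { last_mul_sub_mem := fun i j hi hj => by
        rw [RingHom.mem_ker, mul_sub, mul_comm, mul_comm (MvPowerSeries.X l)]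
        change φ _ = 0
        rw [map_sub, map_mul, map_mul, hφ, hφ, hφ, hz, hτ i hi, hτ j hj,
          tangentCoord_mul_single hi, tangentCoord_mul_single hj, sub_self]
      mul_sub_mem := fun i j hi hj hij => by
        change φ _ = 0
        rw [map_sub, map_mul, map_pow, hφ, hφ, hφ, hz, hτ i hi, hτ j hj,
          tangentCoord_mul_tangentCoord hi hj hij, single_pow _ _ three_ne_zero, ← pow_mul,
          sub_self]
      last_mul_sq_sub_mem := fun i hi => by
        change φ _ = 0
        rw [map_mul, map_sub, map_pow, map_pow, hφ, hφ, hz, hτ i hi, tangentCoord_sq hi,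
          single_pow _ _ three_ne_zero, ← pow_mul, add_sub_cancel_right,
          single_mul_single_of_ne hi.symm] }
  exact ⟨φ, hφ, hrange, le_antisymm (hJ.ker_le hl hm hφ hle) hle⟩

/-- To prove that the type II singularity has given equations, it suffices to check them. -/
theorem IsTypeIIIdeal.hasEquations {o o₁ : Fin (m - 1)}
    (ho : o.val = 0) (ho₁ : o₁ ≠ o) {J : Ideal (MvPowerSeries (Fin (m - 1)) k)}
    (hJ : IsTypeIIIdeal k o o₁ J)
    (hJφ : ∀ φ : MvPowerSeries (Fin (m - 1)) k →ₐ[k] (Fin m → k⟦X⟧),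
      IsTypeIIIdeal k o o₁ (RingHom.ker φ) → J ≤ RingHom.ker φ) :
    HasEquations (typeII k m) (paramII k m) J := by
  have hm : 3 ≤ m := by
    have := o₁.2
    have h : o₁.val ≠ o.val := fun h => ho₁ (Fin.ext h)
    omega
  obtain ⟨l, hl⟩ : ∃ l : Fin m, l.val + 1 = m := ⟨⟨m - 1, by omega⟩, by simp; omega⟩
  obtain ⟨φ, hφ, hrange⟩ := exists_algHom_range_eq_typeII (k := k) hl hm
  let ν : Fin (m - 1) → Fin m := fun i => ⟨i.val, by omega⟩
  have hνl : ∀ i, ν i ≠ l := fun i h => by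
    have := congrArg Fin.val h
    simp [ν] at this
    omega
  have hν : ∀ {i j}, i ≠ j → ν i ≠ ν j := fun hij h => hij (Fin.ext (by simpa [ν] using h))
  have hν0 : ∀ i, i ≠ o → (ν i).val ≠ 0 := fun i hi h => hi (Fin.ext (h.trans ho.symm))
  have hpo : paramII k m o = tangentCoord k l (ν o) 1 := by
    rw [paramII_eq hl (i' := ν o) rfl, if_pos ho]
  have hp : ∀ i, i ≠ o → paramII k m i = tangentCoord k l (ν i) 2 := fun i hi => by
    rw [paramII_eq hl (i' := ν i) rfl, if_neg (hν0 i hi)]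
  have hoi : ∀ i, i ≠ o → paramII k m o * paramII k m i = Pi.single l (X ^ 3) := fun i hi => by
    rw [hpo, hp i hi, tangentCoord_mul_tangentCoord (hνl o) (hνl i) (hν hi.symm)]
  have hle := hJφ φ
    { first_mul_sub_mem := fun i hi => by
        change φ _ = 0
        rw [map_sub, map_mul, map_mul, hφ, hφ, hφ, hoi i hi, hoi o₁ ho₁, sub_self]
      mul_sub_mem := fun i j hi hj hij => by
        change φ _ = 0
        rw [map_sub, map_mul, map_mul, map_pow, hφ, hφ, hφ, hφ, sq, mul_assoc, hoi o₁ ho₁, hp i hi,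
          hp j hj, tangentCoord_mul_tangentCoord (hνl i) (hνl j) (hν hij), hpo,
          tangentCoord_mul_single (hνl o), ← pow_add, sub_self]
      mul_sub_sq_mem := by
        change φ _ = 0
        rw [map_mul, map_mul, map_sub, map_pow, hφ, hφ, hoi o₁ ho₁, mul_comm, sub_mul, hp o₁ ho₁,
          hpo, tangentCoord_mul_single (hνl o₁), tangentCoord_one_pow_mul_single (hνl o),
          sub_self] }
  exact ⟨φ, hφ, hrange, le_antisymm (hJ.ker_le hl ho ho₁ hφ hle) hle⟩

/-- With three branches or more, the third family of equations of type I follows from the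
others. -/
lemma IsTypeIIdeal.of_exists_ne {l : Fin m} {J : Ideal (MvPowerSeries (Fin m) k)}
    (hex : ∀ i, i ≠ l → ∃ j, j ≠ l ∧ i ≠ j)
    (h₁ : ∀ i j, i ≠ l → j ≠ l →
      MvPowerSeries.X l * (MvPowerSeries.X i - MvPowerSeries.X j) ∈ J)
    (h₂ : ∀ i j, i ≠ l → j ≠ l → i ≠ j →
      MvPowerSeries.X i * MvPowerSeries.X j - MvPowerSeries.X l ^ 3 ∈ J) :
    IsTypeIIdeal k l J := by
  refine ⟨h₁, h₂, fun i hi => ?_⟩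
  obtain ⟨j, hj, hij⟩ := hex i hi
  have : MvPowerSeries.X l * (MvPowerSeries.X i ^ 2 - MvPowerSeries.X l ^ 3) =
      MvPowerSeries.X i * (MvPowerSeries.X l * (MvPowerSeries.X i - MvPowerSeries.X j)) +
        MvPowerSeries.X l * (MvPowerSeries.X i * MvPowerSeries.X j -
          (MvPowerSeries.X l ^ 3 : MvPowerSeries (Fin m) k)) := by ring
  rw [this]
  exact add_mem (J.mul_mem_left _ (h₁ i j hi hj)) (J.mul_mem_left _ (h₂ i j hi hj hij))

theorem hasEquations_typeI_two : HasEquations (typeI k 2) (paramI k 2)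
    (Ideal.span {MvPowerSeries.X 1 * (MvPowerSeries.X 1 ^ 3 - MvPowerSeries.X 0 ^ 2)}) := by
  set J : Ideal (MvPowerSeries (Fin 2) k) :=
    Ideal.span {MvPowerSeries.X 1 * (MvPowerSeries.X 1 ^ 3 - MvPowerSeries.X 0 ^ 2)}
  have hneg : (MvPowerSeries.X 1 * (MvPowerSeries.X 1 ^ 3 - MvPowerSeries.X 0 ^ 2) :
      MvPowerSeries (Fin 2) k) =
      -(MvPowerSeries.X 1 * (MvPowerSeries.X 0 ^ 2 - MvPowerSeries.X 1 ^ 3)) := by ring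
  refine IsTypeIIdeal.hasEquations (l := 1) rfl le_rfl ⟨fun i j hi hj => ?_, fun i j hi hj hij => ?_,
    fun i hi => ?_⟩ fun φ hφ => ?_
  · obtain rfl : i = 0 := by omega
    obtain rfl : j = 0 := by omega
    rw [sub_self, mul_zero]
    exact zero_mem _
  · omega
  · obtain rfl : i = 0 := by omega
    rw [← neg_mem_iff, ← hneg]
    exact Ideal.mem_span_singleton_self _
  · rw [Ideal.span_le, Set.singleton_subset_iff, hneg, SetLike.mem_coe, neg_mem_iff]
    exact hφ.last_mul_sq_sub_mem 0 (by decide)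

theorem hasEquations_typeI_three : HasEquations (typeI k 3) (paramI k 3)
    (Ideal.span {MvPowerSeries.X 2 * (MvPowerSeries.X 0 - MvPowerSeries.X 1),
      MvPowerSeries.X 2 ^ 3 - MvPowerSeries.X 0 * MvPowerSeries.X 1}) := by
  set J : Ideal (MvPowerSeries (Fin 3) k) :=
    Ideal.span {MvPowerSeries.X 2 * (MvPowerSeries.X 0 - MvPowerSeries.X 1),
      MvPowerSeries.X 2 ^ 3 - MvPowerSeries.X 0 * MvPowerSeries.X 1}
  have h1 : MvPowerSeries.X 2 * (MvPowerSeries.X 0 - MvPowerSeries.X 1) ∈ J :=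
    Ideal.subset_span (by simp)
  have h2 : MvPowerSeries.X 2 ^ 3 - MvPowerSeries.X 0 * MvPowerSeries.X 1 ∈ J :=
    Ideal.subset_span (by simp)
  have h1' : MvPowerSeries.X 2 * (MvPowerSeries.X 1 - MvPowerSeries.X 0) ∈ J := by
    rw [← neg_mem_iff, ← mul_neg, neg_sub]; exact h1
  have h2' : MvPowerSeries.X 0 * MvPowerSeries.X 1 - MvPowerSeries.X 2 ^ 3 ∈ J := by
    rw [← neg_mem_iff, neg_sub]; exact h2
  have hcases : ∀ i : Fin 3, i ≠ 2 → i = 0 ∨ i = 1 := by decide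
  refine IsTypeIIdeal.hasEquations (l := 2) rfl (by norm_num)
    (IsTypeIIdeal.of_exists_ne (by decide) (fun i j hi hj => ?_) fun i j hi hj hij => ?_)
    fun φ hφ => ?_
  · rcases hcases i hi with rfl | rfl <;> rcases hcases j hj with rfl | rfl
    · simp
    · exact h1
    · exact h1'
    · simp
  · rcases hcases i hi with rfl | rfl <;> rcases hcases j hj with rfl | rfl
    · exact absurd rfl hij
    · exact h2'
    · rw [mul_comm]; exact h2'
    · exact absurd rfl hij
  · rw [Ideal.span_le]
    rintro _ (rfl | rfl)
    · exact hφ.last_mul_sub_mem 0 1 (by decide) (by decide)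
    · rw [SetLike.mem_coe, ← neg_mem_iff, neg_sub]
      exact hφ.mul_sub_mem 0 1 (by decide) (by decide) (by decide)

/-- The binomials `x_i (x_j - x_l)` make all products of two different variables other than the last
equal modulo the ideal, and `x_m ^ 3 - x_1 x_2` identifies their common value. -/
theorem hasEquations_typeI (hm : 4 ≤ m) :
    HasEquations (typeI k m) (paramI k m) (equationsI k m hm) := by
  set l : Fin m := ⟨m - 1, by omega⟩ with hl
  set o : Fin m := ⟨0, by omega⟩ with ho
  set o₁ : Fin m := ⟨1, by omega⟩ with ho₁
  have hol : o ≠ l := by simp [ho, hl, Fin.ext_iff]; omega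
  have ho₁l : o₁ ≠ l := by simp [ho₁, hl, Fin.ext_iff]; omega
  have hoo₁ : o ≠ o₁ := by simp [ho, ho₁, Fin.ext_iff]
  set J := equationsI k m hm with hJ
  let x : Fin m → MvPowerSeries (Fin m) k := MvPowerSeries.X
  have h1 : ∀ i j, i ≠ l → j ≠ l → x l * (x i - x j) ∈ J := by
    intro i j hi hj
    by_cases hij : i = j
    · rw [hij, sub_self, mul_zero]
      exact zero_mem _
    · exact Ideal.subset_span (Or.inl (Or.inr ⟨i, j, hi, hj, hij, rfl⟩))
  have h2 : ∀ i j h, i ≠ l → j ≠ l → h ≠ l → i ≠ j → i ≠ h → x i * x j - x i * x h ∈ J := by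
    intro i j h hi hj hh hij hih
    rw [← mul_sub]
    by_cases hjh : j = h
    · rw [hjh, sub_self, mul_zero]
      exact zero_mem _
    · exact Ideal.subset_span (Or.inl (Or.inl ⟨i, j, h, hi, hj, hh, hij, hih, hjh, rfl⟩))
  have h3 : x o * x o₁ - x l ^ 3 ∈ J := by
    rw [← neg_mem_iff, neg_sub]
    exact Ideal.subset_span (Or.inr rfl)
  have h4 : ∀ j, j ≠ l → o ≠ j → x o * x j - x l ^ 3 ∈ J := fun j hj hoj => by
    rw [← sub_add_sub_cancel _ (x o * x o₁)]
    exact add_mem (h2 o j o₁ hol hj ho₁l hoj hoo₁) h3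
  refine IsTypeIIdeal.hasEquations (l := l) (by simp [hl]; omega) (by omega)
    (IsTypeIIdeal.of_exists_ne (fun i hi => ?_) h1 fun i j hi hj hij => ?_) fun φ hφ => ?_
  · by_cases hio : i = o
    · exact ⟨o₁, ho₁l, hio ▸ hoo₁⟩
    · exact ⟨o, hol, hio⟩
  · by_cases hio : i = o
    · subst hio
      exact h4 j hj hij
    · change x i * x j - x l ^ 3 ∈ J
      rw [← sub_add_sub_cancel _ (x i * x o), mul_comm (x i) (x o)]
      rw [mul_comm (x o) (x i)]
      refine add_mem (h2 i j o hi hj hol hij hio) ?_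
      rw [mul_comm]
      exact h4 i hi (Ne.symm hio)
  · rw [hJ, equationsI, Ideal.span_le]
    rintro _ ((⟨i, j, h, hi, hj, hh, hij, hih, -, rfl⟩ | ⟨i, j, hi, hj, -, rfl⟩) | rfl)
    · have := sub_mem (hφ.mul_sub_mem i j hi hj hij) (hφ.mul_sub_mem i h hi hh hih)
      rwa [sub_sub_sub_cancel_right, ← mul_sub] at this
    · exact hφ.last_mul_sub_mem i j hi hj
    · rw [SetLike.mem_coe, ← neg_mem_iff, neg_sub]
      exact hφ.mul_sub_mem o o₁ hol ho₁l hoo₁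

theorem hasEquations_typeII_three : HasEquations (typeII k 3) (paramII k 3)
    (Ideal.span {MvPowerSeries.X 0 * MvPowerSeries.X 1 *
      (MvPowerSeries.X 1 - MvPowerSeries.X 0 ^ 2)}) := by
  have hcases : ∀ i : Fin (3 - 1), i ≠ 0 → i = 1 := by decide
  refine IsTypeIIIdeal.hasEquations (o := 0) (o₁ := 1) rfl (by decide)
    ⟨fun i hi => ?_, fun i j hi hj hij => ?_, ?_⟩ fun φ hφ => ?_
  · rw [hcases i hi, sub_self]
    exact zero_mem _
  · exact absurd ((hcases i hi).trans (hcases j hj).symm) hij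
  · exact Ideal.mem_span_singleton_self _
  · rw [Ideal.span_le, Set.singleton_subset_iff]
    exact hφ.mul_sub_sq_mem

/-- Modulo the ideal the products of `x o` with the other variables agree, and the remaining
binomials link each product of two different later variables to `x o₁ * x o₂`. The generator
containing `x o₂` then identifies this with `x o ^ 2 * x o₁`. -/
theorem hasEquations_typeII (hm : 4 ≤ m) :
    HasEquations (typeII k m) (paramII k m) (equationsII k m hm) := by
  set o : Fin (m - 1) := ⟨0, by omega⟩ with ho
  set o₁ : Fin (m - 1) := ⟨1, by omega⟩ with ho₁
  set o₂ : Fin (m - 1) := ⟨2, by omega⟩ with ho₂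
  have h01 : o < o₁ := Nat.zero_lt_one
  have h12 : o₁ < o₂ := Nat.one_lt_two
  have hpos : ∀ i, i ≠ o → 0 < i.val := fun i hi =>
    Nat.pos_of_ne_zero fun h => hi (Fin.ext h)
  have hgt : ∀ i, i ≠ o → i ≠ o₁ → o₁ < i := fun i hi hi₁ => by
    have h1 := hpos i hi
    have h2 : i.val ≠ 1 := fun h => hi₁ (Fin.ext h)
    exact Fin.lt_def.mpr (by simp [ho₁]; omega)
  set J := equationsII k m hm with hJ
  let x : Fin (m - 1) → MvPowerSeries (Fin (m - 1)) k := MvPowerSeries.X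
  have hgen : ∀ i j h : Fin (m - 1), ((i < j ∧ j < h) ∨ (0 < j.val ∧ j < h ∧ h < i)) →
      x i * x j - x i * x h ∈ J := fun i j h H => by
    rw [← mul_sub]
    exact Ideal.subset_span (Or.inr ⟨i, j, h, H, rfl⟩)
  have hgen₂ : x o₂ * (x o ^ 2 - x o₁) ∈ J := Ideal.subset_span (Or.inl rfl)
  have hfirst : ∀ i, i ≠ o → x o * x i - x o * x o₁ ∈ J := by
    intro i hi
    by_cases hi₁ : i = o₁
    · rw [hi₁, sub_self]
      exact zero_mem _
    · rw [← neg_mem_iff, neg_sub]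
      exact hgen o o₁ i (Or.inl ⟨h01, hgt i hi hi₁⟩)
  have h12' : x o₁ * x o₂ - x o ^ 2 * x o₁ ∈ J := by
    have : x o₁ * x o₂ - x o ^ 2 * x o₁ = x o * (x o * x o₂ - x o * x o₁) -
        x o₂ * (x o ^ 2 - x o₁) := by ring
    rw [this]
    exact sub_mem (J.mul_mem_left _ (hfirst o₂ (h01.trans h12).ne')) hgen₂
  have h1j : ∀ j, o₁ < j → x o₁ * x j - x o ^ 2 * x o₁ ∈ J := by
    intro j hj
    by_cases hj₂ : j = o₂
    · rw [hj₂]; exact h12'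
    · have h2j : o₂ < j := by
        have h1 : 1 < j.val := hj
        have h2 : j.val ≠ 2 := fun h => hj₂ (Fin.ext h)
        exact Fin.lt_def.mpr (by simp [ho₂]; omega)
      rw [← sub_add_sub_cancel _ (x o₁ * x o₂)]
      refine add_mem ?_ h12'
      rw [← neg_mem_iff, neg_sub]
      exact hgen o₁ o₂ j (Or.inl ⟨h12, h2j⟩)
  have hlt : ∀ i j, i ≠ o → i < j → x i * x j - x o ^ 2 * x o₁ ∈ J := by
    intro i j hi hij
    by_cases hi₁ : i = o₁
    · rw [hi₁]; exact h1j j (hi₁ ▸ hij)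
    · have h1i := hgt i hi hi₁
      rw [← sub_add_sub_cancel _ (x o₁ * x j)]
      refine add_mem ?_ (h1j j (h1i.trans hij))
      rw [mul_comm, mul_comm (x o₁), ← neg_mem_iff, neg_sub]
      exact hgen j o₁ i (Or.inr ⟨Nat.one_pos, h1i, hij⟩)
  refine IsTypeIIIdeal.hasEquations (o := o) (o₁ := o₁) rfl h01.ne'
    ⟨hfirst, fun i j hi hj hij => ?_, ?_⟩ fun φ hφ => ?_
  · rcases lt_or_gt_of_ne hij with h | h
    · exact hlt i j hi h
    · rw [mul_comm]
      exact hlt j i hj h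
  · change x o * x o₁ * (x o₁ - x o ^ 2) ∈ J
    have : x o * x o₁ * (x o₁ - x o ^ 2) = -(x o₁ * (x o * x o₂ - x o * x o₁)) +
        x o * (x o₁ * x o₂ - x o ^ 2 * x o₁) := by ring
    rw [this]
    exact add_mem (neg_mem (J.mul_mem_left _ (hfirst o₂ (h01.trans h12).ne')))
      (J.mul_mem_left _ h12')
  · rw [hJ, equationsII, Ideal.span_le]
    rintro _ (rfl | ⟨i, j, h, H, rfl⟩)
    · have h1 := hφ.mul_sub_mem o₁ o₂ h01.ne' (h01.trans h12).ne' h12.ne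
      have h2 := Ideal.mul_mem_left _ (x o) (hφ.first_mul_sub_mem o₂ (h01.trans h12).ne')
      have h3 := sub_mem h2 h1
      have : x o * (x o * x o₂ - x o * x o₁) - (x o₁ * x o₂ - x o ^ 2 * x o₁) =
        x o₂ * (x o ^ 2 - x o₁) := by ring
      rw [← this]
      exact h3
    · rw [SetLike.mem_coe, mul_sub]
      rcases H with ⟨hij, hjh⟩ | ⟨hj, hjh, hhi⟩
      · by_cases hi : i = o
        · subst hi
          have := sub_mem (hφ.first_mul_sub_mem j hij.ne') (hφ.first_mul_sub_mem h (hij.trans hjh).ne')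
          rwa [sub_sub_sub_cancel_right] at this
        · have hi0 := hpos i hi
          have hjo : j ≠ o := fun hh => by rw [hh] at hij; exact absurd hij (Nat.not_lt_zero _)
          have hho : h ≠ o := fun hh => by rw [hh] at hjh; exact absurd hjh (Nat.not_lt_zero _)
          have := sub_mem (hφ.mul_sub_mem i j hi hjo hij.ne)
            (hφ.mul_sub_mem i h hi hho (hij.trans hjh).ne)
          rwa [sub_sub_sub_cancel_right] at this
      · have hjo : j ≠ o := fun hh => by rw [hh] at hj; exact absurd hj (lt_irrefl _)
        have hho : h ≠ o := fun hh => by rw [hh] at hjh; exact absurd hjh (Nat.not_lt_zero _)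
        have hio : i ≠ o := fun hh => by rw [hh] at hhi; exact absurd hhi (Nat.not_lt_zero _)
        have := sub_mem (hφ.mul_sub_mem i j hio hjo (hjh.trans hhi).ne')
          (hφ.mul_sub_mem i h hio hho hhi.ne')
        rwa [sub_sub_sub_cancel_right] at this

end

end

theorem proposition2p2 {k : Type*} [Field k] [IsAlgClosed k]
    (h2 : (2 : k) ≠ 0) (h3 : (3 : k) ≠ 0) (h5 : (5 : k) ≠ 0) :
    -- for every `m ≥ 2` there are, up to isomorphism, exactly two singularities
    (∀ m : ℕ, 2 ≤ m →
      IsGorensteinGenusTwo k (typeI k m) m ∧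
      IsGorensteinGenusTwo k (typeII k m) m ∧
      IsEmpty (typeI k m ≃ₐ[k] typeII k m) ∧
      ∀ (R : Type*) [CommRing R] [Algebra k R], IsGorensteinGenusTwo k R m →
        Nonempty (R ≃ₐ[k] typeI k m) ∨ Nonempty (R ≃ₐ[k] typeII k m)) ∧
    -- equations in type I
    (HasEquations (typeI k 2) (paramI k 2)
      (Ideal.span {MvPowerSeries.X 1 * (MvPowerSeries.X 1 ^ 3 - MvPowerSeries.X 0 ^ 2)}) ∧
    HasEquations (typeI k 3) (paramI k 3)
      (Ideal.span {MvPowerSeries.X 2 * (MvPowerSeries.X 0 - MvPowerSeries.X 1),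
        MvPowerSeries.X 2 ^ 3 - MvPowerSeries.X 0 * MvPowerSeries.X 1}) ∧
    ∀ (m : ℕ) (hm : 4 ≤ m), HasEquations (typeI k m) (paramI k m) (equationsI k m hm)) ∧
    -- equations in type II (for `m = 2` the coordinates are `x_1` and `y = t_2 ^ 3`)
    (HasEquations (typeII k 2) ![paramII k 2 0, ![0, PowerSeries.X ^ 3]]
      (Ideal.span {MvPowerSeries.X 1 * (MvPowerSeries.X 1 - MvPowerSeries.X 0 ^ 3)}) ∧
    HasEquations (typeII k 3) (paramII k 3)
      (Ideal.span {MvPowerSeries.X 0 * MvPowerSeries.X 1 *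
        (MvPowerSeries.X 1 - MvPowerSeries.X 0 ^ 2)}) ∧
    ∀ (m : ℕ) (hm : 4 ≤ m), HasEquations (typeII k m) (paramII k m) (equationsII k m hm)) := by
  refine ⟨fun m hm => ?_, ⟨hasEquations_typeI_two, hasEquations_typeI_three,
    fun m hm => hasEquations_typeI hm⟩, hasEquations_typeII_two, hasEquations_typeII_three,
    fun m hm => hasEquations_typeII hm⟩
  obtain ⟨p, l, hp, hl, hpl⟩ : ∃ p l : Fin m, p.val = 0 ∧ l.val + 1 = m ∧ p ≠ l := by
    refine ⟨⟨0, by omega⟩, ⟨m - 1, by omega⟩, rfl, by simp; omega, fun h => ?_⟩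
    have := congrArg Fin.val h
    simp at this
    omega
  rw [typeI_eq_glueI hl, typeII_eq_glueII hp hl hpl]
  exact ⟨isGorensteinGenusTwo_glueI l hm, isGorensteinGenusTwo_glueII hpl,
    isEmpty_glueI_algEquiv_glueII hm hpl, fun R _ _ hR => hR.nonempty_algEquiv h2 hm hpl⟩
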